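/- Let $\lambda\in\mathbb R$ and $1\le\eta<2$. Let $q$ be an integer with $q>\tfrac12$ and $q\ge\eta$, let $T>0$ and $\psi_0\in H^q(\mathbb R)$, and let $\psi\in C([0,T];H^q(\mathbb R))$ be a mild solution on $[0,T]$ of $$(i\partial_t+\partial_x^2)\psi=\lambda|\psi|^{2\eta}\psi,\qquad \psi(0)=\psi_0,$$ that is, $\psi(t)=e^{it\partial_x^2}\psi_0-i\lambda\int_0^t e^{i(t-\nu)\partial_x^2}\big(|\psi|^{2\eta}\psi\big)(\nu)\,d\nu$ for all $t\in[0,T]$. Put $\mathcal H(\psi)(x,t)=\int_0^t s\,|\psi(x,s)|^2\,ds$ (so that $\mathcal H(\psi)(x,0)=0$ and $\partial_t\mathcal H(\psi)=t|\psi|^2$) and, for $t\in[0,T]$, $$\mathbb P[\psi](t)=\big\|(x+2it\partial_x)\psi(\cdot,t)\big\|_{L^2(\mathbb R)}^2+\frac{4t^2\lambda}{\eta+1}\int_{\mathbb R}|\psi(x,t)|^{2\eta+2}\,dx-2\int_{\mathbb R}\partial_x^2\mathcal H(\psi)(x,t)\,dx\ \in(-\infty,+\infty],$$ with $\mathbb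 P[\psi](t)=+\infty$ if $(x+2it\partial_x)\psi(\cdot,t)\notin L^2(\mathbb R)$. Then $$\int_0^T\!\!\int_{\mathbb R}t\,|\psi(x,t)|^{2\eta+2}\,dx\,dt\ \le\ C\sup_{0\le t\le T}\mathbb P[\psi](t)$$ with a constant $C>0$ which depends only on $\lambda$ and $\eta$ if $\lambda>0$ (the defocusing case), and which for arbitrary $\lambda\in\mathbb R$ can be chosen to depend only on $\lambda$, $\eta$, $T$ and an upper bound for $\|\psi_0\|_{H^q(\mathbb R)}$. -/

import Mathlib

open MeasureTheory Set Filter Topology FourierTransform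
open scoped ENNReal NNReal ContDiff

noncomputable section

namespace NLSLine

/-- The Hilbert space `L²(ℝ; ℂ)`. -/
abbrev L2 : Type := Lp ℂ 2 (volume : Measure ℝ)

/-- The norm of `H^q(ℝ)`: `(∫ (1 + |ξ|²)^q |f̂(ξ)|² dξ)^(1/2)`, with value `∞` when
`f ∉ H^q(ℝ)`. Here `f̂` is the Fourier transform on `L²` with kernel `exp (-2πi x ξ)`. -/
def sobolevNorm (q : ℕ) (f : L2) : ℝ≥0∞ :=
  eLpNorm (fun ξ : ℝ => (((1 + ξ ^ 2) ^ ((q : ℝ) / 2) : ℝ) : ℂ) * (𝓕 f : L2) ξ) 2 volume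

/-- Membership of an `L²` function in `H^q(ℝ)`. -/
def MemH (q : ℕ) (f : L2) : Prop := sobolevNorm q f < ⊤

theorem memLp_phase_mul (t : ℝ) (g : L2) :
    MemLp (fun ξ : ℝ =>
      Complex.exp (-(4 * (Real.pi : ℂ) ^ 2 * t * (ξ : ℂ) ^ 2) * Complex.I) * g ξ) 2 volume := by
  refine (Lp.memLp g).of_le (Continuous.aestronglyMeasurable (by fun_prop) |>.mul
    (Lp.aestronglyMeasurable g)) (ae_of_all _ fun ξ => ?_)
  rw [norm_mul]
  have : ‖Complex.exp (-(4 * (Real.pi : ℂ) ^ 2 * t * (ξ : ℂ) ^ 2) * Complex.I)‖ = 1 := by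
    have h := Complex.norm_exp_ofReal_mul_I (-(4 * Real.pi ^ 2 * t * ξ ^ 2))
    push_cast at h
    exact h
  rw [this, one_mul]

/-- The free Schrödinger group `exp (itΔ)` on `L²(ℝ)`: the Fourier multiplier with symbol
`exp (-4π² i t ξ²)` (`Δ` has symbol `-4π² ξ²` for the kernel `exp (-2πi x ξ)`). -/
def schrodingerGroup (t : ℝ) (f : L2) : L2 :=
  𝓕⁻ ((memLp_phase_mul t (𝓕 f)).toLp _ : L2)

open Classical in
/-- The nonlinearity `λ |f|^{2η} f` as an element of `L²(ℝ)`. It does lie in `L²(ℝ)` whenever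
`f ∈ L² ∩ L^∞`, in particular for `f ∈ H^q(ℝ)`, `q ≥ 1`; other `f` get the value `0`. -/
def powerNonlinearity (lam η : ℝ) (f : L2) : L2 :=
  if h : MemLp (fun x : ℝ => (lam : ℂ) * ((‖f x‖ ^ (2 * η) : ℝ) : ℂ) * f x) 2 volume
  then h.toLp _ else 0

/-- `ψ` restricted to `[0, T]` is a mild `H^q(ℝ)`-valued solution, with datum `ψ₀ ∈ H^q(ℝ)`, of
`(i ∂_t + Δ) ψ = λ |ψ|^{2η} ψ`: it belongs to `C([0, T]; H^q(ℝ))` and satisfies Duhamel's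
formula on `[0, T]`. -/
structure IsMildSolution (lam η : ℝ) (q : ℕ) (T : ℝ) (ψ₀ : L2) (ψ : ℝ → L2) : Prop where
  datum_mem : MemH q ψ₀
  mem : ∀ t ∈ Icc 0 T, MemH q (ψ t)
  continuous : ∀ t ∈ Icc 0 T,
    Tendsto (fun s => sobolevNorm q (ψ s - ψ t)) (𝓝[Icc 0 T] t) (𝓝 0)
  duhamel : ∀ t ∈ Icc 0 T,
    ψ t = schrodingerGroup t ψ₀
      - Complex.I • ∫ ν in (0 : ℝ)..t, schrodingerGroup (t - ν) (powerNonlinearity lam η (ψ ν))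

/-- `g` is a `k`-th weak derivative of `f` on `ℝ`. -/
def IsWeakDeriv {E : Type} [NormedAddCommGroup E] [NormedSpace ℝ E]
    (k : ℕ) (f g : ℝ → E) : Prop :=
  LocallyIntegrable g volume ∧
    ∀ φ : ℝ → ℝ, ContDiff ℝ ∞ φ → HasCompactSupport φ →
      ∫ x, iteratedDeriv k φ x • f x = (-1 : ℝ) ^ k • ∫ x, φ x • g x

open Classical in
/-- The `k`-th weak derivative of a locally integrable function (unique up to null sets;
`0` if there is none). -/
def weakDeriv {E : Type} [NormedAddCommGroup E] [NormedSpace ℝ E]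
    (k : ℕ) (f : ℝ → E) : ℝ → E :=
  if h : ∃ g, IsWeakDeriv k f g then h.choose else 0

theorem memLp_density (f : L2) : MemLp (fun x : ℝ => ‖f x‖ ^ 2) 1 volume :=
  memLp_one_iff_integrable.2 ((memLp_two_iff_integrable_sq_norm (Lp.aestronglyMeasurable f)).1 (Lp.memLp f))

/-- The mass density `|f|²` as an element of `L¹(ℝ)`. -/
def massDensity (f : L2) : Lp ℝ 1 (volume : Measure ℝ) := (memLp_density f).toLp _

/-- The function `𝓗(ψ)(t) = ∫₀ᵗ s |ψ(s)|² ds`, an `L¹(ℝ)`-valued integral: the solution of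
`𝓗(ψ)(0) = 0`, `∂_t 𝓗(ψ)(t) = t |ψ(t)|²`. -/
def auxH (ψ : ℝ → L2) (t : ℝ) : Lp ℝ 1 (volume : Measure ℝ) :=
  ∫ s in (0 : ℝ)..t, s • massDensity (ψ s)

/-- The pseudo-conformal quantity
`𝐏[ψ](t) = ‖(x + 2it ∂_x) ψ(t)‖²_{L²} + (4 t² λ / (η + 1)) ∫ |ψ(t)|^{2η+2} dx
  - 2 ∫ ∂_x² 𝓗(ψ)(t) dx`,
which is `+∞` when `(x + 2it ∂_x) ψ(t) ∉ L²(ℝ)`. -/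
def pseudoConformal (lam η : ℝ) (ψ : ℝ → L2) (t : ℝ) : EReal :=
  ((∫⁻ x : ℝ, ‖(x : ℂ) * ψ t x + 2 * Complex.I * t * weakDeriv 1 (ψ t) x‖ₑ ^ 2 : ℝ≥0∞) : EReal)
    + ((4 * t ^ 2 * lam / (η + 1) * (∫ x : ℝ, ‖ψ t x‖ ^ (2 * η + 2))
        - 2 * ∫ x : ℝ, weakDeriv 2 (auxH ψ t) x : ℝ) : EReal)

/-- The weighted space-time integral `∫₀ᵀ ∫_ℝ t |ψ(x, t)|^{2η+2} dx dt`, with values in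
`[0, ∞]`. -/
def morawetzIntegral (η T : ℝ) (ψ : ℝ → L2) : ℝ≥0∞ :=
  ∫⁻ t in Icc 0 T, ∫⁻ x : ℝ, ENNReal.ofReal (t * ‖ψ t x‖ ^ (2 * η + 2))

/-- The estimate `∫₀ᵀ ∫_ℝ t |ψ|^{2η+2} dx dt ≤ C sup_{0 ≤ t ≤ T} 𝐏[ψ](t)`. -/
def MorawetzEstimate (lam η T C : ℝ) (ψ : ℝ → L2) : Prop :=
  (morawetzIntegral η T ψ : EReal) ≤ (C : EReal) * ⨆ t ∈ Icc 0 T, pseudoConformal lam η ψ t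

end NLSLine

end

/-! The `𝓗` term of the functional contributes nothing: `𝓗(ψ)(t)` is in `L¹`, and the integral of a
second weak derivative of an `L¹` function vanishes (`integral_weakDeriv_two_eq_zero`). If the
supremum `S` of the functional is infinite, the estimate is trivial because `C > 0`. Otherwise `J
ψ(t) = (x + 2it∂)ψ(t)` is in `L²` for every `t`, hence so is `xψ(t)`. Write `a = ‖Jψ‖`, `V = ∫
|ψ|^{2η+2}`, `X = ‖xψ₀‖`, `m = ‖ψ₀‖`. Everything rests on the pseudo-conformal law
(`IsProfile.pseudoConformal_law`) `a(t)² + 4t²λ/(η+1) V(t) = X² + 4λ(2-η)/(η+1) ∫₀ᵗ s V(s) ds`.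

For `λ > 0` the left side at `t = T` is at most `S`; dropping `X²` gives `C = (η+1)/(4λ(2-η))`.

For `λ ≤ 0` the integral on the right has the favourable sign, so `a² ≤ X² + 4|λ|t²/(η+1) V`. Mass
conservation and the pointwise bound `|ψ|² ≤ t⁻¹ m a` give `V ≤ t^{-η} m^{η+2} a^η`. The uncertainty
principle `m² ≤ 2X‖∂ψ₀‖` trades powers of `m` for `X^{2-η}`, so that `a² ≤ X² + N X^{2-η} a^η`. This
is homogeneous of degree two and `η < 2`, hence `a` is at most a constant times `X`
(`le_mul_of_sq_le`). Then `s V(s)` is at most a constant times `s^{1-η} X²`, which is integrable,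
and `X² ≤ S` is read off at `t = 0`.

The law is proved at `H¹` regularity, where `ψ` need not be differentiable in `L²`. The profile `v =
e^{-itΔ}ψ` is `C¹` in `L²`, and `xv = e^{-itΔ}Jψ`, so `‖Jψ‖ = ‖xv‖`. One differentiates the norm of
`v` multiplied by a truncated `x` and removes the truncation by dominated convergence; the
domination holds because `J` acts on the gauge-invariant nonlinearity like a derivative. The time
derivative of `V` comes from testing the equation against `H¹` functions, together with a quadratic
Taylor remainder that is `o(|s-t|)`. In the combination above the common cross term cancels. -/

noncomputable section

namespace NLSLine

/-! ### Calculus of locally absolutely continuous functions on the line. -/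

section Antiderivative

variable {E E' : Type*} [NormedAddCommGroup E] [NormedSpace ℝ E]
  [NormedAddCommGroup E'] [NormedSpace ℝ E']

/-- `F` is a locally absolutely continuous function with almost everywhere derivative `f`. -/
structure IsAntideriv (F f : ℝ → E) : Prop where
  locallyIntegrable : LocallyIntegrable f volume
  integral_eq : ∀ a b, ∫ x in a..b, f x = F b - F a

namespace IsAntideriv

variable {F f : ℝ → E}

theorem intervalIntegrable (h : IsAntideriv F f) (a b : ℝ) : IntervalIntegrable f volume a b :=
  (h.locallyIntegrable.integrableOn_isCompact isCompact_uIcc).intervalIntegrable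

theorem eq_add (h : IsAntideriv F f) (a b : ℝ) : F b = F a + ∫ x in a..b, f x := by
  rw [h.integral_eq]; abel

theorem continuous (h : IsAntideriv F f) : Continuous F := by
  have : F = fun b => F 0 + ∫ x in (0 : ℝ)..b, f x := funext fun b => h.eq_add 0 b
  rw [this]
  exact continuous_const.add (intervalIntegral.continuous_primitive h.intervalIntegrable 0)

theorem congr_deriv {f' : ℝ → E} (h : IsAntideriv F f) (hf : f =ᵐ[volume] f') :
    IsAntideriv F f' where
  locallyIntegrable := h.locallyIntegrable.congr hf
  integral_eq a b := by
    rw [← h.integral_eq]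
    exact intervalIntegral.integral_congr_ae (hf.mono fun x hx _ => hx.symm)

theorem of_contDiff (hF : ContDiff ℝ 1 F) [CompleteSpace E] : IsAntideriv F (deriv F) where
  locallyIntegrable := (hF.continuous_deriv le_rfl).locallyIntegrable
  integral_eq a b := intervalIntegral.integral_deriv_eq_sub
    (fun x _ => hF.differentiable one_ne_zero x)
    ((hF.continuous_deriv le_rfl).intervalIntegrable a b)

/-- The chain rule is obtained by approximation: on a bounded interval `f` is an `L¹` limit of
continuous `g n`, whose primitives `G n` converge uniformly to `F`. The classical chain rule for `Φ
∘ G n` passes to the limit. -/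
theorem comp_contDiff [ProperSpace E] [CompleteSpace E] [CompleteSpace E']
    (h : IsAntideriv F f) {Φ : E → E'} (hΦ : ContDiff ℝ 1 Φ) :
    IsAntideriv (fun x => Φ (F x)) (fun x => fderiv ℝ Φ (F x) (f x)) := by
  have hD : Continuous (fderiv ℝ Φ) := hΦ.continuous_fderiv one_ne_zero
  have hDF : Continuous fun x => fderiv ℝ Φ (F x) := hD.comp h.continuous
  refine ⟨?_, fun a b => ?_⟩
  · intro x
    obtain ⟨K, hK, hxK⟩ := exists_compact_mem_nhds x
    refine ⟨K, hxK, ?_⟩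
    obtain ⟨C, hC⟩ := hK.exists_bound_of_continuousOn hDF.continuousOn
    have hi := h.locallyIntegrable.integrableOn_isCompact hK
    refine (hi.norm.const_mul C).mono' ?_ ?_
    · exact (ContinuousLinearMap.apply ℝ E' : E →L[ℝ] _).aestronglyMeasurable_comp₂
        hi.aestronglyMeasurable hDF.aestronglyMeasurable
    · filter_upwards [ae_restrict_mem hK.measurableSet] with y hy
      exact ((fderiv ℝ Φ (F y)).le_opNorm _).trans (by gcongr; exact hC y hy)
  set u : ℝ → E := (uIoc a b).indicator f with hu
  have hui : Integrable u := (integrable_indicator_iff measurableSet_uIoc).2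
    (intervalIntegrable_iff.1 (h.intervalIntegrable a b))
  have hε : ∀ n : ℕ, (0 : ℝ) < 1 / ((n : ℝ) + 1) := fun n => by positivity
  choose g _ hgε hgc hgi using fun n => hui.exists_hasCompactSupport_integral_sub_le (hε n)
  set G : ℕ → ℝ → E := fun n x => F a + ∫ y in a..x, g n y with hG
  have hGd : ∀ n x, HasDerivAt (G n) (g n x) x := fun n x =>
    ((hgc n).integral_hasStrictDerivAt a x).hasDerivAt.const_add _
  have hGF : ∀ n, ∀ x ∈ uIcc a b, ‖G n x - F x‖ ≤ 1 / ((n : ℝ) + 1) := by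
    intro n x hx
    have hsub : uIoc a x ⊆ uIoc a b :=
      uIoc_subset_uIoc_of_uIcc_subset_uIcc (uIcc_subset_uIcc_left hx)
    have e : G n x - F x = -∫ y in a..x, (u y - g n y) := by
      have : ∫ y in a..x, u y = ∫ y in a..x, f y := by
        refine intervalIntegral.integral_congr_ae (ae_of_all _ fun y hy => ?_)
        exact indicator_of_mem (hsub hy) f
      rw [intervalIntegral.integral_sub hui.intervalIntegrable (hgi n).intervalIntegrable, this,
        h.integral_eq]
      simp only [hG]; abel
    rw [e, norm_neg]
    refine (intervalIntegral.norm_integral_le_integral_norm_uIoc).trans ?_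
    refine le_trans ?_ (hgε n)
    exact setIntegral_le_integral (hui.sub (hgi n)).norm (ae_of_all _ fun _ => norm_nonneg _)
  obtain ⟨R, hR⟩ := (isCompact_uIcc (a := a) (b := b)).exists_bound_of_continuousOn
    h.continuous.continuousOn
  -- The radius is `R + 1` because each `G n` stays within distance `1` of `F` on the interval.
  obtain ⟨C, hC⟩ := (isCompact_closedBall (0 : E) (R + 1)).exists_bound_of_continuousOn
    hD.continuousOn
  have hGb : ∀ n, ∀ x ∈ uIcc a b, ‖fderiv ℝ Φ (G n x)‖ ≤ C := by
    intro n x hx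
    apply hC
    rw [mem_closedBall_zero_iff]
    have h1 := hGF n x hx
    have h2 : 1 / ((n : ℝ) + 1) ≤ 1 := by
      rw [div_le_one (by positivity)]; linarith [(Nat.cast_nonneg n : (0 : ℝ) ≤ n)]
    have h3 := norm_add_le (G n x - F x) (F x)
    rw [sub_add_cancel] at h3
    linarith [hR x hx]
  have hGt : ∀ x ∈ uIcc a b, Tendsto (fun n => G n x) atTop (𝓝 (F x)) := fun x hx =>
    tendsto_iff_norm_sub_tendsto_zero.2 (squeeze_zero (fun _ => norm_nonneg _)
      (fun n => hGF n x hx) tendsto_one_div_add_atTop_nhds_zero_nat)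
  have hGc : ∀ n, Continuous fun x => fderiv ℝ Φ (G n x) := fun n =>
    hD.comp (continuous_iff_continuousAt.2 fun x => (hGd n x).continuousAt)
  have hev : ∀ n, ∫ x in a..b, fderiv ℝ Φ (G n x) (g n x) = Φ (G n b) - Φ (F a) := by
    intro n
    have : Φ (F a) = Φ (G n a) := by simp [hG]
    rw [this]
    refine intervalIntegral.integral_eq_sub_of_hasDerivAt
      (f := fun x => Φ (G n x)) (fun x _ => ?_) ?_
    · exact (hΦ.differentiable one_ne_zero (G n x)).hasFDerivAt.comp_hasDerivAt x (hGd n x)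
    · exact ((hGc n).clm_apply (hgc n)).intervalIntegrable a b
  have hif : ∀ n, IntervalIntegrable (fun x => fderiv ℝ Φ (G n x) (f x)) volume a b := by
    intro n
    refine ((h.intervalIntegrable a b).norm.const_mul C).mono_fun' ?_ ?_
    · exact (ContinuousLinearMap.apply ℝ E' : E →L[ℝ] _).aestronglyMeasurable_comp₂
        (h.intervalIntegrable a b).aestronglyMeasurable_restrict_uIoc
        (hGc n).aestronglyMeasurable
    · filter_upwards [ae_restrict_mem measurableSet_uIoc] with y hy
      exact ((fderiv ℝ Φ (G n y)).le_opNorm _).trans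
        (by gcongr; exact hGb n y (uIoc_subset_uIcc hy))
  have l1 : Tendsto (fun n => ∫ x in a..b, fderiv ℝ Φ (G n x) (f x)) atTop
      (𝓝 (∫ x in a..b, fderiv ℝ Φ (F x) (f x))) := by
    refine intervalIntegral.tendsto_integral_filter_of_dominated_convergence
      (fun x => C * ‖f x‖) (Eventually.of_forall fun n => (hif n).aestronglyMeasurable_restrict_uIoc)
      (Eventually.of_forall fun n => ae_of_all _ fun x hx => ?_)
      ((h.intervalIntegrable a b).norm.const_mul C) (ae_of_all _ fun x hx => ?_)
    · exact ((fderiv ℝ Φ (G n x)).le_opNorm _).trans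
        (by gcongr; exact hGb n x (uIoc_subset_uIcc hx))
    · have h1 : Tendsto (fun n => fderiv ℝ Φ (G n x)) atTop (𝓝 (fderiv ℝ Φ (F x))) :=
        (hD.tendsto _).comp (hGt x (uIoc_subset_uIcc hx))
      exact ((ContinuousLinearMap.apply ℝ E' (f x)).continuous.tendsto _).comp h1
  -- Replacing `g n` by `f` costs at most `C` times their `L¹` distance.
  have l2 : Tendsto (fun n => (∫ x in a..b, fderiv ℝ Φ (G n x) (g n x))
      - ∫ x in a..b, fderiv ℝ Φ (G n x) (f x)) atTop (𝓝 0) := by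
    have lC : Tendsto (fun n : ℕ => C * (1 / ((n : ℝ) + 1))) atTop (𝓝 0) := by
      simpa using tendsto_one_div_add_atTop_nhds_zero_nat.const_mul C
    refine squeeze_zero_norm (fun n => ?_) lC
    have hgi' : IntervalIntegrable (fun x => fderiv ℝ Φ (G n x) (g n x)) volume a b :=
      ((hGc n).clm_apply (hgc n)).intervalIntegrable a b
    rw [← intervalIntegral.integral_sub hgi' (hif n)]
    have hw : IntegrableOn (fun x => C * ‖u x - g n x‖) (uIoc a b) :=
      ((hui.sub (hgi n)).norm.const_mul C).integrableOn
    have hCn : 0 ≤ C := (norm_nonneg _).trans (hGb n a left_mem_uIcc)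
    calc ‖∫ x in a..b, (fderiv ℝ Φ (G n x) (g n x) - fderiv ℝ Φ (G n x) (f x))‖
        ≤ ∫ x in uIoc a b, ‖fderiv ℝ Φ (G n x) (g n x) - fderiv ℝ Φ (G n x) (f x)‖ :=
          intervalIntegral.norm_integral_le_integral_norm_uIoc
      _ ≤ ∫ x in uIoc a b, C * ‖u x - g n x‖ := by
          refine setIntegral_mono_on (intervalIntegrable_iff.1 (hgi'.sub (hif n))).norm hw
            measurableSet_uIoc fun x hx => ?_
          rw [← map_sub, hu, indicator_of_mem hx, norm_sub_rev (f x)]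
          exact ((fderiv ℝ Φ (G n x)).le_opNorm _).trans
            (by gcongr; exact hGb n x (uIoc_subset_uIcc hx))
      _ ≤ ∫ x, C * ‖u x - g n x‖ :=
          setIntegral_le_integral ((hui.sub (hgi n)).norm.const_mul C)
            (ae_of_all _ fun _ => by positivity)
      _ = C * ∫ x, ‖u x - g n x‖ := integral_const_mul _ _
      _ ≤ C * (1 / ((n : ℝ) + 1)) := by gcongr; exact hgε n
  have l3 := l2.add l1
  simp only [sub_add_cancel, zero_add] at l3
  refine tendsto_nhds_unique (l3.congr hev)
    (((hΦ.continuous.tendsto _).comp (hGt b right_mem_uIcc)).sub tendsto_const_nhds)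

theorem prodMk [CompleteSpace E] [CompleteSpace E'] {G g : ℝ → E'}
    (hF : IsAntideriv F f) (hG : IsAntideriv G g) :
    IsAntideriv (fun x => (F x, G x)) (fun x => (f x, g x)) := by
  refine ⟨fun x => ?_, fun a b => ?_⟩
  · obtain ⟨K, hK, hxK⟩ := exists_compact_mem_nhds x
    exact ⟨K, hxK, (hF.locallyIntegrable.integrableOn_isCompact hK).prodMk
      (hG.locallyIntegrable.integrableOn_isCompact hK)⟩
  · have e : ∫ x in a..b, (f x, g x) = (∫ x in a..b, f x, ∫ x in a..b, g x) := by
      simp only [intervalIntegral, integral_pair (hF.intervalIntegrable a b).1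
        (hG.intervalIntegrable a b).1, integral_pair (hF.intervalIntegrable a b).2
        (hG.intervalIntegrable a b).2, Prod.mk_sub_mk]
    rw [e, hF.integral_eq, hG.integral_eq, Prod.mk_sub_mk]

theorem mul {A : Type*} [NormedCommRing A] [NormedAlgebra ℝ A] [ProperSpace A]
    {F f G g : ℝ → A} (hF : IsAntideriv F f) (hG : IsAntideriv G g) :
    IsAntideriv (fun x => F x * G x) (fun x => F x * g x + G x * f x) := by
  have h := (hF.prodMk hG).comp_contDiff (Φ := fun p : A × A => p.1 * p.2)
    (contDiff_fst.mul contDiff_snd)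
  refine h.congr_deriv (ae_of_all _ fun x => ?_)
  have := ((hasFDerivAt_fst (𝕜 := ℝ) (p := (F x, G x))).mul
    (hasFDerivAt_snd (𝕜 := ℝ) (p := (F x, G x)))).fderiv
  simp only at this ⊢
  rw [show (fun p : A × A => p.1 * p.2) = Prod.fst * Prod.snd from rfl, this]
  simp

theorem clm_comp [CompleteSpace E] [CompleteSpace E'] (L : E →L[ℝ] E') (hF : IsAntideriv F f) :
    IsAntideriv (fun x => L (F x)) (fun x => L (f x)) := by
  refine ⟨fun x => ?_, fun a b => ?_⟩
  · obtain ⟨K, hK, hxK⟩ := exists_compact_mem_nhds x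
    exact ⟨K, hxK, L.integrable_comp (hF.locallyIntegrable.integrableOn_isCompact hK)⟩
  · rw [L.intervalIntegral_comp_comm (hF.intervalIntegrable a b), hF.integral_eq, map_sub]

section Integrable

variable (h : IsAntideriv F f) (hF : Integrable F volume) (hf : Integrable f volume)
include h hF hf

/-- An integrable derivative makes the limit exist; integrability of `F` itself excludes a nonzero
limit. -/
theorem tendsto_atTop : Tendsto F atTop (𝓝 0) := by
  have A : Tendsto F atTop (𝓝 (F 0 + ∫ x in Ioi (0 : ℝ), f x)) := by
    refine ((intervalIntegral_tendsto_integral_Ioi 0 hf.integrableOn tendsto_id).const_add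
      (F 0)).congr fun b => ?_
    rw [id, ← h.eq_add]
  have : F 0 + ∫ x in Ioi (0 : ℝ), f x = 0 := by
    refine IntegrableAtFilter.eq_zero_of_tendsto (μ := volume) ⟨univ, univ_mem, hF.integrableOn⟩
      (fun s hs => ?_) A
    rcases mem_atTop_sets.1 hs with ⟨b, hb⟩
    rw [← top_le_iff, ← Real.volume_Ici (a := b)]
    exact measure_mono hb
  rwa [this] at A

theorem tendsto_atBot : Tendsto F atBot (𝓝 0) := by
  have A : Tendsto F atBot (𝓝 (F 0 - ∫ x in Iic (0 : ℝ), f x)) := by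
    refine ((intervalIntegral_tendsto_integral_Iic 0 hf.integrableOn tendsto_id).const_sub
      (F 0)).congr fun b => ?_
    rw [id, h.integral_eq]; abel
  have : F 0 - ∫ x in Iic (0 : ℝ), f x = 0 := by
    refine IntegrableAtFilter.eq_zero_of_tendsto (μ := volume) ⟨univ, univ_mem, hF.integrableOn⟩
      (fun s hs => ?_) A
    rcases mem_atBot_sets.1 hs with ⟨b, hb⟩
    rw [← top_le_iff, ← Real.volume_Iic (a := b)]
    exact measure_mono hb
  rwa [this] at A

/-- Both boundary values at infinity vanish. Every integration by parts below is this fact applied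
to a product. -/
theorem integral_eq_zero : ∫ x, f x = 0 := by
  have A := intervalIntegral_tendsto_integral hf tendsto_neg_atTop_atBot tendsto_id
  have B := (h.tendsto_atTop hF hf).sub ((h.tendsto_atBot hF hf).comp tendsto_neg_atTop_atBot)
  rw [sub_zero] at B
  refine tendsto_nhds_unique A (B.congr fun b => ?_)
  rw [id, h.integral_eq, Function.comp]

theorem norm_le_integral (x : ℝ) : ‖F x‖ ≤ ∫ y, ‖f y‖ := by
  have B : Tendsto (fun b => ‖F x - F b‖) atBot (𝓝 ‖F x - 0‖) :=
    ((h.tendsto_atBot hF hf).const_sub (F x)).norm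
  rw [sub_zero] at B
  refine le_of_tendsto B (Eventually.of_forall fun b => ?_)
  rw [← h.integral_eq b x]
  refine intervalIntegral.norm_integral_le_integral_norm_uIoc.trans ?_
  exact setIntegral_le_integral hf.norm (ae_of_all _ fun _ => norm_nonneg _)

end Integrable

end IsAntideriv

end Antiderivative

end NLSLine

namespace NLSLine

/-! ### Multiplication operators on `L²` and the truncated position operator. -/

section BoundedMultiplication

theorem memLp_boundedMul {m : ℝ → ℂ} {C : ℝ} (hm : Measurable m) (hC : ∀ x, ‖m x‖ ≤ C) (f : L2) :
    MemLp (fun x => m x * f x) 2 volume := by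
  refine ((Lp.memLp f).norm.const_mul C).mono'
    (hm.aestronglyMeasurable.mul (Lp.aestronglyMeasurable f)) (ae_of_all _ fun x => ?_)
  rw [norm_mul]
  exact mul_le_mul_of_nonneg_right (hC x) (norm_nonneg _)

/-- Multiplication by a bounded measurable function, as a bounded operator on `L²(ℝ)`. -/
def boundedMul (m : ℝ → ℂ) (C : ℝ) (hm : Measurable m) (hC : ∀ x, ‖m x‖ ≤ C) : L2 →L[ℂ] L2 :=
  LinearMap.mkContinuous
    { toFun := fun f => (memLp_boundedMul hm hC f).toLp _
      map_add' := fun f g => by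
        rw [← MemLp.toLp_add, MemLp.toLp_eq_toLp_iff]
        filter_upwards [Lp.coeFn_add f g] with x hx
        rw [hx, Pi.add_apply, Pi.add_apply, mul_add]
      map_smul' := fun c f => by
        rw [RingHom.id_apply, ← MemLp.toLp_const_smul, MemLp.toLp_eq_toLp_iff]
        filter_upwards [Lp.coeFn_smul c f] with x hx
        rw [hx, Pi.smul_apply, Pi.smul_apply, smul_eq_mul, smul_eq_mul, mul_left_comm] } C fun f => by
    refine Lp.norm_le_mul_norm_of_ae_le_mul ?_
    filter_upwards [(memLp_boundedMul hm hC f).coeFn_toLp] with x hx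
    change ‖((memLp_boundedMul hm hC f).toLp _ : L2) x‖ ≤ _
    rw [hx, norm_mul]
    exact mul_le_mul_of_nonneg_right (hC x) (norm_nonneg _)

variable {m : ℝ → ℂ} {C : ℝ} {hm : Measurable m} {hC : ∀ x, ‖m x‖ ≤ C}

theorem boundedMul_ae (f : L2) : boundedMul m C hm hC f =ᵐ[volume] fun x => m x * f x :=
  (memLp_boundedMul hm hC f).coeFn_toLp

theorem inner_boundedMul_left (hr : ∀ x, starRingEnd ℂ (m x) = m x) (f g : L2) :
    inner ℂ (boundedMul m C hm hC f) g = inner ℂ f (boundedMul m C hm hC g) := by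
  rw [L2.inner_def, L2.inner_def]
  refine integral_congr_ae ?_
  filter_upwards [boundedMul_ae (hm := hm) (hC := hC) f,
    boundedMul_ae (hm := hm) (hC := hC) g] with x h1 h2
  rw [h1, h2, RCLike.inner_apply, RCLike.inner_apply, map_mul, hr]
  ring

/-- The cut-off `1_{|x| ≤ R}` as an operator on `L²(ℝ)`. -/
def truncate (R : ℝ) : L2 →L[ℂ] L2 :=
  boundedMul (indicator {x : ℝ | |x| ≤ R} 1) 1
    (measurable_one.indicator (measurableSet_le measurable_norm measurable_const))
    fun x => by
      by_cases hx : x ∈ {x : ℝ | |x| ≤ R}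
      · rw [indicator_of_mem hx]; simp
      · rw [indicator_of_notMem hx]; simp

/-- Multiplication by `x 1_{|x| ≤ R}` as an operator on `L²(ℝ)`. -/
def truncatedX (R : ℝ) : L2 →L[ℂ] L2 :=
  boundedMul (indicator {x : ℝ | |x| ≤ R} fun x => (x : ℂ)) |R|
    (Complex.measurable_ofReal.indicator (measurableSet_le measurable_norm measurable_const))
    fun x => by
      by_cases hx : x ∈ {x : ℝ | |x| ≤ R}
      · rw [indicator_of_mem hx, Complex.norm_real]
        exact le_trans hx (le_abs_self R)
      · rw [indicator_of_notMem hx]; simp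

theorem inner_truncate_left (R : ℝ) (f g : L2) :
    inner ℂ (truncate R f) g = inner ℂ f (truncate R g) :=
  inner_boundedMul_left (fun x => by by_cases hx : |x| ≤ R <;> simp [hx]) f g

theorem inner_truncatedX_left (R : ℝ) (f g : L2) :
    inner ℂ (truncatedX R f) g = inner ℂ f (truncatedX R g) :=
  inner_boundedMul_left (fun x => by by_cases hx : |x| ≤ R <;> simp [hx]) f g

theorem truncate_ae (R : ℝ) (f : L2) :
    truncate R f =ᵐ[volume] fun x => if |x| ≤ R then f x else 0 := by
  filter_upwards [boundedMul_ae f] with x hx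
  rw [truncate, hx]
  by_cases h : |x| ≤ R <;> simp [h]

theorem truncatedX_ae (R : ℝ) (f : L2) :
    truncatedX R f =ᵐ[volume] fun x => if |x| ≤ R then (x : ℂ) * f x else 0 := by
  filter_upwards [boundedMul_ae f] with x hx
  rw [truncatedX, hx]
  by_cases h : |x| ≤ R <;> simp [h]

end BoundedMultiplication

/-- `h = x f` in `L²(ℝ)`. -/
def IsMulX (f h : L2) : Prop := h =ᵐ[volume] fun x => (x : ℂ) * f x

theorem IsMulX.truncatedX_eq {f h : L2} (H : IsMulX f h) (R : ℝ) :
    truncatedX R f = truncate R h := by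
  refine Lp.ext ?_
  filter_upwards [truncatedX_ae R f, truncate_ae R h, H] with x h1 h2 h3
  rw [h1, h2, h3]

theorem isMulX_of_truncatedX_eq {f h : L2} (H : ∀ n : ℕ, truncatedX n f = truncate n h) :
    IsMulX f h := by
  have : ∀ᵐ x : ℝ, ∀ n : ℕ, (if |x| ≤ n then (x : ℂ) * f x else 0)
      = if |x| ≤ n then h x else 0 := by
    rw [ae_all_iff]
    intro n
    filter_upwards [truncatedX_ae n f, truncate_ae n h] with x h1 h2
    rw [← h1, ← h2, H]
  filter_upwards [this] with x hx
  obtain ⟨n, hn⟩ := exists_nat_ge |x|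
  simpa [hn] using (hx n).symm

/-- By the arithmetic-geometric mean inequality, `|f|` is dominated by `(1+x²)⁻¹ + (1+x²)|f|²`. This
makes Fourier transforms of such functions genuine integrals. -/
theorem IsMulX.integrable {f h : L2} (H : IsMulX f h) : Integrable f volume := by
  have h1 := (memLp_two_iff_integrable_sq_norm (Lp.aestronglyMeasurable f)).1 (Lp.memLp f)
  have h2 := (memLp_two_iff_integrable_sq_norm (Lp.aestronglyMeasurable h)).1 (Lp.memLp h)
  refine ((integrable_inv_one_add_sq.add h1).add h2).mono' (Lp.aestronglyMeasurable f) ?_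
  filter_upwards [H] with x hx
  simp only [Pi.add_apply, hx, norm_mul, Complex.norm_real, Real.norm_eq_abs, mul_pow, sq_abs]
  have hp : 0 < 1 + x ^ 2 := by positivity
  have : (1 + x ^ 2)⁻¹ + ‖f x‖ ^ 2 + x ^ 2 * ‖f x‖ ^ 2 - ‖f x‖
      = (1 + x ^ 2)⁻¹ * ((1 - (1 + x ^ 2) * ‖f x‖) ^ 2 + (1 + x ^ 2) * ‖f x‖) := by
    field_simp; ring
  have h0 : 0 ≤ (1 + x ^ 2)⁻¹ * ((1 - (1 + x ^ 2) * ‖f x‖) ^ 2 + (1 + x ^ 2) * ‖f x‖) := by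
    positivity
  linarith

/-- `g` is the derivative of `f` in the sense of locally absolutely continuous functions. -/
def HasL2Deriv (f g : L2) : Prop := ∃ F : ℝ → ℂ, f =ᵐ[volume] F ∧ IsAntideriv F g

theorem IsAntideriv.conj {F f : ℝ → ℂ} (h : IsAntideriv F f) :
    IsAntideriv (fun x => starRingEnd ℂ (F x)) (fun x => starRingEnd ℂ (f x)) :=
  h.clm_comp (Complex.conjCLE : ℂ →L[ℝ] ℂ)

theorem integrable_conj_mul_of_L2 (f g : L2) :
    Integrable (fun x => starRingEnd ℂ (f x) * g x) volume := by
  refine (L2.integrable_inner (𝕜 := ℂ) f g).congr (ae_of_all _ fun x => ?_)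
  simp only [RCLike.inner_apply]
  ring

theorem inner_L2_eq (f g : L2) : inner ℂ f g = ∫ x, starRingEnd ℂ (f x) * g x := by
  rw [L2.inner_def]
  refine integral_congr_ae (ae_of_all _ fun x => ?_)
  simp only [RCLike.inner_apply]
  ring

/-- Integration by parts in `H¹(ℝ)`. -/
theorem HasL2Deriv.inner_eq_neg {f g f' g' : L2} (h : HasL2Deriv f g) (h' : HasL2Deriv f' g') :
    inner ℂ f g' = -inner ℂ g f' := by
  obtain ⟨F, hF, hFg⟩ := h
  obtain ⟨F', hF', hFg'⟩ := h'
  have e1 : (fun x => starRingEnd ℂ (f x) * f' x) =ᵐ[volume]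
      fun x => starRingEnd ℂ (F x) * F' x := by
    filter_upwards [hF, hF'] with x h1 h2
    rw [h1, h2]
  have e2 : (fun x => starRingEnd ℂ (f x) * g' x + starRingEnd ℂ (g x) * f' x) =ᵐ[volume]
      fun x => starRingEnd ℂ (F x) * g' x + F' x * starRingEnd ℂ (g x) := by
    filter_upwards [hF, hF'] with x h1 h2
    rw [h1, h2]; ring
  have i2 := (integrable_conj_mul_of_L2 f g').add (integrable_conj_mul_of_L2 g f')
  have := (hFg.conj.mul hFg').integral_eq_zero ((integrable_conj_mul_of_L2 f f').congr e1)
    (i2.congr e2)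
  rw [← integral_congr_ae e2, integral_add (integrable_conj_mul_of_L2 f g')
    (integrable_conj_mul_of_L2 g f'), ← inner_L2_eq, ← inner_L2_eq] at this
  exact eq_neg_of_add_eq_zero_left this

/-! ### The Fourier transform on `L²` exchanges differentiation and multiplication by `x`. -/

section Fourier

/-- The Plancherel extension and the Fourier integral satisfy the same duality formula against test
functions, so they agree almost everywhere. -/
theorem fourier_ae_eq_of_integrable {f : L2} (hf : Integrable f volume) :
    (𝓕 f : L2) =ᵐ[volume] 𝓕 (f : ℝ → ℂ) := by
  refine ae_eq_of_integral_contDiff_smul_eq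
    ((Lp.memLp (𝓕 f : L2)).locallyIntegrable (by norm_num))
    (VectorFourier.fourierIntegral_continuous Real.continuous_fourierChar
      (by exact continuous_inner) hf).locallyIntegrable ?_
  intro g hg hgc
  have hgc' : HasCompactSupport (Complex.ofRealCLM ∘ g) := hgc.comp_left rfl
  set G : SchwartzMap ℝ ℂ := hgc'.toSchwartzMap (Complex.ofRealCLM.contDiff.comp hg)
  have h1 := congrArg (fun L : TemperedDistribution ℝ ℂ => L G)
    (Lp.fourier_toTemperedDistribution_eq f)
  simp only [TemperedDistribution.fourier_apply, Lp.toTemperedDistribution_apply,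
    SchwartzMap.fourier_coe] at h1
  refine Eq.trans h1.symm ?_
  have h2 := VectorFourier.integral_fourierIntegral_smul_eq_flip (L := innerₗ ℝ)
    Real.continuous_fourierChar continuous_inner (G.integrable (μ := volume)) hf
  rw [flip_innerₗ] at h2
  exact h2

theorem fourierInv_ae_eq_of_integrable {f : L2} (hf : Integrable f volume) :
    (𝓕⁻ f : L2) =ᵐ[volume] 𝓕⁻ (f : ℝ → ℂ) := by
  refine ae_eq_of_integral_contDiff_smul_eq
    ((Lp.memLp (𝓕⁻ f : L2)).locallyIntegrable (by norm_num))
    (VectorFourier.fourierIntegral_continuous Real.continuous_fourierChar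
      (by exact continuous_inner.neg) hf).locallyIntegrable ?_
  intro g hg hgc
  have hgc' : HasCompactSupport (Complex.ofRealCLM ∘ g) := hgc.comp_left rfl
  set G : SchwartzMap ℝ ℂ := hgc'.toSchwartzMap (Complex.ofRealCLM.contDiff.comp hg)
  have h1 := congrArg (fun L : TemperedDistribution ℝ ℂ => L G)
    (Lp.fourierInv_toTemperedDistribution_eq f)
  simp only [TemperedDistribution.fourierInv_apply, Lp.toTemperedDistribution_apply,
    SchwartzMap.fourierInv_coe] at h1
  refine Eq.trans h1.symm ?_
  have h2 := VectorFourier.integral_fourierIntegral_smul_eq_flip (L := -innerₗ ℝ)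
    Real.continuous_fourierChar continuous_inner.neg (G.integrable (μ := volume)) hf
  rw [show (-innerₗ ℝ : ℝ →ₗ[ℝ] ℝ →ₗ[ℝ] ℝ).flip = -innerₗ ℝ by
    ext; simp] at h2
  exact h2

theorem fourier_real_eq (f : ℝ → ℂ) (ξ : ℝ) :
    𝓕 f ξ = ∫ x : ℝ, Complex.exp (-(2 * Real.pi * Complex.I) * ξ * x) * f x := by
  rw [Real.fourier_eq']
  refine integral_congr_ae (ae_of_all _ fun x => ?_)
  simp only [smul_eq_mul]
  congr 2
  simp only [RCLike.inner_apply, conj_trivial]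
  push_cast; ring

theorem fourierInv_real_eq (f : ℝ → ℂ) (ξ : ℝ) :
    𝓕⁻ f ξ = ∫ x : ℝ, Complex.exp ((2 * Real.pi * Complex.I) * ξ * x) * f x := by
  rw [Real.fourierInv_eq']
  refine integral_congr_ae (ae_of_all _ fun x => ?_)
  simp only [smul_eq_mul]
  congr 2
  simp only [RCLike.inner_apply, conj_trivial]
  push_cast; ring

theorem norm_exp_imag_mul (r : ℝ) (c : ℂ) (hc : c = r * Complex.I) (x y : ℝ) :
    ‖Complex.exp (c * x * y)‖ = 1 := by
  rw [hc, show (r : ℂ) * Complex.I * x * y = ((r * x * y : ℝ) : ℂ) * Complex.I by push_cast; ring]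
  exact Complex.norm_exp_ofReal_mul_I _

/-- The Fourier kernel is antidifferentiated in frequency by the transform of an interval. -/
theorem isAntideriv_kernel_integral {f h g : L2} (H : IsMulX f h) (r : ℝ) {c : ℂ}
    (hc : c = r * Complex.I)
    (hg : ∀ a b, a ≤ b → ∫ ξ in Ioc a b, g ξ
      = ∫ x : ℝ, (∫ ξ : ℝ in a..b, Complex.exp (c * x * ξ)) * h x) :
    IsAntideriv (fun ξ : ℝ => ∫ x : ℝ, Complex.exp (c * ξ * x) * f x) (c • g : L2) := by
  have hint : ∀ ξ : ℝ, Integrable (fun x : ℝ => Complex.exp (c * ξ * x) * f x) := fun ξ => by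
    refine H.integrable.norm.mono' ((Continuous.aestronglyMeasurable (by fun_prop)).mul
      (Lp.aestronglyMeasurable f)) (ae_of_all _ fun x => ?_)
    rw [norm_mul, norm_exp_imag_mul r c hc, one_mul]
  have key : ∀ a b, a ≤ b → ∫ ξ in a..b, (c • g : L2) ξ
      = (∫ x : ℝ, Complex.exp (c * b * x) * f x) - ∫ x : ℝ, Complex.exp (c * a * x) * f x := by
    intro a b hab
    have e1 : ∫ ξ in a..b, (c • g : L2) ξ = ∫ ξ in a..b, c * g ξ :=
      intervalIntegral.integral_congr_ae ((Lp.coeFn_smul c g).mono fun x hx _ => by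
        rw [hx, Pi.smul_apply, smul_eq_mul])
    rw [e1, intervalIntegral.integral_const_mul, intervalIntegral.integral_of_le hab, hg a b hab,
      ← integral_const_mul, ← integral_sub (hint b) (hint a)]
    refine integral_congr_ae ?_
    filter_upwards [H] with x hx
    -- The factor `x` supplied by `h = x f` completes the kernel to an exact `ξ`-derivative.
    have e2 : ∫ ξ in a..b, (c * x) * Complex.exp (c * x * ξ)
        = Complex.exp (c * x * b) - Complex.exp (c * x * a) := by
      refine intervalIntegral.integral_eq_sub_of_hasDerivAt (f := fun ξ : ℝ =>
        Complex.exp (c * x * ξ)) (fun ξ _ => ?_) (Continuous.intervalIntegrable (by fun_prop) _ _)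
      have h1 : HasDerivAt (fun ξ : ℝ => c * x * (ξ : ℂ)) (c * x * 1) ξ :=
        (Complex.ofRealCLM.hasDerivAt (x := ξ)).const_mul (c * x)
      have h2 := h1.cexp
      rwa [mul_one, mul_comm (Complex.exp _)] at h2
    rw [intervalIntegral.integral_const_mul] at e2
    rw [hx, show c * ((∫ ξ in a..b, Complex.exp (c * x * ξ)) * (x * f x))
      = ((c * x) * ∫ ξ in a..b, Complex.exp (c * x * ξ)) * f x by ring, e2, sub_mul]
    simp only [mul_right_comm c]
  refine ⟨(Lp.memLp (c • g)).locallyIntegrable (by norm_num), fun a b => ?_⟩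
  rcases le_total a b with hab | hab
  · exact key a b hab
  · rw [intervalIntegral.integral_symm, key b a hab]; ring

theorem inner_fourier_right (f g : L2) : inner ℂ f (𝓕 g : L2) = inner ℂ (𝓕⁻ f : L2) g := by
  rw [← Lp.inner_fourier_eq (𝓕⁻ f : L2), fourier_fourierInv_eq]

theorem inner_fourierInv_right (f g : L2) : inner ℂ f (𝓕⁻ g : L2) = inner ℂ (𝓕 f : L2) g := by
  rw [← Lp.inner_fourier_eq, fourier_fourierInv_eq]

theorem integrable_indicatorConst (a b : ℝ) :
    Integrable (indicatorConstLp 2 (μ := volume) (measurableSet_Ioc (a := a) (b := b))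
      measure_Ioc_lt_top.ne (1 : ℂ) : L2) volume :=
  ((integrable_indicator_iff measurableSet_Ioc).2
    (integrableOn_const measure_Ioc_lt_top.ne)).congr indicatorConstLp_coeFn.symm

theorem setIntegral_eq_inner (g : L2) (a b : ℝ) : ∫ ξ in Ioc a b, g ξ
    = inner ℂ (indicatorConstLp 2 (μ := volume) (measurableSet_Ioc (a := a) (b := b))
      measure_Ioc_lt_top.ne (1 : ℂ) : L2) g :=
  (L2.inner_indicatorConstLp_one measurableSet_Ioc _ g).symm

theorem integral_exp_mul_indicatorConst (c : ℂ) {a b : ℝ} (hab : a ≤ b) (x : ℝ) :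
    ∫ ξ : ℝ, Complex.exp (c * x * ξ) * (indicatorConstLp 2 (μ := volume)
      (measurableSet_Ioc (a := a) (b := b)) measure_Ioc_lt_top.ne (1 : ℂ) : L2) ξ
      = ∫ ξ : ℝ in a..b, Complex.exp (c * x * ξ) := by
  rw [intervalIntegral.integral_of_le hab, ← integral_indicator measurableSet_Ioc]
  refine integral_congr_ae ?_
  filter_upwards [indicatorConstLp_coeFn (p := 2) (μ := volume)
    (hs := measurableSet_Ioc (a := a) (b := b)) (hμs := measure_Ioc_lt_top.ne) (c := (1 : ℂ))]
    with ξ hξ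
  rw [hξ]
  by_cases h : ξ ∈ Ioc a b <;> simp [h]

theorem conj_integral_exp (c : ℂ) (a b x : ℝ) :
    starRingEnd ℂ (∫ ξ : ℝ in a..b, Complex.exp (c * x * ξ))
      = ∫ ξ : ℝ in a..b, Complex.exp (starRingEnd ℂ c * x * ξ) := by
  rw [intervalIntegral, intervalIntegral, map_sub, ← integral_conj, ← integral_conj]
  simp only [← Complex.exp_conj, map_mul, Complex.conj_ofReal]

/-- If `x f ∈ L²` then `𝓕 f` is differentiable with derivative `-2πi 𝓕 (x f)`. -/
theorem IsMulX.hasL2Deriv_fourier {f h : L2} (H : IsMulX f h) :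
    HasL2Deriv (𝓕 f) ((-(2 * Real.pi * Complex.I)) • (𝓕 h : L2)) := by
  refine ⟨_, (fourier_ae_eq_of_integrable H.integrable).trans
    (ae_of_all _ fun ξ => fourier_real_eq f ξ),
    isAntideriv_kernel_integral H (-(2 * Real.pi)) (by push_cast; ring) fun a b hab => ?_⟩
  -- As `h` is only in `L²`, its transform is not a convergent integral; Plancherel against the
  -- indicator of the interval takes the place of Fubini.
  rw [setIntegral_eq_inner, inner_fourier_right, inner_L2_eq]
  refine integral_congr_ae ?_
  filter_upwards [fourierInv_ae_eq_of_integrable (integrable_indicatorConst a b)] with x hx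
  rw [hx, fourierInv_real_eq, integral_exp_mul_indicatorConst _ hab, conj_integral_exp]
  simp [show starRingEnd ℂ 2 = 2 from map_ofNat _ 2]

/-- If `ξ f ∈ L²` then `𝓕⁻ f` is differentiable with derivative `2πi 𝓕⁻ (ξ f)`. -/
theorem IsMulX.hasL2Deriv_fourierInv {f h : L2} (H : IsMulX f h) :
    HasL2Deriv (𝓕⁻ f) ((2 * Real.pi * Complex.I) • (𝓕⁻ h : L2)) := by
  refine ⟨_, (fourierInv_ae_eq_of_integrable H.integrable).trans
    (ae_of_all _ fun ξ => fourierInv_real_eq f ξ),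
    isAntideriv_kernel_integral H (2 * Real.pi) (by push_cast; ring) fun a b hab => ?_⟩
  rw [setIntegral_eq_inner, inner_fourierInv_right, inner_L2_eq]
  refine integral_congr_ae ?_
  filter_upwards [fourier_ae_eq_of_integrable (integrable_indicatorConst a b)] with x hx
  rw [hx, fourier_real_eq, integral_exp_mul_indicatorConst _ hab, conj_integral_exp]
  simp [show starRingEnd ℂ 2 = 2 from map_ofNat _ 2]

theorem truncate_truncate (R : ℝ) (f : L2) : truncate R (truncate R f) = truncate R f := by
  refine Lp.ext ?_
  filter_upwards [truncate_ae R (truncate R f), truncate_ae R f] with x h1 h2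
  rw [h1, h2]
  by_cases h : |x| ≤ R <;> simp [h]

theorem truncate_truncatedX (R : ℝ) (f : L2) :
    truncate R (truncatedX R f) = truncatedX R f := by
  refine Lp.ext ?_
  filter_upwards [truncate_ae R (truncatedX R f), truncatedX_ae R f] with x h1 h2
  rw [h1, h2]
  by_cases h : |x| ≤ R <;> simp [h]

theorem isMulX_truncate (R : ℝ) (f : L2) : IsMulX (truncate R f) (truncatedX R f) := by
  filter_upwards [truncatedX_ae R f, truncate_ae R f] with x h1 h2
  rw [h1, h2]
  by_cases h : |x| ≤ R <;> simp [h]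

/-- A weak formulation of `h = x f`. -/
theorem isMulX_of_inner {f h : L2}
    (H : ∀ w w' : L2, IsMulX w w' → inner ℂ w' f = inner ℂ w h) : IsMulX f h := by
  refine isMulX_of_truncatedX_eq fun n => sub_eq_zero.1 ?_
  -- The test function is the truncated discrepancy itself, so the hypothesis gives `⟪w, w⟫ = 0`.
  set w := truncatedX n f - truncate n h with hw
  have h1 := H _ _ (isMulX_truncate n w)
  have h2 : truncate n w = w := by
    rw [hw, map_sub, truncate_truncatedX, truncate_truncate]
  rw [inner_truncatedX_left, inner_truncate_left] at h1
  have : inner ℂ w w = 0 := by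
    nth_rw 2 [hw]
    rw [inner_sub_right, h1, sub_self]
  exact inner_self_eq_zero.1 this

/-- This converse goes by duality: if `ξw ∈ L²` then `𝓕⁻ w` is differentiable, and integration by
parts against `f` is the weak form of the claim. -/
theorem HasL2Deriv.isMulX_fourier {f g : L2} (H : HasL2Deriv f g) :
    IsMulX (𝓕 f) ((2 * Real.pi * Complex.I)⁻¹ • (𝓕 g : L2)) := by
  refine isMulX_of_inner fun w w' hw => ?_
  have h1 := hw.hasL2Deriv_fourierInv.inner_eq_neg H
  rw [inner_smul_left] at h1
  rw [inner_smul_right, inner_fourier_right, inner_fourier_right, h1]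
  simp only [map_mul, Complex.conj_I, Complex.conj_ofReal, map_ofNat]
  have : (Real.pi : ℂ) ≠ 0 := by exact_mod_cast Real.pi_ne_zero
  field_simp

theorem HasL2Deriv.isMulX_fourierInv {f g : L2} (H : HasL2Deriv f g) :
    IsMulX (𝓕⁻ f) ((-(2 * Real.pi * Complex.I))⁻¹ • (𝓕⁻ g : L2)) := by
  refine isMulX_of_inner fun w w' hw => ?_
  have h1 := hw.hasL2Deriv_fourier.inner_eq_neg H
  rw [inner_smul_left] at h1
  rw [inner_smul_right, inner_fourierInv_right, inner_fourierInv_right, h1]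
  simp only [map_mul, map_neg, Complex.conj_I, Complex.conj_ofReal, map_ofNat]
  have : (Real.pi : ℂ) ≠ 0 := by exact_mod_cast Real.pi_ne_zero
  field_simp

end Fourier

end NLSLine

namespace NLSLine

/-! ### The free Schrödinger group: isometry, commutation with `x`, weak differentiability. -/

section Group

theorem fourier_L2_sub (f g : L2) : (𝓕 (f - g) : L2) = 𝓕 f - 𝓕 g :=
  (Lp.fourierTransformₗᵢ ℝ ℂ).map_sub f g

/-- The symbol of the free Schrödinger group. -/
def phase (t ξ : ℝ) : ℂ :=
  Complex.exp (-(4 * (Real.pi : ℂ) ^ 2 * t * (ξ : ℂ) ^ 2) * Complex.I)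

theorem norm_phase (t ξ : ℝ) : ‖phase t ξ‖ = 1 := by
  have h := Complex.norm_exp_ofReal_mul_I (-(4 * Real.pi ^ 2 * t * ξ ^ 2))
  push_cast at h
  exact h

theorem phase_add (s t ξ : ℝ) : phase (s + t) ξ = phase s ξ * phase t ξ := by
  simp only [phase, ← Complex.exp_add]
  congr 1; push_cast; ring

theorem phase_zero (ξ : ℝ) : phase 0 ξ = 1 := by simp [phase]

theorem conj_phase_mul_phase (t ξ : ℝ) : starRingEnd ℂ (phase t ξ) * phase t ξ = 1 := by
  rw [mul_comm, Complex.mul_conj, Complex.normSq_eq_norm_sq, norm_phase]; simp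

theorem continuous_phase (t : ℝ) : Continuous (phase t) := by
  unfold phase; fun_prop

theorem hasDerivAt_phase_time (t ξ : ℝ) :
    HasDerivAt (fun s => phase s ξ) (-(4 * (Real.pi : ℂ) ^ 2 * ξ ^ 2 * Complex.I) * phase t ξ)
      t := by
  have h1 : HasDerivAt (fun s : ℝ => (s : ℂ)) 1 t := Complex.ofRealCLM.hasDerivAt
  have h2 := ((h1.const_mul (-(4 * (Real.pi : ℂ) ^ 2 * ξ ^ 2 * Complex.I)))).cexp
  refine (h2.congr_deriv ?_).congr_of_eventuallyEq (Eventually.of_forall fun s => ?_)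
  · rw [mul_one, mul_comm]; congr 1; simp only [phase]; congr 1; ring
  · simp only [phase]; congr 1; ring

theorem hasDerivAt_phase (t ξ : ℝ) :
    HasDerivAt (phase t) (-(8 * (Real.pi : ℂ) ^ 2 * t * ξ * Complex.I) * phase t ξ) ξ := by
  have h1 : HasDerivAt (fun s : ℝ => (s : ℂ) ^ 2) (2 * (ξ : ℂ)) ξ := by
    simpa using (Complex.ofRealCLM.hasDerivAt (x := ξ)).fun_pow 2
  have h2 := ((h1.const_mul (-(4 * (Real.pi : ℂ) ^ 2 * t * Complex.I)))).cexp
  refine (h2.congr_deriv ?_).congr_of_eventuallyEq (Eventually.of_forall fun s => ?_)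
  · rw [mul_comm]; simp only [phase]
    rw [show -(4 * (Real.pi : ℂ) ^ 2 * t * Complex.I) * (ξ : ℂ) ^ 2
      = -(4 * (Real.pi : ℂ) ^ 2 * t * (ξ : ℂ) ^ 2) * Complex.I by ring]
    ring
  · simp only [phase]; congr 1; ring

/-- Multiplication by the symbol of the free Schrödinger group. -/
def phaseMul (t : ℝ) : L2 →L[ℂ] L2 :=
  boundedMul (phase t) 1 (continuous_phase t).measurable fun ξ => (norm_phase t ξ).le

theorem phaseMul_ae (t : ℝ) (f : L2) : phaseMul t f =ᵐ[volume] fun ξ => phase t ξ * f ξ :=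
  boundedMul_ae f

/-- The free Schrödinger group as a family of bounded operators. -/
def freeEvolution (t : ℝ) : L2 →L[ℂ] L2 :=
  (Lp.fourierTransformₗᵢ ℝ ℂ).symm.toContinuousLinearEquiv.toContinuousLinearMap.comp
    ((phaseMul t).comp (Lp.fourierTransformₗᵢ ℝ ℂ).toContinuousLinearEquiv.toContinuousLinearMap)

theorem freeEvolution_eq (t : ℝ) (f : L2) :
    freeEvolution t f = (𝓕⁻ (phaseMul t (𝓕 f)) : L2) := rfl

theorem schrodingerGroup_eq (t : ℝ) (f : L2) : schrodingerGroup t f = freeEvolution t f := rfl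

theorem phaseMul_add (s t : ℝ) (f : L2) : phaseMul (s + t) f = phaseMul s (phaseMul t f) := by
  refine Lp.ext ?_
  filter_upwards [phaseMul_ae (s + t) f, phaseMul_ae s (phaseMul t f), phaseMul_ae t f]
    with x h1 h2 h3
  rw [h1, h2, h3, phase_add, mul_assoc]

theorem phaseMul_zero (f : L2) : phaseMul 0 f = f := by
  refine Lp.ext ?_
  filter_upwards [phaseMul_ae 0 f] with x h1
  rw [h1, phase_zero, one_mul]

theorem freeEvolution_add (s t : ℝ) (f : L2) :
    freeEvolution (s + t) f = freeEvolution s (freeEvolution t f) := by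
  simp only [freeEvolution_eq, fourier_fourierInv_eq, phaseMul_add]

theorem freeEvolution_zero (f : L2) : freeEvolution 0 f = f := by
  simp only [freeEvolution_eq, phaseMul_zero, fourierInv_fourier_eq]

theorem freeEvolution_neg_apply (t : ℝ) (f : L2) :
    freeEvolution (-t) (freeEvolution t f) = f := by
  rw [← freeEvolution_add, neg_add_cancel, freeEvolution_zero]

theorem freeEvolution_apply_neg (t : ℝ) (f : L2) :
    freeEvolution t (freeEvolution (-t) f) = f := by
  rw [← freeEvolution_add, add_neg_cancel, freeEvolution_zero]

theorem inner_fourierInv_eq (f g : L2) :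
    inner ℂ (𝓕⁻ f : L2) (𝓕⁻ g : L2) = inner ℂ f g := by
  rw [inner_fourierInv_right, fourier_fourierInv_eq]

theorem inner_phaseMul (t : ℝ) (f g : L2) :
    inner ℂ (phaseMul t f) (phaseMul t g) = inner ℂ f g := by
  rw [inner_L2_eq, inner_L2_eq]
  refine integral_congr_ae ?_
  filter_upwards [phaseMul_ae t f, phaseMul_ae t g] with x h1 h2
  rw [h1, h2, map_mul]
  linear_combination starRingEnd ℂ (f x) * g x * conj_phase_mul_phase t x

theorem inner_freeEvolution (t : ℝ) (f g : L2) :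
    inner ℂ (freeEvolution t f) (freeEvolution t g) = inner ℂ f g := by
  simp only [freeEvolution_eq, inner_fourierInv_eq, inner_phaseMul, Lp.inner_fourier_eq]

theorem norm_freeEvolution (t : ℝ) (f : L2) : ‖freeEvolution t f‖ = ‖f‖ := by
  rw [@norm_eq_sqrt_re_inner ℂ, @norm_eq_sqrt_re_inner ℂ _ _ _ _ f, inner_freeEvolution]

/-- The commutation rule `x e^{itΔ} = e^{itΔ} (x - 2it ∂_x)`. -/
theorem IsMulX.freeEvolution {f h g : L2} (H : IsMulX f h) (D : HasL2Deriv f g) (t : ℝ) :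
    IsMulX (freeEvolution t f) (NLSLine.freeEvolution t (h - (2 * Complex.I * t) • g)) := by
  have hpi : (Real.pi : ℂ) ≠ 0 := by exact_mod_cast Real.pi_ne_zero
  -- In frequency the rule is the Leibniz rule for `phase t * 𝓕 f`; differentiating the phase
  -- produces a multiple of `tξ 𝓕 f`, that is, of `t 𝓕 g`.
  have key : HasL2Deriv (phaseMul t (𝓕 f))
      (phaseMul t (-(2 * Real.pi * Complex.I) • (𝓕 (h - (2 * Complex.I * t) • g) : L2))) := by
    obtain ⟨F, hF, hFd⟩ := H.hasL2Deriv_fourier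
    have hp : ContDiff ℝ 1 (phase t) := by
      unfold phase
      exact Complex.contDiff_exp.comp (n := 1) (𝕜 := ℝ)
        (((contDiff_const.mul (Complex.ofRealCLM.contDiff.pow 2)).neg).mul contDiff_const)
    refine ⟨fun ξ => phase t ξ * F ξ, ?_, ?_⟩
    · filter_upwards [phaseMul_ae t (𝓕 f), hF] with x h1 h2
      rw [h1, h2]
    · refine ((IsAntideriv.of_contDiff hp).mul hFd).congr_deriv ?_
      have e1 : (𝓕 (h - (2 * Complex.I * t) • g) : L2)
          = (𝓕 h : L2) - (2 * Complex.I * t) • (𝓕 g : L2) := by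
        rw [fourier_L2_sub, FourierTransform.fourier_smul]
      rw [e1]
      filter_upwards [phaseMul_ae t (-(2 * Real.pi * Complex.I) •
          ((𝓕 h : L2) - (2 * Complex.I * t) • (𝓕 g : L2))), hF, D.isMulX_fourier,
        Lp.coeFn_smul (-(2 * Real.pi * Complex.I)) ((𝓕 h : L2) - (2 * Complex.I * t) • (𝓕 g : L2)),
        Lp.coeFn_sub (𝓕 h : L2) ((2 * Complex.I * t) • (𝓕 g : L2)),
        Lp.coeFn_smul (2 * Complex.I * t) (𝓕 g : L2),
        Lp.coeFn_smul (-(2 * Real.pi * Complex.I)) (𝓕 h : L2),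
        Lp.coeFn_smul (2 * Real.pi * Complex.I)⁻¹ (𝓕 g : L2)] with x h1 h2 h3 h4 h5 h6 h7 h8
      rw [h1, h4, Pi.smul_apply, h5, Pi.sub_apply, h6, h7, (hasDerivAt_phase t x).deriv]
      rw [h8, Pi.smul_apply, h2] at h3
      simp only [Pi.smul_apply, smul_eq_mul] at h3 ⊢
      have h9 : (𝓕 g : L2) x = (2 * Real.pi * Complex.I) * (x * F x) := by
        rw [← h3]; field_simp
      rw [h9]
      linear_combination (-4 * (Real.pi : ℂ) ^ 2 * Complex.I * (2 * t) * x * F x * phase t x) * Complex.I_sq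
  have h1 := key.isMulX_fourierInv
  rw [map_smul, FourierTransform.fourierInv_smul, smul_smul, inv_mul_cancel₀ (by
    simp [hpi]), one_smul] at h1
  exact h1

/-- Weak differentiability of the free evolution of an `H¹` function. -/
theorem hasDerivAt_inner_freeEvolution {f g f' g' : L2} (hf : HasL2Deriv f f')
    (hg : HasL2Deriv g g') :
    HasDerivAt (fun t => inner ℂ f (freeEvolution t g)) (-Complex.I * inner ℂ f' g') 0 := by
  have hpi : (Real.pi : ℂ) ≠ 0 := by exact_mod_cast Real.pi_ne_zero
  set a : L2 := (2 * Real.pi * Complex.I)⁻¹ • (𝓕 f' : L2) with ha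
  set b : L2 := (2 * Real.pi * Complex.I)⁻¹ • (𝓕 g' : L2) with hb
  have ha' : IsMulX (𝓕 f) a := hf.isMulX_fourier
  have hb' : IsMulX (𝓕 g) b := hg.isMulX_fourier
  have e1 : ∀ t, inner ℂ f (freeEvolution t g)
      = ∫ ξ, starRingEnd ℂ ((𝓕 f : L2) ξ) * (phase t ξ * (𝓕 g : L2) ξ) := by
    intro t
    rw [freeEvolution_eq, inner_fourierInv_right, inner_L2_eq]
    refine integral_congr_ae ?_
    filter_upwards [phaseMul_ae t (𝓕 g)] with ξ h
    rw [h]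
  have hint : ∀ t, Integrable fun ξ =>
      starRingEnd ℂ ((𝓕 f : L2) ξ) * (phase t ξ * (𝓕 g : L2) ξ) := by
    intro t
    refine (integrable_conj_mul_of_L2 (𝓕 f) (phaseMul t (𝓕 g))).congr ?_
    filter_upwards [phaseMul_ae t (𝓕 g)] with ξ h
    rw [h]
  -- The time derivative costs `ξ²`; one factor `ξ` is given to each of `f` and `g`, so a single
  -- derivative on each side suffices.
  have hbd : ∀ t, ∀ᵐ ξ : ℝ, starRingEnd ℂ ((𝓕 f : L2) ξ) *
      ((-(4 * (Real.pi : ℂ) ^ 2 * ξ ^ 2 * Complex.I) * phase t ξ) * (𝓕 g : L2) ξ)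
      = -(4 * (Real.pi : ℂ) ^ 2 * Complex.I) * phase t ξ * (starRingEnd ℂ (a ξ) * b ξ) := by
    intro t
    filter_upwards [ha', hb'] with ξ h1 h2
    rw [h1, h2, map_mul, Complex.conj_ofReal]
    ring
  have hint' : ∀ t, Integrable fun ξ : ℝ => starRingEnd ℂ ((𝓕 f : L2) ξ) *
      ((-(4 * (Real.pi : ℂ) ^ 2 * ξ ^ 2 * Complex.I) * phase t ξ) * (𝓕 g : L2) ξ) := by
    intro t
    refine ((integrable_conj_mul_of_L2 a b).norm.const_mul (4 * Real.pi ^ 2)).mono' ?_ ?_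
    · exact (Complex.continuous_conj.comp_aestronglyMeasurable (Lp.aestronglyMeasurable _)).mul
        ((Continuous.aestronglyMeasurable (by unfold phase; fun_prop)).mul
          (Lp.aestronglyMeasurable _))
    · filter_upwards [hbd t] with ξ h
      rw [h, norm_mul, norm_mul, norm_phase, mul_one]
      gcongr
      simp [abs_of_pos Real.pi_pos]
  have main := (hasDerivAt_integral_of_dominated_loc_of_deriv_le (μ := volume) (𝕜 := ℝ)
    (F := fun t ξ => starRingEnd ℂ ((𝓕 f : L2) ξ) * (phase t ξ * (𝓕 g : L2) ξ))
    (F' := fun t ξ => starRingEnd ℂ ((𝓕 f : L2) ξ) *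
      ((-(4 * (Real.pi : ℂ) ^ 2 * ξ ^ 2 * Complex.I) * phase t ξ) * (𝓕 g : L2) ξ))
    (x₀ := 0) (s := univ) (bound := fun ξ => 4 * Real.pi ^ 2 * ‖starRingEnd ℂ (a ξ) * b ξ‖)
    univ_mem (Eventually.of_forall fun t => (hint t).aestronglyMeasurable) (hint 0)
    (hint' 0).aestronglyMeasurable ?_ ((integrable_conj_mul_of_L2 a b).norm.const_mul _) ?_).2
  · simp only [← e1] at main
    refine main.congr_deriv ?_
    rw [integral_congr_ae (hbd 0)]
    simp only [phase_zero, mul_one]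
    rw [integral_const_mul, ← inner_L2_eq, ha, hb, inner_smul_left, inner_smul_right,
      Lp.inner_fourier_eq]
    simp only [map_inv₀, map_mul, Complex.conj_I, Complex.conj_ofReal, map_ofNat]
    field_simp
    rw [Complex.I_sq]; ring
  · filter_upwards [ha', hb'] with ξ h1 h2 t _
    simp only [h1, h2, norm_mul, norm_phase, RCLike.norm_conj, norm_neg, norm_pow,
      Complex.norm_real, Complex.norm_I, Complex.norm_ofNat, mul_one, Real.norm_eq_abs,
      abs_of_pos Real.pi_pos]
    apply le_of_eq; ring
  · refine ae_of_all _ fun ξ t _ => ?_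
    exact ((hasDerivAt_phase_time t ξ).mul_const _).const_mul _

/-- By unitarity the square is `2‖f‖² - 2 Re ⟪f, e^{itΔ}f⟫`, and the derivative of the inner product
at `0` is `-i‖f'‖²`, which is purely imaginary. So increments of an `H¹` orbit are `o(|t|^{1/2})`.
-/
theorem norm_sub_sq_isLittleO {f f' : L2} (hf : HasL2Deriv f f') :
    (fun t => ‖freeEvolution t f - f‖ ^ 2) =o[𝓝 0] fun t : ℝ => t := by
  have h := hasDerivAt_inner_freeEvolution hf hf
  have h1 : HasDerivAt (fun t => (inner ℂ f (freeEvolution t f)).re) 0 0 := by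
    have := (Complex.reCLM.hasFDerivAt.comp_hasDerivAt (0 : ℝ) h)
    refine this.congr_deriv ?_
    simp only [Complex.reCLM_apply, neg_mul, Complex.neg_re, Complex.mul_re, Complex.I_re,
      Complex.I_im, zero_mul, one_mul, zero_sub, neg_neg]
    exact inner_self_im (𝕜 := ℂ) f'
  have h2 := (hasDerivAt_iff_isLittleO.1 h1).const_mul_left (-2)
  refine h2.congr (fun t => ?_) (fun t => sub_zero t)
  have := @norm_sub_sq ℂ _ _ _ _ (freeEvolution t f) f
  rw [this, norm_freeEvolution, freeEvolution_zero, smul_zero, sub_zero]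
  have e1 : RCLike.re (inner ℂ (freeEvolution t f) f) = (inner ℂ f (freeEvolution t f)).re :=
    inner_re_symm (𝕜 := ℂ) _ _
  have e2 : (inner ℂ f f).re = ‖f‖ ^ 2 := by
    rw [@norm_sq_eq_re_inner ℂ]; rfl
  rw [e1, e2]; ring

theorem continuous_freeEvolution_apply (f : L2) : Continuous fun t => freeEvolution t f := by
  have e1 : ∀ t, (inner ℂ f (freeEvolution t f)).re
      = (∫ ξ, phase t ξ * (starRingEnd ℂ ((𝓕 f : L2) ξ) * (𝓕 f : L2) ξ)).re := by
    intro t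
    rw [freeEvolution_eq, inner_fourierInv_right, inner_L2_eq]
    congr 1
    refine integral_congr_ae ?_
    filter_upwards [phaseMul_ae t (𝓕 f)] with ξ h
    rw [h]; ring
  have hi := integrable_conj_mul_of_L2 (𝓕 f) (𝓕 f)
  have c1 : Continuous fun t => (inner ℂ f (freeEvolution t f)).re := by
    simp only [e1]
    refine Complex.continuous_re.comp (continuous_of_dominated
      (bound := fun ξ => ‖starRingEnd ℂ ((𝓕 f : L2) ξ) * (𝓕 f : L2) ξ‖) (fun t => ?_)
      (fun t => ae_of_all _ fun ξ => ?_) hi.norm (ae_of_all _ fun ξ => ?_))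
    · exact (continuous_phase t).aestronglyMeasurable.mul hi.aestronglyMeasurable
    · rw [norm_mul, norm_phase, one_mul]
    · unfold phase; fun_prop
  have e2 : ∀ s t, ‖freeEvolution s f - freeEvolution t f‖ ^ 2
      = 2 * ‖f‖ ^ 2 - 2 * (inner ℂ f (freeEvolution (t - s) f)).re := by
    intro s t
    have h1 := @norm_sub_sq ℂ _ _ _ _ (freeEvolution s f) (freeEvolution t f)
    rw [h1, norm_freeEvolution, norm_freeEvolution, show t = s + (t - s) by ring,
      freeEvolution_add, inner_freeEvolution, show s + (t - s) - s = t - s by ring]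
    simp only [RCLike.re_eq_complex_re]
    ring
  refine continuous_iff_continuousAt.2 fun t => tendsto_iff_norm_sub_tendsto_zero.2 ?_
  have c2 : Tendsto (fun s => Real.sqrt (‖freeEvolution s f - freeEvolution t f‖ ^ 2)) (𝓝 t)
      (𝓝 (Real.sqrt (2 * ‖f‖ ^ 2 - 2 * (inner ℂ f (freeEvolution (t - t) f)).re))) := by
    simp only [e2]
    have : Continuous fun s => Real.sqrt
        (2 * ‖f‖ ^ 2 - 2 * (inner ℂ f (freeEvolution (t - s) f)).re) :=
      (continuous_const.sub (continuous_const.mul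
        (c1.comp (continuous_const.sub continuous_id)))).sqrt
    exact this.tendsto t
  rw [← e2] at c2
  simpa [Real.sqrt_sq (norm_nonneg _)] using c2

theorem tendsto_freeEvolution {α : Type*} {l : Filter α} {τ : α → ℝ} {w : α → L2} {t : ℝ} {f : L2}
    (hτ : Tendsto τ l (𝓝 t)) (hw : Tendsto w l (𝓝 f)) :
    Tendsto (fun a => freeEvolution (τ a) (w a)) l (𝓝 (freeEvolution t f)) := by
  have h1 : Tendsto (fun a => freeEvolution (τ a) (w a - f)) l (𝓝 0) := by
    rw [tendsto_zero_iff_norm_tendsto_zero]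
    simp only [norm_freeEvolution]
    exact tendsto_iff_norm_sub_tendsto_zero.1 hw
  have h2 := h1.add (((continuous_freeEvolution_apply f).tendsto t).comp hτ)
  simpa [map_sub] using h2

end Group

end NLSLine

namespace NLSLine

/-! ### Pointwise calculus of the power nonlinearity. -/

section Pointwise

/-- The gauge invariant power `|z|^{2η} z`. -/
def gaugePower (η : ℝ) (z : ℂ) : ℂ := ((‖z‖ ^ (2 * η) : ℝ) : ℂ) * z

theorem real_inner_eq (z w : ℂ) : inner ℝ z w = (starRingEnd ℂ z * w).re := by
  rw [Complex.inner, mul_comm]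

theorem abs_re_conj_mul_le (z w : ℂ) : |(starRingEnd ℂ z * w).re| ≤ ‖z‖ * ‖w‖ := by
  refine (Complex.abs_re_le_norm _).trans ?_
  rw [norm_mul, RCLike.norm_conj]

theorem abs_im_conj_mul_le (z w : ℂ) : |(starRingEnd ℂ z * w).im| ≤ ‖z‖ * ‖w‖ := by
  refine (Complex.abs_im_le_norm _).trans ?_
  rw [norm_mul, RCLike.norm_conj]

theorem fderiv_norm_rpow_apply {p : ℝ} (hp : 1 < p) (z w : ℂ) :
    fderiv ℝ (fun z : ℂ => ‖z‖ ^ p) z w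
      = p * ‖z‖ ^ (p - 2) * (starRingEnd ℂ z * w).re := by
  rw [fderiv_norm_rpow z hp, ← real_inner_eq]
  simp

variable {η : ℝ}

theorem contDiff_gaugePower (hη : 1 ≤ η) : ContDiff ℝ 1 (gaugePower η) :=
  (Complex.ofRealCLM.contDiff.comp (contDiff_norm_rpow (by linarith))).mul contDiff_id

theorem fderiv_gaugePower (hη : 1 ≤ η) (z w : ℂ) : fderiv ℝ (gaugePower η) z w
    = ((‖z‖ ^ (2 * η) : ℝ) : ℂ) * w
      + ((2 * η * ‖z‖ ^ (2 * η - 2) * (starRingEnd ℂ z * w).re : ℝ) : ℂ) * z := by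
  have h1 := (hasFDerivAt_norm_rpow z (show 1 < 2 * η by linarith))
  have h2 := (Complex.ofRealCLM.hasFDerivAt.comp z h1).mul (hasFDerivAt_id (𝕜 := ℝ) z)
  have h3 : fderiv ℝ (gaugePower η) z = _ := h2.fderiv
  rw [h3]
  simp [mul_comm z]
  left; ring

theorem norm_gaugePower_le {K : ℝ} (hη : 1 ≤ η) {z : ℂ} (hz : ‖z‖ ≤ K) :
    ‖gaugePower η z‖ ≤ K ^ (2 * η) * ‖z‖ := by
  rw [gaugePower, norm_mul, Complex.norm_real, Real.norm_of_nonneg (by positivity)]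
  gcongr

theorem exists_lipschitz_gaugePower (hη : 1 ≤ η) (K : ℝ) :
    ∃ C : ℝ, 0 ≤ C ∧ ∀ z w : ℂ, ‖z‖ ≤ K → ‖w‖ ≤ K →
      ‖gaugePower η z - gaugePower η w‖ ≤ C * ‖z - w‖ := by
  obtain ⟨C, hC⟩ := (contDiff_gaugePower hη).contDiffOn.exists_lipschitzOnWith one_ne_zero
    (convex_closedBall (0 : ℂ) K) (isCompact_closedBall _ _)
  refine ⟨C, C.2, fun z w hz hw => ?_⟩
  have := hC.norm_sub_le (mem_closedBall_zero_iff.2 hz) (mem_closedBall_zero_iff.2 hw)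
  exact this

/-- The gradient of `|z|^{2η+2}` is `(2η+2)|z|^{2η}z`, which is Lipschitz on bounded sets, so the
first-order remainder is quadratic. -/
theorem exists_taylor_norm_rpow (hη : 1 ≤ η) (K : ℝ) :
    ∃ C : ℝ, 0 ≤ C ∧ ∀ z w : ℂ, ‖z‖ ≤ K → ‖w‖ ≤ K →
      |‖w‖ ^ (2 * η + 2) - ‖z‖ ^ (2 * η + 2)
        - (2 * η + 2) * (starRingEnd ℂ (gaugePower η z) * (w - z)).re| ≤ C * ‖w - z‖ ^ 2 := by
  obtain ⟨C, hC0, hC⟩ := exists_lipschitz_gaugePower hη K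
  refine ⟨(2 * η + 2) * C, by positivity, fun z w hz hw => ?_⟩
  have hp : 1 < 2 * η + 2 := by linarith
  have hd : ∀ u v : ℂ, fderiv ℝ (fun z : ℂ => ‖z‖ ^ (2 * η + 2)) u v
      = (2 * η + 2) * (starRingEnd ℂ (gaugePower η u) * v).re := by
    intro u v
    rw [fderiv_norm_rpow_apply hp, gaugePower, map_mul, Complex.conj_ofReal, mul_assoc _ _ v,
      Complex.re_ofReal_mul, show 2 * η + 2 - 2 = 2 * η by ring, mul_assoc]
  set L : ℂ →L[ℝ] ℝ := fderiv ℝ (fun z : ℂ => ‖z‖ ^ (2 * η + 2)) z with hL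
  have hseg : segment ℝ z w ⊆ Metric.closedBall 0 K :=
    (convex_closedBall (0 : ℂ) K).segment_subset (mem_closedBall_zero_iff.2 hz)
      (mem_closedBall_zero_iff.2 hw)
  have h := (convex_segment z w).norm_image_sub_le_of_norm_hasFDerivWithin_le' (𝕜 := ℝ)
    (f := fun z : ℂ => ‖z‖ ^ (2 * η + 2)) (φ := L) (C := (2 * η + 2) * C * ‖w - z‖)
    (f' := fun u => fderiv ℝ (fun z : ℂ => ‖z‖ ^ (2 * η + 2)) u) (x := z) (y := w)
    (fun u _ => ((differentiable_norm_rpow hp) u).hasFDerivAt.hasFDerivWithinAt)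
    (fun u hu => ?_) (left_mem_segment ℝ z w) (right_mem_segment ℝ z w)
  · rw [hL, hd, Real.norm_eq_abs] at h
    refine h.trans (le_of_eq (by ring))
  · refine ContinuousLinearMap.opNorm_le_bound _ (by positivity) fun v => ?_
    rw [sub_apply, hL, hd, hd, ← mul_sub, ← Complex.sub_re, ← sub_mul,
      ← map_sub, norm_mul, Real.norm_of_nonneg (by positivity : 0 ≤ 2 * η + 2)]
    have h1 := abs_re_conj_mul_le (gaugePower η u - gaugePower η z) v
    have h2 := hC u z (mem_closedBall_zero_iff.1 (hseg hu)) hz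
    have h3 : ‖u - z‖ ≤ ‖w - z‖ := by
      exact norm_sub_le_of_mem_segment hu
    rw [Real.norm_eq_abs]
    calc (2 * η + 2) * |(starRingEnd ℂ (gaugePower η u - gaugePower η z) * v).re|
        ≤ (2 * η + 2) * (C * ‖w - z‖ * ‖v‖) := by
          gcongr
          refine h1.trans ?_
          gcongr
          exact h2.trans (by gcongr)
      _ = (2 * η + 2) * C * ‖w - z‖ * ‖v‖ := by ring

end Pointwise

/-! ### The nonlinearity and the potential energy on bounded `L²` functions. -/

section Nonlinearity

variable {η K lam : ℝ} {f g h : L2}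

theorem memLp_powerNonlinearity (lam : ℝ) (hη : 1 ≤ η) (hf : ∀ᵐ x : ℝ, ‖f x‖ ≤ K) :
    MemLp (fun x : ℝ => (lam : ℂ) * ((‖f x‖ ^ (2 * η) : ℝ) : ℂ) * f x) 2 volume := by
  refine ((Lp.memLp f).norm.const_mul (|lam| * K ^ (2 * η))).mono' ?_ ?_
  · have := Lp.aestronglyMeasurable f
    have hm : AEStronglyMeasurable (fun x => gaugePower η (f x)) volume :=
      (contDiff_gaugePower hη).continuous.comp_aestronglyMeasurable this
    refine (hm.const_mul (lam : ℂ)).congr (ae_of_all _ fun x => ?_)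
    simp only [gaugePower, mul_assoc]
  · filter_upwards [hf] with x hx
    rw [mul_assoc, norm_mul, Complex.norm_real, Real.norm_eq_abs, mul_assoc]
    gcongr
    exact norm_gaugePower_le hη hx

theorem powerNonlinearity_ae (lam : ℝ) (hη : 1 ≤ η) (hf : ∀ᵐ x : ℝ, ‖f x‖ ≤ K) :
    powerNonlinearity lam η f =ᵐ[volume] fun x => (lam : ℂ) * gaugePower η (f x) := by
  rw [powerNonlinearity, dif_pos (memLp_powerNonlinearity lam hη hf)]
  filter_upwards [(memLp_powerNonlinearity lam hη hf).coeFn_toLp] with x hx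
  rw [hx, gaugePower, mul_assoc]

theorem powerNonlinearity_one_ae (hη : 1 ≤ η) (hf : ∀ᵐ x : ℝ, ‖f x‖ ≤ K) :
    powerNonlinearity 1 η f =ᵐ[volume] fun x => gaugePower η (f x) := by
  filter_upwards [powerNonlinearity_ae 1 hη hf] with x hx
  rw [hx, Complex.ofReal_one, one_mul]

theorem powerNonlinearity_eq_smul (lam : ℝ) (hη : 1 ≤ η) (hf : ∀ᵐ x : ℝ, ‖f x‖ ≤ K) :
    powerNonlinearity lam η f = (lam : ℂ) • powerNonlinearity 1 η f := by
  refine Lp.ext ?_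
  filter_upwards [powerNonlinearity_ae lam hη hf, powerNonlinearity_one_ae hη hf,
    Lp.coeFn_smul (lam : ℂ) (powerNonlinearity 1 η f)] with x h1 h2 h3
  rw [h1, h3, Pi.smul_apply, h2, smul_eq_mul]

theorem exists_lipschitz_powerNonlinearity (hη : 1 ≤ η) (K : ℝ) :
    ∃ C : ℝ, 0 ≤ C ∧ ∀ f g : L2, (∀ᵐ x : ℝ, ‖f x‖ ≤ K) → (∀ᵐ x : ℝ, ‖g x‖ ≤ K) →
      ‖powerNonlinearity 1 η f - powerNonlinearity 1 η g‖ ≤ C * ‖f - g‖ := by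
  obtain ⟨C, hC0, hC⟩ := exists_lipschitz_gaugePower hη K
  refine ⟨C, hC0, fun f g hf hg => Lp.norm_le_mul_norm_of_ae_le_mul ?_⟩
  filter_upwards [hf, hg, powerNonlinearity_one_ae hη hf, powerNonlinearity_one_ae hη hg,
    Lp.coeFn_sub (powerNonlinearity 1 η f) (powerNonlinearity 1 η g), Lp.coeFn_sub f g]
    with x h1 h2 h3 h4 h5 h6
  rw [h5, h6, Pi.sub_apply, Pi.sub_apply, h3, h4]
  exact hC _ _ h1 h2

theorem integrable_norm_mul_norm (f g : L2) : Integrable (fun x => ‖f x‖ * ‖g x‖) volume :=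
  MemLp.integrable_mul (Lp.memLp f).norm (Lp.memLp g).norm

theorem integral_norm_mul_norm_le (f g : L2) : ∫ x, ‖f x‖ * ‖g x‖ ≤ ‖f‖ * ‖g‖ := by
  have h := real_inner_le_norm ((Lp.memLp f).norm.toLp _) ((Lp.memLp g).norm.toLp _)
  rw [Lp.norm_toLp, Lp.norm_toLp, eLpNorm_norm, eLpNorm_norm, ← Lp.norm_def, ← Lp.norm_def,
    L2.inner_def] at h
  refine le_trans (le_of_eq ?_) h
  refine integral_congr_ae ?_
  filter_upwards [(Lp.memLp f).norm.coeFn_toLp, (Lp.memLp g).norm.coeFn_toLp] with x h1 h2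
  rw [h1, h2]
  simp [mul_comm]

theorem norm_sq_L2_eq (f : L2) : ‖f‖ ^ 2 = ∫ x, ‖f x‖ ^ 2 := by
  have h := @norm_sq_eq_re_inner ℂ _ _ _ _ f
  rw [h, inner_L2_eq]
  have : ∀ x, starRingEnd ℂ (f x) * f x = ((‖f x‖ ^ 2 : ℝ) : ℂ) := fun x => by
    rw [mul_comm, Complex.mul_conj, Complex.normSq_eq_norm_sq]
  simp only [this]
  rw [integral_complex_ofReal]
  exact Complex.ofReal_re _

/-- The potential energy `∫ |f|^{2η+2}` (without prefactor). -/
def potential (η : ℝ) (f : L2) : ℝ := ∫ x : ℝ, ‖f x‖ ^ (2 * η + 2)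

theorem norm_rpow_le_of_le (hη : 0 ≤ η) {z : ℂ} (hz : ‖z‖ ≤ K) :
    ‖z‖ ^ (2 * η + 2) ≤ K ^ (2 * η) * (‖z‖ * ‖z‖) := by
  rw [Real.rpow_add_of_nonneg (norm_nonneg _) (by linarith) (by norm_num)]
  rw [Real.rpow_two, sq]
  gcongr

theorem integrable_potential (hη : 0 ≤ η) (hf : ∀ᵐ x : ℝ, ‖f x‖ ≤ K) :
    Integrable (fun x : ℝ => ‖f x‖ ^ (2 * η + 2)) volume := by
  refine ((integrable_norm_mul_norm f f).const_mul (K ^ (2 * η))).mono' ?_ ?_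
  · exact ((Lp.aestronglyMeasurable f).norm.aemeasurable.pow_const _).aestronglyMeasurable
  · filter_upwards [hf] with x hx
    rw [Real.norm_of_nonneg (by positivity)]
    exact norm_rpow_le_of_le hη hx

theorem potential_nonneg (η : ℝ) (f : L2) : 0 ≤ potential η f :=
  integral_nonneg fun _ => by positivity

theorem potential_le (hη : 0 ≤ η) (hf : ∀ᵐ x : ℝ, ‖f x‖ ≤ K) :
    potential η f ≤ K ^ (2 * η) * ‖f‖ ^ 2 := by
  rw [norm_sq_L2_eq, ← integral_const_mul]
  refine integral_mono_ae (integrable_potential hη hf) (((integrable_norm_mul_norm f f).congr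
    (ae_of_all _ fun x => (sq _).symm)).const_mul _) ?_
  filter_upwards [hf] with x hx
  rw [sq]
  exact norm_rpow_le_of_le hη hx

/-- Because the remainder is quadratic in the `L²` norm, the potential can be differentiated along a
curve whose increments are merely `o(|s-t|^{1/2})`. -/
theorem exists_taylor_potential (hη : 1 ≤ η) (K : ℝ) :
    ∃ C : ℝ, 0 ≤ C ∧ ∀ f g : L2, (∀ᵐ x : ℝ, ‖f x‖ ≤ K) → (∀ᵐ x : ℝ, ‖g x‖ ≤ K) →
      |potential η g - potential η f
        - (2 * η + 2) * (inner ℂ (powerNonlinearity 1 η f) (g - f)).re| ≤ C * ‖g - f‖ ^ 2 := by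
  obtain ⟨C, hC0, hC⟩ := exists_taylor_norm_rpow hη K
  refine ⟨C, hC0, fun f g hf hg => ?_⟩
  have i1 := integrable_potential (by linarith : (0 : ℝ) ≤ η) hg
  have i2 := integrable_potential (by linarith : (0 : ℝ) ≤ η) hf
  have i3 : Integrable (fun x => (starRingEnd ℂ (powerNonlinearity 1 η f x) * (g - f) x).re) :=
    (integrable_conj_mul_of_L2 _ _).re
  have i4 : Integrable (fun x => C * ‖(g - f) x‖ ^ 2) :=
    ((integrable_norm_mul_norm (g - f) (g - f)).congr (ae_of_all _ fun x => (sq _).symm)).const_mul C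
  have e : potential η g - potential η f
        - (2 * η + 2) * (inner ℂ (powerNonlinearity 1 η f) (g - f)).re
      = ∫ x, (‖g x‖ ^ (2 * η + 2) - ‖f x‖ ^ (2 * η + 2)
        - (2 * η + 2) * (starRingEnd ℂ (powerNonlinearity 1 η f x) * (g - f) x).re) := by
    have e1 : (inner ℂ (powerNonlinearity 1 η f) (g - f)).re
        = ∫ x, (starRingEnd ℂ (powerNonlinearity 1 η f x) * (g - f) x).re := by
      rw [inner_L2_eq]
      exact (integral_re (integrable_conj_mul_of_L2 _ _)).symm
    have e2 := integral_sub (i1.sub i2) (i3.const_mul (2 * η + 2))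
    have e3 := integral_sub i1 i2
    simp only [Pi.sub_apply] at e2 e3
    rw [e2, e3, integral_const_mul, e1]
    rfl
  rw [e, norm_sq_L2_eq, ← integral_const_mul, ← Real.norm_eq_abs]
  refine norm_integral_le_of_norm_le i4 ?_
  filter_upwards [hf, hg, powerNonlinearity_one_ae hη hf, Lp.coeFn_sub g f] with x h1 h2 h3 h4
  rw [h3, h4, Pi.sub_apply]
  exact hC _ _ h1 h2

end Nonlinearity

end NLSLine

namespace NLSLine

/-! ### Weak derivatives, and the vanishing of the auxiliary term. -/

section WeakDerivative

variable {E : Type} [NormedAddCommGroup E] [NormedSpace ℝ E]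

theorem IsWeakDeriv.ae_eq [CompleteSpace E] {k : ℕ} {f g g' : ℝ → E} (h : IsWeakDeriv k f g)
    (h' : IsWeakDeriv k f g') : g =ᵐ[volume] g' := by
  refine ae_eq_of_integral_contDiff_smul_eq h.1 h'.1 fun φ hφ hc => ?_
  have := (h.2 φ hφ hc).symm.trans (h'.2 φ hφ hc)
  exact smul_right_injective E (pow_ne_zero k (by norm_num : (-1 : ℝ) ≠ 0)) this

theorem weakDeriv_ae_eq [CompleteSpace E] {k : ℕ} {f g : ℝ → E} (h : IsWeakDeriv k f g) :
    weakDeriv k f =ᵐ[volume] g := by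
  have hex : ∃ g, IsWeakDeriv k f g := ⟨g, h⟩
  rw [weakDeriv, dif_pos hex]
  exact hex.choose_spec.ae_eq h

theorem HasL2Deriv.isWeakDeriv {f g : L2} (h : HasL2Deriv f g) : IsWeakDeriv 1 f g := by
  obtain ⟨F, hF, hFg⟩ := h
  refine ⟨hFg.locallyIntegrable, fun φ hφ hc => ?_⟩
  have hφ1 : ContDiff ℝ 1 φ := hφ.of_le (by exact_mod_cast le_top)
  have hd : ∀ x, deriv (fun x => (φ x : ℂ)) x = ((deriv φ x : ℝ) : ℂ) := fun x =>
    ((hφ1.differentiable one_ne_zero x).hasDerivAt.ofReal_comp).deriv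
  have hA := (IsAntideriv.of_contDiff (Complex.ofRealCLM.contDiff.comp hφ1)).mul hFg
  have i1 : Integrable (fun x => φ x • F x) :=
    hFg.continuous.locallyIntegrable.integrable_smul_left_of_hasCompactSupport hφ.continuous hc
  have i2 : Integrable (fun x => φ x • g x) :=
    hFg.locallyIntegrable.integrable_smul_left_of_hasCompactSupport hφ.continuous hc
  have i3 : Integrable (fun x => deriv φ x • F x) :=
    hFg.continuous.locallyIntegrable.integrable_smul_left_of_hasCompactSupport
      (hφ1.continuous_deriv le_rfl) hc.deriv
  have e : ∀ x, (Complex.ofRealCLM ∘ φ) x * g x + F x * deriv (Complex.ofRealCLM ∘ φ) x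
      = φ x • g x + deriv φ x • F x := by
    intro x
    rw [show deriv (Complex.ofRealCLM ∘ φ) x = _ from hd x]
    simp only [Function.comp_apply, Complex.ofRealCLM_apply, Complex.real_smul]
    ring
  have key := hA.integral_eq_zero (i1.congr (ae_of_all _ fun x => by simp))
    ((i2.add i3).congr (ae_of_all _ fun x => (e x).symm))
  simp only [e] at key
  rw [integral_add i2 i3] at key
  rw [iteratedDeriv_one, pow_one, neg_one_smul, eq_neg_iff_add_eq_zero, add_comm, ← key]
  congr 1
  refine integral_congr_ae ?_
  filter_upwards [hF] with x hx
  rw [hx]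

/-- The integral of the second weak derivative of an integrable function vanishes. -/
theorem integral_weakDeriv_two_eq_zero {f : ℝ → ℝ} (hf : Integrable f volume) :
    ∫ x, weakDeriv 2 f x = 0 := by
  by_cases hex : ∃ g, IsWeakDeriv 2 f g
  swap
  · rw [weakDeriv, dif_neg hex]; simp
  rw [weakDeriv, dif_pos hex]
  obtain ⟨-, hw⟩ := hex.choose_spec
  set g := hex.choose
  -- A non-integrable derivative has Bochner integral `0` by convention, just as an absent one is
  -- the zero function; only integrable `g` needs an argument.
  by_cases hg : Integrable g volume
  swap
  · exact integral_undef hg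
  let b : ContDiffBump (0 : ℝ) := ⟨1, 2, one_pos, one_lt_two⟩
  have hbs : ContDiff ℝ ∞ b := b.contDiff
  have hb2 : ContDiff ℝ 2 b := b.contDiff (n := 2)
  have hbc : HasCompactSupport (iteratedDeriv 2 b) := by
    rw [iteratedDeriv_succ, iteratedDeriv_one]
    exact b.hasCompactSupport.deriv.deriv
  obtain ⟨C, hC⟩ := (hb2.continuous_iteratedDeriv 2
    le_rfl).bounded_above_of_compact_support hbc
  -- Cut-offs at scale `n + 1`: two derivatives gain `(n+1)⁻²` against the finite integral of `|f|`,
  -- while the cut-offs tend to `1` under the integral of `g`.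
  set φ : ℕ → ℝ → ℝ := fun n x => b (((n : ℝ) + 1)⁻¹ * x) with hφ
  have hn : ∀ n : ℕ, ((n : ℝ) + 1)⁻¹ ≠ 0 := fun n => by positivity
  have hφs : ∀ n, ContDiff ℝ ∞ (φ n) := fun n => hbs.comp (contDiff_const.mul contDiff_id)
  have hφc : ∀ n, HasCompactSupport (φ n) := fun n =>
    b.hasCompactSupport.comp_homeomorph (Homeomorph.mulLeft₀ _ (hn n))
  have hφ2 : ∀ n x, iteratedDeriv 2 (φ n) x
      = ((n : ℝ) + 1)⁻¹ ^ 2 * iteratedDeriv 2 b (((n : ℝ) + 1)⁻¹ * x) := fun n x => by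
    have := iteratedDeriv_comp_const_mul (n := 2) hb2 (((n : ℝ) + 1)⁻¹)
    exact congrFun this x
  have l1 : Tendsto (fun n => ∫ x, φ n x • g x) atTop (𝓝 (∫ x, g x)) := by
    refine tendsto_integral_of_dominated_convergence (fun x => ‖g x‖)
      (fun n => (hφs n).continuous.aestronglyMeasurable.smul hg.aestronglyMeasurable) hg.norm
      (fun n => ae_of_all _ fun x => ?_) (ae_of_all _ fun x => ?_)
    · rw [norm_smul, Real.norm_of_nonneg b.nonneg]
      exact mul_le_of_le_one_left (norm_nonneg _) b.le_one
    · have h0 : Tendsto (fun n : ℕ => ((n : ℝ) + 1)⁻¹ * x) atTop (𝓝 0) := by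
        simpa using (tendsto_inv_atTop_zero.comp (tendsto_atTop_add_const_right atTop (1 : ℝ)
          tendsto_natCast_atTop_atTop)).mul_const x
      have h1 := (hbs.continuous.tendsto 0).comp h0
      rw [b.one_of_mem_closedBall (by simp [b])] at h1
      simpa using h1.smul_const (g x)
  have l2 : Tendsto (fun n => ∫ x, φ n x • g x) atTop (𝓝 0) := by
    have hb : Tendsto (fun n : ℕ => ((n : ℝ) + 1)⁻¹ ^ 2 * (C * ∫ x, ‖f x‖)) atTop (𝓝 0) := by
      simpa using ((tendsto_inv_atTop_zero.comp (tendsto_atTop_add_const_right atTop (1 : ℝ)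
          tendsto_natCast_atTop_atTop)).pow 2).mul_const (C * ∫ x, ‖f x‖)
    refine squeeze_zero_norm (fun n => ?_) hb
    have h1 := hw (φ n) (hφs n) (hφc n)
    rw [neg_one_sq, one_smul] at h1
    rw [← h1, ← integral_const_mul, ← integral_const_mul]
    refine norm_integral_le_of_norm_le ((hf.norm.const_mul _).const_mul _) (ae_of_all _ fun x => ?_)
    rw [norm_smul, hφ2, norm_mul, norm_pow, norm_inv, Real.norm_of_nonneg (by positivity :
      (0 : ℝ) ≤ (n : ℝ) + 1), mul_assoc]
    gcongr
    exact hC _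
  exact tendsto_nhds_unique l1 l2

end WeakDerivative

/-! ### Consequences of finite Sobolev norm. -/

section Sobolev

theorem norm_le_of_ae_le_weight {q : ℕ} {f k : L2} (hf : MemH q f)
    (hk : ∀ᵐ ξ : ℝ, ‖k ξ‖ ≤ (1 + ξ ^ 2) ^ ((q : ℝ) / 2) * ‖(𝓕 f : L2) ξ‖) :
    ‖k‖ ≤ (sobolevNorm q f).toReal := by
  rw [Lp.norm_def]
  refine ENNReal.toReal_mono hf.ne ?_
  refine eLpNorm_mono_ae (hk.mono fun ξ h => h.trans (le_of_eq ?_))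
  rw [norm_mul, Complex.norm_real, Real.norm_of_nonneg (by positivity)]

theorem one_le_weight (q : ℕ) (ξ : ℝ) : 1 ≤ (1 + ξ ^ 2) ^ ((q : ℝ) / 2) :=
  Real.one_le_rpow (by nlinarith [sq_nonneg ξ]) (by positivity)

theorem norm_le_sobolevNorm {q : ℕ} {f : L2} (hf : MemH q f) :
    ‖f‖ ≤ (sobolevNorm q f).toReal := by
  rw [← Lp.norm_fourier_eq]
  exact norm_le_of_ae_le_weight hf (ae_of_all _ fun ξ =>
    le_mul_of_one_le_left (norm_nonneg _) (one_le_weight q ξ))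

/-- For `q ≥ 1` the Sobolev weight dominates `|ξ|`, so the inverse-transform rule applies to `𝓕 f`.
The factor `2π` is that of the kernel. -/
theorem MemH.exists_hasL2Deriv {q : ℕ} (hq : 1 ≤ q) {f : L2} (hf : MemH q f) :
    ∃ g : L2, HasL2Deriv f g ∧ ‖g‖ ≤ 2 * Real.pi * (sobolevNorm q f).toReal := by
  have hw : ∀ ξ : ℝ, |ξ| ≤ (1 + ξ ^ 2) ^ ((q : ℝ) / 2) := fun ξ => by
    have h1 : |ξ| ≤ (1 + ξ ^ 2) ^ ((1 : ℝ) / 2) := by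
      rw [← Real.sqrt_eq_rpow]
      exact Real.abs_le_sqrt (by linarith)
    refine h1.trans (Real.rpow_le_rpow_of_exponent_le (by nlinarith [sq_nonneg ξ]) ?_)
    have : (1 : ℝ) ≤ q := by exact_mod_cast hq
    linarith
  have hk : MemLp (fun ξ : ℝ => (ξ : ℂ) * (𝓕 f : L2) ξ) 2 volume := by
    have h1 : MemLp (fun ξ : ℝ =>
      (((1 + ξ ^ 2) ^ ((q : ℝ) / 2) : ℝ) : ℂ) * (𝓕 f : L2) ξ) 2 volume := by
      refine ⟨?_, hf⟩
      refine (Measurable.aestronglyMeasurable ?_).mul (Lp.aestronglyMeasurable _)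
      fun_prop
    refine h1.mono ((Complex.measurable_ofReal.aestronglyMeasurable).mul
      (Lp.aestronglyMeasurable _)) (ae_of_all _ fun ξ => ?_)
    rw [norm_mul, norm_mul, Complex.norm_real, Complex.norm_real, Real.norm_eq_abs,
      Real.norm_of_nonneg (by positivity)]
    exact mul_le_mul_of_nonneg_right (hw ξ) (norm_nonneg _)
  have hX : IsMulX (𝓕 f) (hk.toLp _) := hk.coeFn_toLp
  have hD := hX.hasL2Deriv_fourierInv
  rw [fourierInv_fourier_eq] at hD
  refine ⟨_, hD, ?_⟩
  have hn : ‖(𝓕⁻ (hk.toLp _) : L2)‖ = ‖(hk.toLp _ : L2)‖ := by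
    rw [← Lp.norm_fourier_eq, fourier_fourierInv_eq]
  rw [norm_smul, hn]
  have h2 : ‖(hk.toLp _ : L2)‖ ≤ (sobolevNorm q f).toReal := by
    refine norm_le_of_ae_le_weight hf ?_
    filter_upwards [hX] with ξ h
    rw [h, norm_mul, Complex.norm_real, Real.norm_eq_abs]
    exact mul_le_mul_of_nonneg_right (hw ξ) (norm_nonneg _)
  have h3 : ‖(2 * Real.pi * Complex.I : ℂ)‖ = 2 * Real.pi := by
    simp [abs_of_pos Real.pi_pos]
  rw [h3]
  gcongr

theorem sobolevNorm_le_add (q : ℕ) (f g : L2) :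
    sobolevNorm q f ≤ sobolevNorm q (f - g) + sobolevNorm q g := by
  have hm : ∀ k : L2, AEStronglyMeasurable (fun ξ : ℝ =>
      (((1 + ξ ^ 2) ^ ((q : ℝ) / 2) : ℝ) : ℂ) * (𝓕 k : L2) ξ) volume := fun k =>
    (Measurable.aestronglyMeasurable (by fun_prop)).mul (Lp.aestronglyMeasurable _)
  refine le_trans (le_of_eq ?_) (eLpNorm_add_le (hm (f - g)) (hm g) (by norm_num))
  refine eLpNorm_congr_ae ?_
  have e : (𝓕 f : L2) = 𝓕 (f - g) + 𝓕 g := by rw [fourier_L2_sub, sub_add_cancel]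
  have h := Lp.coeFn_add (𝓕 (f - g) : L2) (𝓕 g)
  rw [← e] at h
  filter_upwards [h] with ξ hξ
  rw [hξ, Pi.add_apply, Pi.add_apply, mul_add]

end Sobolev

end NLSLine

/-! ### Sup bounds, the virial identity, and the Galilei operator on the nonlinearity. -/

namespace NLSLine

variable {η K : ℝ} {f g h : L2}

theorem IsAntideriv.norm_rpow {F f : ℝ → ℂ} (hF : IsAntideriv F f) {p : ℝ} (hp : 1 < p) :
    IsAntideriv (fun x => ‖F x‖ ^ p)
      (fun x => p * ‖F x‖ ^ (p - 2) * (starRingEnd ℂ (F x) * f x).re) :=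
  (hF.comp_contDiff (contDiff_norm_rpow hp)).congr_deriv
    (ae_of_all _ fun _ => fderiv_norm_rpow_apply hp _ _)

theorem integrable_re_conj_mul (f g : L2) :
    Integrable (fun x => (starRingEnd ℂ (f x) * g x).re) volume :=
  (integrable_conj_mul_of_L2 f g).re

theorem integrable_norm_sq (f : L2) : Integrable (fun x => ‖f x‖ ^ 2) volume :=
  (memLp_two_iff_integrable_sq_norm (Lp.aestronglyMeasurable f)).1 (Lp.memLp f)

/-- `|f|²` is absolutely continuous, with derivative `2 Re (f̄ g)`. The integral is left unestimated
because it is bounded in two ways: by Cauchy-Schwarz for the Sobolev embedding, and through `x +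
2it∂` for time decay. -/
theorem HasL2Deriv.norm_sq_le_integral (D : HasL2Deriv f g) :
    ∀ᵐ x, ‖f x‖ ^ 2 ≤ ∫ y, 2 * |(starRingEnd ℂ (f y) * g y).re| := by
  obtain ⟨F, hF, hFg⟩ := D
  have hA := hFg.norm_rpow (p := 2) one_lt_two
  have e : (fun x => 2 * ‖F x‖ ^ ((2 : ℝ) - 2) * (starRingEnd ℂ (F x) * g x).re)
      =ᵐ[volume] fun x => 2 * (starRingEnd ℂ (f x) * g x).re := by
    filter_upwards [hF] with x hx
    rw [hx, sub_self, Real.rpow_zero, mul_one]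
  have hA' := hA.congr_deriv e
  have i1 : Integrable (fun x => ‖F x‖ ^ (2 : ℝ)) := (integrable_norm_sq f).congr (by
    filter_upwards [hF] with x hx
    rw [hx, Real.rpow_two])
  have h1 := hA'.norm_le_integral i1 ((integrable_re_conj_mul f g).const_mul 2)
  filter_upwards [hF] with x hx
  have h2 := h1 x
  simp only [Real.rpow_two, norm_pow, norm_mul, Real.norm_eq_abs, abs_two, abs_norm] at h2
  rw [hx]
  exact h2

/-- The `H¹ ⊆ L^∞` embedding. -/
theorem HasL2Deriv.norm_sq_le (D : HasL2Deriv f g) :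
    ∀ᵐ x, ‖f x‖ ^ 2 ≤ 2 * (‖f‖ * ‖g‖) := by
  filter_upwards [D.norm_sq_le_integral] with x hx
  refine hx.trans ?_
  rw [integral_const_mul]
  gcongr
  refine le_trans ?_ (integral_norm_mul_norm_le f g)
  exact integral_mono (integrable_re_conj_mul f g).abs (integrable_norm_mul_norm f g)
    fun x => abs_re_conj_mul_le _ _

theorem coeFn_add_smul (h g : L2) (c : ℂ) :
    (h + c • g : L2) =ᵐ[volume] fun x => h x + c * g x := by
  filter_upwards [Lp.coeFn_add h (c • g), Lp.coeFn_smul c g] with x h1 h2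
  rw [h1, Pi.add_apply, h2, Pi.smul_apply, smul_eq_mul]

/-- `t Re (ψ̄ ∂ψ)` is controlled by the Galilei operator `x + 2it∂`. -/
theorem im_conj_mul_galilei (x t : ℝ) (z w : ℂ) :
    (starRingEnd ℂ z * (x * z + 2 * Complex.I * t * w)).im
      = 2 * t * (starRingEnd ℂ z * w).re := by
  simp only [Complex.mul_im, Complex.mul_re, Complex.add_im, Complex.add_re, Complex.conj_re,
    Complex.conj_im, Complex.ofReal_re, Complex.ofReal_im, Complex.I_re, Complex.I_im,
    Complex.re_ofNat, Complex.im_ofNat]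
  ring

/-- Pointwise decay from the Galilei operator. -/
theorem HasL2Deriv.norm_sq_le_galilei (D : HasL2Deriv f g) (X : IsMulX f h) {t : ℝ} (ht : 0 < t) :
    ∀ᵐ x, ‖f x‖ ^ 2 ≤ t⁻¹ * (‖f‖ * ‖h + (2 * Complex.I * t) • g‖) := by
  filter_upwards [D.norm_sq_le_integral] with x hx
  refine hx.trans ?_
  refine le_trans ?_ (mul_le_mul_of_nonneg_left (integral_norm_mul_norm_le f _)
    (inv_nonneg.2 ht.le))
  rw [← integral_const_mul]
  refine integral_mono_ae ((integrable_re_conj_mul f g).abs.const_mul 2)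
    ((integrable_norm_mul_norm f _).const_mul _) ?_
  filter_upwards [X, coeFn_add_smul h g (2 * Complex.I * t)] with y h1 h2
  -- Since `x|f|²` is real, the position part of the Galilei operator drops out of `Im (f̄ Jf) = 2t
  -- Re (f̄ g)`.
  have h3 := abs_im_conj_mul_le (f y) ((h + (2 * Complex.I * t) • g : L2) y)
  rw [h2, h1, im_conj_mul_galilei, abs_mul, abs_of_pos (by positivity : 0 < 2 * t)] at h3
  rw [h2, h1, ← sub_nonneg, ← mul_nonneg_iff_of_pos_left ht]
  have : t * (t⁻¹ * (‖f y‖ * ‖(y : ℂ) * f y + 2 * Complex.I * t * g y‖)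
      - 2 * |(starRingEnd ℂ (f y) * g y).re|)
      = ‖f y‖ * ‖(y : ℂ) * f y + 2 * Complex.I * t * g y‖
        - 2 * t * |(starRingEnd ℂ (f y) * g y).re| := by
    field_simp
  rw [this]
  linarith

/-- The virial identity `∫ |f|^{2η+2} = -∫ x ∂(|f|^{2η+2})`. -/
theorem HasL2Deriv.potential_eq (D : HasL2Deriv f g) (X : IsMulX f h) (hη : 0 ≤ η)
    (hK : ∀ᵐ x : ℝ, ‖f x‖ ≤ K) :
    Integrable (fun x : ℝ => x * (‖f x‖ ^ (2 * η) * (starRingEnd ℂ (f x) * g x).re)) volume ∧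
    potential η f
      = -((2 * η + 2) * ∫ x : ℝ, x * (‖f x‖ ^ (2 * η) * (starRingEnd ℂ (f x) * g x).re)) := by
  have i0 := integrable_potential hη hK
  have i1 : Integrable (fun x : ℝ => x * (‖f x‖ ^ (2 * η) * (starRingEnd ℂ (f x) * g x).re)) := by
    refine ((integrable_norm_mul_norm h g).const_mul (K ^ (2 * η))).mono' ?_ ?_
    · exact measurable_id.aestronglyMeasurable.mul
        ((((Lp.aestronglyMeasurable f).norm.aemeasurable.pow_const _).aestronglyMeasurable).mul
          (integrable_re_conj_mul f g).aestronglyMeasurable)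
    · filter_upwards [X, hK] with x h1 h2
      have hK0 : 0 ≤ K := (norm_nonneg _).trans h2
      rw [norm_mul, norm_mul, Real.norm_of_nonneg (by positivity : 0 ≤ ‖f x‖ ^ (2 * η)),
        Real.norm_eq_abs, Real.norm_eq_abs, h1, norm_mul, Complex.norm_real, Real.norm_eq_abs]
      calc |x| * (‖f x‖ ^ (2 * η) * |(starRingEnd ℂ (f x) * g x).re|)
          ≤ |x| * (K ^ (2 * η) * (‖f x‖ * ‖g x‖)) := by
            gcongr
            exact abs_re_conj_mul_le _ _
        _ = _ := by ring
  have i2 : Integrable (fun x : ℝ => x * ‖f x‖ ^ (2 * η + 2)) := by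
    refine ((integrable_norm_mul_norm h f).const_mul (K ^ (2 * η))).mono' ?_ ?_
    · exact measurable_id.aestronglyMeasurable.mul i0.aestronglyMeasurable
    · filter_upwards [X, hK] with x h1 h2
      have hK0 : 0 ≤ K := (norm_nonneg _).trans h2
      rw [norm_mul, Real.norm_of_nonneg (by positivity : 0 ≤ ‖f x‖ ^ (2 * η + 2)),
        Real.norm_eq_abs, h1, norm_mul, Complex.norm_real, Real.norm_eq_abs]
      calc |x| * ‖f x‖ ^ (2 * η + 2) ≤ |x| * (K ^ (2 * η) * (‖f x‖ * ‖f x‖)) := by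
            gcongr
            exact norm_rpow_le_of_le hη h2
        _ = _ := by ring
  refine ⟨i1, ?_⟩
  obtain ⟨F, hF, hFg⟩ := D
  have hA := (IsAntideriv.of_contDiff (contDiff_id (𝕜 := ℝ) (E := ℝ) (n := 1))).mul
    (hFg.norm_rpow (p := 2 * η + 2) (by linarith))
  have e : (fun x => id x * ((2 * η + 2) * ‖F x‖ ^ (2 * η + 2 - 2)
      * (starRingEnd ℂ (F x) * g x).re) + ‖F x‖ ^ (2 * η + 2) * deriv id x) =ᵐ[volume]
      fun x : ℝ => (2 * η + 2) * (x * (‖f x‖ ^ (2 * η) * (starRingEnd ℂ (f x) * g x).re))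
        + ‖f x‖ ^ (2 * η + 2) := by
    filter_upwards [hF] with x hx
    rw [hx, deriv_id, id, add_sub_cancel_right]; ring
  have key := (hA.congr_deriv e).integral_eq_zero (i2.congr (by
    filter_upwards [hF] with x hx
    rw [hx, id])) ((i1.const_mul _).add i0)
  rw [integral_add (i1.const_mul _) i0, integral_const_mul] at key
  rw [potential]; linarith

/-- The uncertainty principle. -/
theorem HasL2Deriv.norm_sq_le_uncertainty (D : HasL2Deriv f g) (X : IsMulX f h) :
    ‖f‖ ^ 2 ≤ 2 * (‖h‖ * ‖g‖) := by
  have hK : ∀ᵐ x, ‖f x‖ ≤ Real.sqrt (2 * (‖f‖ * ‖g‖)) :=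
    D.norm_sq_le.mono fun x hx => Real.le_sqrt_of_sq_le hx
  obtain ⟨i1, h1⟩ := D.potential_eq X le_rfl hK
  -- The uncertainty principle is the virial identity at exponent `η = 0`.
  have h2 : potential 0 f = ‖f‖ ^ 2 := by
    rw [norm_sq_L2_eq, potential]; simp
  rw [← h2, h1]
  refine (neg_le_abs _).trans ?_
  rw [abs_mul, mul_zero, zero_add, abs_two]
  gcongr
  rw [← Real.norm_eq_abs]
  refine le_trans (norm_integral_le_of_norm_le (integrable_norm_mul_norm h g) ?_)
    (integral_norm_mul_norm_le h g)
  filter_upwards [X] with x hx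
  rw [Real.rpow_zero, one_mul, norm_mul, hx, norm_mul, Complex.norm_real, mul_assoc]
  gcongr
  exact abs_re_conj_mul_le _ _

/-- The quantity `∫ |f|^{2η-2} Re (f̄ g) Im (f̄ g)`. -/
def crossTerm (η : ℝ) (f g : L2) : ℝ :=
  ∫ x, ‖f x‖ ^ (2 * η - 2) * (starRingEnd ℂ (f x) * g x).re * (starRingEnd ℂ (f x) * g x).im

theorem rpow_sub_two_mul_sq (hη : 1 ≤ η) (z : ℂ) :
    ‖z‖ ^ (2 * η - 2) * ‖z‖ ^ 2 = ‖z‖ ^ (2 * η) := by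
  rw [← Real.rpow_two, ← Real.rpow_add_of_nonneg (norm_nonneg _) (by linarith) (by norm_num)]
  congr 1; ring

theorem norm_crossTerm_integrand_le (hη : 1 ≤ η) {z w : ℂ} (hz : ‖z‖ ≤ K) :
    ‖‖z‖ ^ (2 * η - 2) * (starRingEnd ℂ z * w).re * (starRingEnd ℂ z * w).im‖
      ≤ K ^ (2 * η) * ‖w‖ ^ 2 := by
  rw [norm_mul, norm_mul, Real.norm_of_nonneg (by positivity : 0 ≤ ‖z‖ ^ (2 * η - 2)),
    Real.norm_eq_abs, Real.norm_eq_abs]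
  calc ‖z‖ ^ (2 * η - 2) * |(starRingEnd ℂ z * w).re| * |(starRingEnd ℂ z * w).im|
      ≤ ‖z‖ ^ (2 * η - 2) * (‖z‖ * ‖w‖) * (‖z‖ * ‖w‖) := by
        gcongr
        · exact abs_re_conj_mul_le _ _
        · exact abs_im_conj_mul_le _ _
    _ = ‖z‖ ^ (2 * η) * ‖w‖ ^ 2 := by rw [← rpow_sub_two_mul_sq hη]; ring
    _ ≤ K ^ (2 * η) * ‖w‖ ^ 2 := by gcongr

theorem integrable_crossTerm (hη : 1 ≤ η) (hK : ∀ᵐ x : ℝ, ‖f x‖ ≤ K) (g : L2) :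
    Integrable (fun x => ‖f x‖ ^ (2 * η - 2) * (starRingEnd ℂ (f x) * g x).re
      * (starRingEnd ℂ (f x) * g x).im) volume := by
  refine ((integrable_norm_sq g).const_mul (K ^ (2 * η))).mono' ?_
    (hK.mono fun x hx => norm_crossTerm_integrand_le hη hx)
  exact ((((Lp.aestronglyMeasurable f).norm.aemeasurable.pow_const _).aestronglyMeasurable).mul
    (integrable_re_conj_mul f g).aestronglyMeasurable).mul
    (integrable_conj_mul_of_L2 f g).im.aestronglyMeasurable

theorem norm_crossTerm_le (hη : 1 ≤ η) (hK : ∀ᵐ x : ℝ, ‖f x‖ ≤ K) (g : L2) :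
    ‖crossTerm η f g‖ ≤ K ^ (2 * η) * ‖g‖ ^ 2 := by
  rw [norm_sq_L2_eq, ← integral_const_mul]
  exact norm_integral_le_of_norm_le ((integrable_norm_sq g).const_mul _)
    (hK.mono fun x hx => norm_crossTerm_integrand_le hη hx)

/-- The derivative of `|f|^{2η} f`. -/
theorem HasL2Deriv.exists_powerNonlinearity (D : HasL2Deriv f g) (hη : 1 ≤ η)
    (hK : ∀ᵐ x : ℝ, ‖f x‖ ≤ K) :
    ∃ G : L2, HasL2Deriv (powerNonlinearity 1 η f) G ∧ G =ᵐ[volume] fun x =>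
      ((‖f x‖ ^ (2 * η) : ℝ) : ℂ) * g x
        + ((2 * η * ‖f x‖ ^ (2 * η - 2) * (starRingEnd ℂ (f x) * g x).re : ℝ) : ℂ) * f x := by
  have hN := powerNonlinearity_one_ae hη hK
  have hp : ∀ p : ℝ, AEStronglyMeasurable (fun x => ‖f x‖ ^ p) volume := fun p =>
    ((Lp.aestronglyMeasurable f).norm.aemeasurable.pow_const p).aestronglyMeasurable
  have hG : MemLp (fun x => ((‖f x‖ ^ (2 * η) : ℝ) : ℂ) * g x
      + ((2 * η * ‖f x‖ ^ (2 * η - 2) * (starRingEnd ℂ (f x) * g x).re : ℝ) : ℂ) * f x)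
      2 volume := by
    refine ((Lp.memLp g).norm.const_mul ((1 + 2 * η) * K ^ (2 * η))).mono' ?_ ?_
    · have m1 : AEStronglyMeasurable (fun x => ((‖f x‖ ^ (2 * η) : ℝ) : ℂ)) volume :=
        Complex.continuous_ofReal.comp_aestronglyMeasurable (hp (2 * η))
      have m2 : AEStronglyMeasurable (fun x => 2 * η * ‖f x‖ ^ (2 * η - 2)
          * (starRingEnd ℂ (f x) * g x).re) volume :=
        ((hp (2 * η - 2)).const_mul (2 * η)).mul
          (integrable_re_conj_mul f g).aestronglyMeasurable
      have m3 := Complex.continuous_ofReal.comp_aestronglyMeasurable m2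
      exact (m1.mul (Lp.aestronglyMeasurable g)).add (m3.mul (Lp.aestronglyMeasurable f))
    · filter_upwards [hK] with x hx
      have hK0 : 0 ≤ K := (norm_nonneg _).trans hx
      refine (norm_add_le _ _).trans ?_
      rw [norm_mul, norm_mul, Complex.norm_real, Complex.norm_real, norm_mul, norm_mul,
        Real.norm_of_nonneg (by positivity : 0 ≤ ‖f x‖ ^ (2 * η)),
        Real.norm_of_nonneg (by positivity : 0 ≤ ‖f x‖ ^ (2 * η - 2)),
        Real.norm_of_nonneg (by positivity : 0 ≤ 2 * η), Real.norm_eq_abs]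
      calc ‖f x‖ ^ (2 * η) * ‖g x‖
            + 2 * η * ‖f x‖ ^ (2 * η - 2) * |(starRingEnd ℂ (f x) * g x).re| * ‖f x‖
          ≤ ‖f x‖ ^ (2 * η) * ‖g x‖
            + 2 * η * ‖f x‖ ^ (2 * η - 2) * (‖f x‖ * ‖g x‖) * ‖f x‖ := by
            gcongr
            exact abs_re_conj_mul_le _ _
        _ = (1 + 2 * η) * ‖f x‖ ^ (2 * η) * ‖g x‖ := by rw [← rpow_sub_two_mul_sq hη]; ring
        _ ≤ (1 + 2 * η) * K ^ (2 * η) * ‖g x‖ := by gcongr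
  obtain ⟨F, hF, hFg⟩ := D
  refine ⟨hG.toLp _, ⟨fun x => gaugePower η (F x), ?_, ?_⟩, hG.coeFn_toLp⟩
  · filter_upwards [hN, hF] with x h1 h2
    rw [h1, h2]
  · refine (hFg.comp_contDiff (contDiff_gaugePower hη)).congr_deriv ?_
    filter_upwards [hG.coeFn_toLp, hF] with x h1 h2
    rw [h1, fderiv_gaugePower hη, h2]

theorem IsMulX.exists_powerNonlinearity (X : IsMulX f h) (hη : 1 ≤ η)
    (hK : ∀ᵐ x : ℝ, ‖f x‖ ≤ K) :
    ∃ N' : L2, IsMulX (powerNonlinearity 1 η f) N' ∧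
      N' =ᵐ[volume] fun x => ((‖f x‖ ^ (2 * η) : ℝ) : ℂ) * h x := by
  have hm : MemLp (fun x => ((‖f x‖ ^ (2 * η) : ℝ) : ℂ) * h x) 2 volume := by
    refine ((Lp.memLp h).norm.const_mul (K ^ (2 * η))).mono' ?_ ?_
    · exact (Complex.continuous_ofReal.comp_aestronglyMeasurable
        ((Lp.aestronglyMeasurable f).norm.aemeasurable.pow_const _).aestronglyMeasurable).mul
        (Lp.aestronglyMeasurable h)
    · filter_upwards [hK] with x hx
      rw [norm_mul, Complex.norm_real, Real.norm_of_nonneg (by positivity)]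
      gcongr
  refine ⟨hm.toLp _, ?_, hm.coeFn_toLp⟩
  filter_upwards [hm.coeFn_toLp, powerNonlinearity_one_ae hη hK, X] with x h1 h2 h3
  rw [h1, h2, h3, gaugePower]; ring

/-- The structure of `|f|^{2η} f` with respect to `∂` and to the Galilei operator `x + 2it∂`. -/
theorem exists_galilei_powerNonlinearity (D : HasL2Deriv f g) (X : IsMulX f h) (hη : 1 ≤ η)
    (hK : ∀ᵐ x : ℝ, ‖f x‖ ≤ K) :
    ∃ G N' : L2, HasL2Deriv (powerNonlinearity 1 η f) G ∧ IsMulX (powerNonlinearity 1 η f) N' ∧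
      (inner ℂ G g).im = 2 * η * crossTerm η f g ∧
      ∀ t : ℝ, (inner ℂ (h + (2 * Complex.I * t) • g) (N' + (2 * Complex.I * t) • G)).im
          = -(4 * η * t * (potential η f / (2 * η + 2) + 2 * t * crossTerm η f g)) ∧
        ‖N' + (2 * Complex.I * t) • G‖
          ≤ (1 + 2 * η) * K ^ (2 * η) * ‖h + (2 * Complex.I * t) • g‖ := by
  obtain ⟨G, hG, hGe⟩ := D.exists_powerNonlinearity hη hK
  obtain ⟨N', hN, hNe⟩ := X.exists_powerNonlinearity hη hK
  have ic := integrable_crossTerm hη hK g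
  obtain ⟨iv, hv⟩ := D.potential_eq X (by linarith) hK
  refine ⟨G, N', hG, hN, ?_, fun t => ⟨?_, ?_⟩⟩
  · rw [inner_L2_eq, crossTerm, ← integral_const_mul]
    refine (integral_im (integrable_conj_mul_of_L2 G g)).symm.trans (integral_congr_ae ?_)
    filter_upwards [hGe] with x hx
    rw [hx]
    simp only [RCLike.im_eq_complex_im, Complex.mul_im, Complex.mul_re, Complex.add_im,
      Complex.add_re, Complex.conj_re, Complex.conj_im, Complex.ofReal_re, Complex.ofReal_im,
      map_add, map_mul]
    ring
  -- The virial identity turns the potential into the term linear in `x`, so both sides become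
  -- integrals of the same pointwise expression.
  · have e : -(4 * η * t * (potential η f / (2 * η + 2) + 2 * t * crossTerm η f g))
        = ∫ x : ℝ, (4 * η * t * (x * (‖f x‖ ^ (2 * η) * (starRingEnd ℂ (f x) * g x).re))
          - 4 * η * t * (2 * t) * (‖f x‖ ^ (2 * η - 2) * (starRingEnd ℂ (f x) * g x).re
            * (starRingEnd ℂ (f x) * g x).im)) := by
      rw [integral_sub (iv.const_mul _) (ic.const_mul _), integral_const_mul, integral_const_mul,
        hv, crossTerm]
      field_simp
      ring
    rw [e, inner_L2_eq]
    refine (integral_im (integrable_conj_mul_of_L2 _ _)).symm.trans (integral_congr_ae ?_)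
    filter_upwards [hGe, hNe, X, coeFn_add_smul h g (2 * Complex.I * t),
      coeFn_add_smul N' G (2 * Complex.I * t)] with x h1 h2 h3 h4 h5
    rw [h4, h5, h1, h2, h3]
    have h6 := rpow_sub_two_mul_sq hη (f x)
    rw [← Complex.normSq_eq_norm_sq, Complex.normSq_apply] at h6
    rw [← h6]
    simp only [RCLike.im_eq_complex_im, Complex.mul_im, Complex.mul_re, Complex.add_im,
      Complex.add_re, Complex.conj_re, Complex.conj_im, Complex.ofReal_re, Complex.ofReal_im,
      map_add, map_mul, Complex.I_re, Complex.I_im, Complex.re_ofNat, Complex.im_ofNat,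
      Complex.conj_I, Complex.neg_re, Complex.neg_im, Complex.conj_ofReal]
    ring
  · refine Lp.norm_le_mul_norm_of_ae_le_mul ?_
    filter_upwards [hGe, hNe, X, coeFn_add_smul h g (2 * Complex.I * t),
      coeFn_add_smul N' G (2 * Complex.I * t), hK] with x h1 h2 h3 h4 h5 hx
    -- Gauge invariance: `J(|f|^{2η}f) = |f|^{2η} Jf + 2η|f|^{2η-2} Im(f̄ Jf) i f`. Position and
    -- derivative enter only through `Jf`, which gives the norm bound.
    have e : ((‖f x‖ ^ (2 * η) : ℝ) : ℂ) * h x + 2 * Complex.I * t *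
        (((‖f x‖ ^ (2 * η) : ℝ) : ℂ) * g x
        + ((2 * η * ‖f x‖ ^ (2 * η - 2) * (starRingEnd ℂ (f x) * g x).re : ℝ) : ℂ) * f x)
        = ((‖f x‖ ^ (2 * η) : ℝ) : ℂ) * (x * f x + 2 * Complex.I * t * g x)
          + ((2 * η * ‖f x‖ ^ (2 * η - 2) * (starRingEnd ℂ (f x) *
            (x * f x + 2 * Complex.I * t * g x)).im : ℝ) : ℂ) * (Complex.I * f x) := by
      rw [im_conj_mul_galilei, h3]
      push_cast; ring
    rw [h5, h4, h1, h2, e, h3]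
    set j : ℂ := x * f x + 2 * Complex.I * t * g x
    refine (norm_add_le _ _).trans ?_
    rw [norm_mul, norm_mul, norm_mul Complex.I, Complex.norm_I, one_mul, Complex.norm_real,
      Complex.norm_real, norm_mul, norm_mul,
      Real.norm_of_nonneg (by positivity : 0 ≤ ‖f x‖ ^ (2 * η)),
      Real.norm_of_nonneg (by positivity : 0 ≤ ‖f x‖ ^ (2 * η - 2)),
      Real.norm_of_nonneg (by positivity : 0 ≤ 2 * η), Real.norm_eq_abs]
    calc ‖f x‖ ^ (2 * η) * ‖j‖
          + 2 * η * ‖f x‖ ^ (2 * η - 2) * |(starRingEnd ℂ (f x) * j).im| * ‖f x‖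
        ≤ ‖f x‖ ^ (2 * η) * ‖j‖
          + 2 * η * ‖f x‖ ^ (2 * η - 2) * (‖f x‖ * ‖j‖) * ‖f x‖ := by
          gcongr
          exact abs_im_conj_mul_le _ _
      _ = (1 + 2 * η) * ‖f x‖ ^ (2 * η) * ‖j‖ := by rw [← rpow_sub_two_mul_sq hη]; ring
      _ ≤ (1 + 2 * η) * K ^ (2 * η) * ‖j‖ := by gcongr

/-- `|f|^{2η} f` is a real multiple of `f`. -/
theorem inner_powerNonlinearity_im (hη : 1 ≤ η) (hK : ∀ᵐ x : ℝ, ‖f x‖ ≤ K) :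
    (inner ℂ f (powerNonlinearity 1 η f)).im = 0 := by
  rw [inner_L2_eq]
  refine (integral_im (integrable_conj_mul_of_L2 _ _)).symm.trans ?_
  refine integral_eq_zero_of_ae ?_
  filter_upwards [powerNonlinearity_one_ae hη hK] with x hx
  rw [hx, gaugePower, Pi.zero_apply]
  simp only [RCLike.im_eq_complex_im, Complex.mul_im, Complex.mul_re, Complex.conj_re,
    Complex.conj_im, Complex.ofReal_re, Complex.ofReal_im]
  ring

end NLSLine

/-! ### The interaction picture, conservation of mass, and the time derivative of the potential. -/

namespace NLSLine

variable {η K lam T : ℝ} {q : ℕ} {ψ₀ : L2} {ψ : ℝ → L2}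

theorem hasDerivAt_norm_sq {v : ℝ → L2} {v' : L2} {t : ℝ} (hv : HasDerivAt v v' t) :
    HasDerivAt (fun s => ‖v s‖ ^ 2) (2 * (inner ℂ (v t) v').re) t := by
  have h1 := (Complex.reCLM.hasFDerivAt.comp_hasDerivAt t (hv.inner ℂ hv))
  refine (h1.congr_deriv ?_).congr_of_eventuallyEq (Eventually.of_forall fun s => ?_)
  · have : (inner ℂ v' (v t)).re = (inner ℂ (v t) v').re := inner_re_symm (𝕜 := ℂ) _ _
    rw [Complex.reCLM_apply, Complex.add_re, this, two_mul]
  · exact @norm_sq_eq_re_inner ℂ _ _ _ _ (v s)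

theorem IsMildSolution.exists_sobolevNorm_le (H : IsMildSolution lam η q T ψ₀ ψ) :
    ∃ S : ℝ≥0, ∀ t ∈ Icc 0 T, sobolevNorm q (ψ t) ≤ S := by
  refine isCompact_Icc.induction_on (p := fun s => ∃ S : ℝ≥0, ∀ t ∈ s, sobolevNorm q (ψ t) ≤ S)
    ⟨0, by simp⟩ (fun s t hst ⟨S, hS⟩ => ⟨S, fun x hx => hS x (hst hx)⟩) ?_ ?_
  · rintro s t ⟨S, hS⟩ ⟨S', hS'⟩
    refine ⟨max S S', fun x hx => ?_⟩
    rcases hx with hx | hx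
    · exact (hS x hx).trans (by exact_mod_cast le_max_left _ _)
    · exact (hS' x hx).trans (by exact_mod_cast le_max_right _ _)
  · intro t ht
    have h1 := (H.continuous t ht).eventually_lt_const (u := 1) one_pos
    refine ⟨{s | sobolevNorm q (ψ s - ψ t) < 1}, h1, 1 + (sobolevNorm q (ψ t)).toNNReal,
      fun s hs => ?_⟩
    refine (sobolevNorm_le_add q (ψ s) (ψ t)).trans ?_
    rw [ENNReal.coe_add, ENNReal.coe_one, ENNReal.coe_toNNReal (H.mem t ht).ne]
    gcongr
    exact le_of_lt hs

theorem IsMildSolution.continuousOn (H : IsMildSolution lam η q T ψ₀ ψ) :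
    ContinuousOn ψ (Icc 0 T) := by
  intro t ht
  refine tendsto_iff_norm_sub_tendsto_zero.2 ?_
  have h1 := (ENNReal.tendsto_toReal ENNReal.zero_ne_top).comp (H.continuous t ht)
  refine squeeze_zero' (Eventually.of_forall fun _ => norm_nonneg _) ?_ h1
  filter_upwards [(H.continuous t ht).eventually_lt_const (u := 1) one_pos] with s hs
  exact norm_le_sobolevNorm (hs.trans ENNReal.one_lt_top)

/-- A function of time with values in a bounded subset of `H¹(ℝ)`, on `[0, T]`. -/
structure IsBoundedH1 (T K : ℝ) (ψ ψ' : ℝ → L2) : Prop where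
  hasL2Deriv : ∀ t ∈ Icc 0 T, HasL2Deriv (ψ t) (ψ' t)
  norm_le : ∀ t ∈ Icc 0 T, ∀ᵐ x : ℝ, ‖ψ t x‖ ≤ K
  norm_deriv_le : ∀ t ∈ Icc 0 T, ‖ψ' t‖ ≤ K

/-- The bound `K` comes from compactness of `[0, T]` and is purely qualitative: it justifies limits
and does not enter the final constants. -/
theorem IsMildSolution.exists_isBoundedH1 (H : IsMildSolution lam η q T ψ₀ ψ) (hq : 1 ≤ q) :
    ∃ K ψ', IsBoundedH1 T K ψ ψ' := by
  obtain ⟨S, hS⟩ := H.exists_sobolevNorm_le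
  have hS' : ∀ t ∈ Icc 0 T, (sobolevNorm q (ψ t)).toReal ≤ S := fun t ht =>
    ENNReal.toReal_le_coe_of_le_coe (hS t ht)
  have h1 : ∀ t, ∃ g : L2, t ∈ Icc 0 T → HasL2Deriv (ψ t) g ∧ ‖g‖ ≤ 2 * Real.pi * S := by
    intro t
    by_cases ht : t ∈ Icc 0 T
    · obtain ⟨g, hg, hg'⟩ := (H.mem t ht).exists_hasL2Deriv hq
      exact ⟨g, fun _ => ⟨hg, hg'.trans (by gcongr; exact hS' t ht)⟩⟩
    · exact ⟨0, fun h => absurd h ht⟩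
  choose ψ' hψ' using h1
  refine ⟨max (2 * Real.pi * S) (Real.sqrt (2 * (S * (2 * Real.pi * S)))), ψ',
    fun t ht => (hψ' t ht).1, fun t ht => ?_, fun t ht => (hψ' t ht).2.trans (le_max_left _ _)⟩
  filter_upwards [(hψ' t ht).1.norm_sq_le] with x hx
  refine le_trans (Real.le_sqrt_of_sq_le (hx.trans ?_)) (le_max_right _ _)
  gcongr
  · exact (norm_le_sobolevNorm (H.mem t ht)).trans (hS' t ht)
  · exact (hψ' t ht).2

/-- The interaction picture: `v(t) = e^{-itΔ} ψ(t)` is continuously differentiable in `L²`. -/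
structure IsProfile (lam η T : ℝ) (ψ v w : ℝ → L2) : Prop where
  eq_freeEvolution : ∀ t ∈ Icc 0 T, ψ t = freeEvolution t (v t)
  hasDerivAt : ∀ t, HasDerivAt v (-(Complex.I * lam) • w t) t
  continuous : Continuous w
  eq_nonlinearity : ∀ t ∈ Icc 0 T, w t = freeEvolution (-t) (powerNonlinearity 1 η (ψ t))

theorem IsMildSolution.exists_isProfile (H : IsMildSolution lam η q T ψ₀ ψ) (hη : 1 ≤ η)
    (hT : 0 < T) (hK : ∀ t ∈ Icc 0 T, ∀ᵐ x : ℝ, ‖ψ t x‖ ≤ K) :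
    ∃ v w, IsProfile lam η T ψ v w ∧ v 0 = ψ₀ := by
  obtain ⟨C, hC0, hC⟩ := exists_lipschitz_powerNonlinearity hη K
  have hNc : ContinuousOn (fun t => powerNonlinearity 1 η (ψ t)) (Icc 0 T) := by
    intro t ht
    refine tendsto_iff_norm_sub_tendsto_zero.2 ?_
    have h1 := (tendsto_iff_norm_sub_tendsto_zero.1 (H.continuousOn t ht)).const_mul C
    rw [mul_zero] at h1
    refine squeeze_zero' (Eventually.of_forall fun _ => norm_nonneg _) ?_ h1
    filter_upwards [self_mem_nhdsWithin] with s hs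
    exact hC _ _ (hK s hs) (hK t ht)
  -- The nonlinearity is frozen at its endpoint values outside `[0, T]`, so the profile is
  -- two-sidedly differentiable at every time, `0` and `T` included.
  set w : ℝ → L2 := fun t =>
    freeEvolution (-t) (IccExtend hT.le (domRestrict (Icc 0 T) fun t => powerNonlinearity 1 η (ψ t)) t)
    with hw
  have hwe : ∀ t ∈ Icc 0 T, w t = freeEvolution (-t) (powerNonlinearity 1 η (ψ t)) := fun t ht => by
    rw [hw]
    simp only [IccExtend_of_mem hT.le _ ht, domRestrict_apply]
  have hwc : Continuous w := by
    have h1 : Continuous (IccExtend hT.le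
      (domRestrict (Icc 0 T) fun t => powerNonlinearity 1 η (ψ t))) :=
      hNc.domRestrict.Icc_extend'
    exact continuous_iff_continuousAt.2 fun t =>
      tendsto_freeEvolution (continuous_neg.tendsto t) (h1.tendsto t)
  refine ⟨fun t => ψ₀ - (Complex.I * lam) • ∫ s in (0 : ℝ)..t, w s, w,
    ⟨fun t ht => ?_, fun t => ?_, hwc, hwe⟩, by simp⟩
  · rw [H.duhamel t ht, schrodingerGroup_eq, map_sub, map_smul,
      ← (freeEvolution t).intervalIntegral_comp_comm (hwc.intervalIntegrable 0 t), mul_smul]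
    congr 2
    rw [← intervalIntegral.integral_smul]
    refine intervalIntegral.integral_congr fun s hs => ?_
    have hs' : s ∈ Icc 0 T := by
      rw [uIcc_of_le ht.1] at hs
      exact ⟨hs.1, hs.2.trans ht.2⟩
    rw [schrodingerGroup_eq, hwe s hs', powerNonlinearity_eq_smul lam hη (hK s hs'), map_smul,
      ← freeEvolution_add, sub_eq_add_neg]
  · have h1 := (hwc.integral_hasStrictDerivAt 0 t).hasDerivAt
    have h2 := (h1.const_smul (Complex.I * lam)).const_sub ψ₀
    rwa [← neg_smul] at h2

section Profile

variable {v w : ℝ → L2} {ψ' : ℝ → L2} (P : IsProfile lam η T ψ v w) (hb : IsBoundedH1 T K ψ ψ')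
include P

theorem IsProfile.continuous_profile : Continuous v :=
  continuous_iff_continuousAt.2 fun t => (P.hasDerivAt t).continuousAt

theorem IsProfile.continuousOn : ContinuousOn ψ (Icc 0 T) := by
  have h : Continuous fun t => freeEvolution t (v t) := continuous_iff_continuousAt.2 fun t =>
    tendsto_freeEvolution tendsto_id (P.continuous_profile.tendsto t)
  exact h.continuousOn.congr fun t ht => P.eq_freeEvolution t ht

theorem IsProfile.apply_eq {t : ℝ} (ht : t ∈ Icc 0 T) : v t = freeEvolution (-t) (ψ t) := by
  rw [P.eq_freeEvolution t ht, freeEvolution_neg_apply]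

include hb

/-- Conservation of mass. -/
theorem IsProfile.norm_eq (hη : 1 ≤ η) {t : ℝ} (ht : t ∈ Icc 0 T) : ‖ψ t‖ = ‖v 0‖ := by
  have h0 : ∀ s ∈ Icc 0 T, HasDerivAt (fun s => ‖v s‖ ^ 2) 0 s := by
    intro s hs
    refine (hasDerivAt_norm_sq (P.hasDerivAt s)).congr_deriv ?_
    rw [P.apply_eq hs, P.eq_nonlinearity s hs, inner_smul_right, inner_freeEvolution]
    have := inner_powerNonlinearity_im hη (hb.norm_le s hs)
    simp [this]
  have h1 := constant_of_has_deriv_right_zero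
    (fun s hs => (h0 s hs).continuousAt.continuousWithinAt)
    (fun s hs => (h0 s ⟨hs.1, hs.2.le⟩).hasDerivWithinAt) t ht
  rw [P.eq_freeEvolution t ht, norm_freeEvolution]
  exact (sq_eq_sq₀ (norm_nonneg _) (norm_nonneg _)).1 h1

omit hb in
-- The increment `v s - v t` vanishes at `s = t`, so no derivative falls on the group; its joint
-- strong continuity is enough.
theorem IsProfile.hasDerivAt_freeEvolution_sub (t : ℝ) :
    HasDerivAt (fun s => freeEvolution s (v s - v t))
      (freeEvolution t (-(Complex.I * lam) • w t)) t := by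
  rw [hasDerivAt_iff_tendsto_slope]
  have h := hasDerivAt_iff_tendsto_slope.1 (P.hasDerivAt t)
  refine (tendsto_freeEvolution (tendsto_id.mono_left nhdsWithin_le_nhds) h).congr fun s => ?_
  rw [slope_def_module, slope_def_module, id, sub_self, map_zero, sub_zero]
  exact (freeEvolution s).map_smul_of_tower _ _

/-- This is the equation tested against an `H¹` function. It comes from splitting `ψ(s)` into the
free flow of `ψ(t)` and the evolved profile increment. -/
theorem IsProfile.hasDerivAt_inner {t : ℝ} (ht : t ∈ Icc 0 T) {f f' : L2} (hf : HasL2Deriv f f') :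
    HasDerivAt (fun s => inner ℂ f (freeEvolution s (v s)))
      (-Complex.I * inner ℂ f' (ψ' t)
        + inner ℂ f (-(Complex.I * lam) • powerNonlinearity 1 η (ψ t))) t := by
  have h1 : HasDerivAt (fun s => inner ℂ f (freeEvolution (s - t) (ψ t)))
      (-Complex.I * inner ℂ f' (ψ' t)) t := by
    have := hasDerivAt_inner_freeEvolution hf (hb.hasL2Deriv t ht)
    rw [← sub_self t] at this
    exact this.comp_sub_const t t
  have h2 := (hasDerivAt_const t f).inner ℂ (P.hasDerivAt_freeEvolution_sub t)
  rw [inner_zero_left, add_zero, P.eq_nonlinearity t ht, ← map_smul, freeEvolution_apply_neg] at h2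
  refine (h1.add h2).congr_of_eventuallyEq (Eventually.of_forall fun s => ?_)
  simp only [Pi.add_apply]
  rw [← inner_add_right]
  congr 1
  rw [P.eq_freeEvolution t ht, ← freeEvolution_add, sub_add_cancel, ← map_add, add_sub_cancel]

/-- In the same splitting, the free part has squared norm `o(|s-t|)` by `H¹` regularity and the
profile part `O(|s-t|²)` by differentiability. -/
theorem IsProfile.norm_sub_sq_isLittleO {t : ℝ} (ht : t ∈ Icc 0 T) :
    (fun s => ‖freeEvolution s (v s) - ψ t‖ ^ 2) =o[𝓝 t] fun s => s - t := by
  have ht0 : Tendsto (fun s => s - t) (𝓝 t) (𝓝 0) := by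
    simpa using (continuous_sub_right t).tendsto t
  have h1 := ((NLSLine.norm_sub_sq_isLittleO (hb.hasL2Deriv t ht)).comp_tendsto ht0)
  have h2 : (fun s => ‖v s - v t‖ ^ 2) =o[𝓝 t] fun s => s - t := by
    have h3 : (fun s => ‖v s - v t‖ ^ 2) =O[𝓝 t] fun s => (s - t) ^ 2 :=
      (P.hasDerivAt t).isBigO_sub.norm_left.pow 2
    refine h3.trans_isLittleO ?_
    have h4 : (fun s => (s - t) * (s - t)) =o[𝓝 t] fun s => 1 * (s - t) :=
      ((Asymptotics.isLittleO_one_iff ℝ).2 ht0).mul_isBigO (Asymptotics.isBigO_refl _ _)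
    simpa [sq] using h4
  have h5 := (h1.const_mul_left 2).add (h2.const_mul_left 2)
  refine Asymptotics.IsLittleO.of_norm_left (Asymptotics.IsBigO.trans_isLittleO
    (Asymptotics.IsBigO.of_bound 1 (Eventually.of_forall fun s => ?_)) h5)
  rw [one_mul, norm_norm, Real.norm_of_nonneg (by positivity), Function.comp]
  refine le_trans ?_ (le_abs_self _)
  have e : freeEvolution s (v s) - ψ t
      = (freeEvolution (s - t) (ψ t) - ψ t) + freeEvolution s (v s - v t) := by
    rw [P.eq_freeEvolution t ht, ← freeEvolution_add, sub_add_cancel, map_sub]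
    abel
  rw [e, ← norm_freeEvolution s (v s - v t)]
  have h6 := norm_add_le (freeEvolution (s - t) (ψ t) - ψ t) (freeEvolution s (v s - v t))
  nlinarith [norm_nonneg ((freeEvolution (s - t) (ψ t) - ψ t) + freeEvolution s (v s - v t)),
    sq_nonneg (‖freeEvolution (s - t) (ψ t) - ψ t‖ - ‖freeEvolution s (v s - v t)‖),
    norm_nonneg (freeEvolution (s - t) (ψ t) - ψ t), norm_nonneg (freeEvolution s (v s - v t))]

/-- The time derivative of the potential energy. -/
theorem IsProfile.hasDerivAt_potential (hη : 1 ≤ η) {t : ℝ} (ht : t ∈ Ioo 0 T) {G : L2}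
    (hG : HasL2Deriv (powerNonlinearity 1 η (ψ t)) G) :
    HasDerivAt (fun s => potential η (ψ s)) ((2 * η + 2) * (inner ℂ G (ψ' t)).im) t := by
  have ht' : t ∈ Icc 0 T := Ioo_subset_Icc_self ht
  obtain ⟨C, hC0, hC⟩ := exists_taylor_potential hη K
  have hev : ∀ᶠ s in 𝓝 t, s ∈ Icc 0 T := Icc_mem_nhds ht.1 ht.2
  have h1 := P.hasDerivAt_inner hb ht' hG
  have h2 := (Complex.reCLM.hasFDerivAt.comp_hasDerivAt t h1)
  -- The nonlinear contribution is a purely imaginary multiple of `‖|ψ|^{2η}ψ‖²`, so its real part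
  -- vanishes and `λ` disappears.
  have e2 : Complex.reCLM (-Complex.I * inner ℂ G (ψ' t) + inner ℂ (powerNonlinearity 1 η (ψ t))
      (-(Complex.I * lam) • powerNonlinearity 1 η (ψ t))) = (inner ℂ G (ψ' t)).im := by
    rw [inner_smul_right]
    have : (inner ℂ (powerNonlinearity 1 η (ψ t)) (powerNonlinearity 1 η (ψ t))).im = 0 :=
      inner_self_im (𝕜 := ℂ) _
    simp only [Complex.reCLM_apply, Complex.add_re, Complex.mul_re, Complex.neg_re, Complex.I_re,
      Complex.I_im, Complex.neg_im, Complex.mul_im, Complex.ofReal_re, Complex.ofReal_im, this]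
    ring
  rw [e2] at h2
  have h3 := (hasDerivAt_iff_isLittleO.1 h2).const_mul_left (2 * η + 2)
  have h4 := (P.norm_sub_sq_isLittleO hb ht').const_mul_left C
  rw [hasDerivAt_iff_isLittleO]
  refine Asymptotics.IsLittleO.of_norm_left (Asymptotics.IsBigO.trans_isLittleO
    (Asymptotics.IsBigO.of_bound 1 (hev.mono fun s hs => ?_)) (h4.norm_left.add h3.norm_left))
  rw [one_mul, norm_norm]
  have h5 := hC _ _ (hb.norm_le t ht') (hb.norm_le s hs)
  have e3 := P.eq_freeEvolution t ht'
  simp only [Function.comp_apply, Complex.reCLM_apply, ← P.eq_freeEvolution s hs, ← e3]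
  rw [inner_sub_right, Complex.sub_re] at h5
  set a := (inner ℂ (powerNonlinearity 1 η (ψ t)) (ψ s)).re
  set b := (inner ℂ (powerNonlinearity 1 η (ψ t)) (ψ t)).re
  rw [Real.norm_of_nonneg (by positivity : 0 ≤ ‖C * ‖ψ s - ψ t‖ ^ 2‖
    + ‖(2 * η + 2) * (a - b - (s - t) • (inner ℂ G (ψ' t)).im)‖),
    Real.norm_of_nonneg (by positivity : 0 ≤ C * ‖ψ s - ψ t‖ ^ 2)]
  refine le_trans (le_of_eq ?_) ((norm_add_le (potential η (ψ s) - potential η (ψ t)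
    - (2 * η + 2) * (a - b)) _).trans (add_le_add_left h5 _))
  congr 1
  simp only [smul_eq_mul]
  ring

theorem IsProfile.continuousOn_potential (hη : 1 ≤ η) :
    ContinuousOn (fun s => potential η (ψ s)) (Icc 0 T) := by
  obtain ⟨C, hC0, hC⟩ := exists_taylor_potential hη K
  intro t ht
  have h1 : Tendsto (fun s => ψ s - ψ t) (𝓝[Icc 0 T] t) (𝓝 0) := by
    have := (P.continuousOn t ht).sub_const (ψ t)
    simpa [ContinuousWithinAt] using this
  have h2 : Tendsto (fun s => (2 * η + 2) * (inner ℂ (powerNonlinearity 1 η (ψ t)) (ψ s - ψ t)).re)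
      (𝓝[Icc 0 T] t) (𝓝 0) := by
    have := ((Complex.continuous_re.tendsto _).comp ((tendsto_const_nhds
      (x := powerNonlinearity 1 η (ψ t))).inner (𝕜 := ℂ) h1)).const_mul (2 * η + 2)
    simpa using this
  have h3 : Tendsto (fun s => C * ‖ψ s - ψ t‖ ^ 2) (𝓝[Icc 0 T] t) (𝓝 0) := by
    simpa using (h1.norm.pow 2).const_mul C
  have h4 : Tendsto (fun s => potential η (ψ s) - potential η (ψ t)
      - (2 * η + 2) * (inner ℂ (powerNonlinearity 1 η (ψ t)) (ψ s - ψ t)).re)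
      (𝓝[Icc 0 T] t) (𝓝 0) := by
    refine squeeze_zero_norm' ?_ h3
    filter_upwards [self_mem_nhdsWithin] with s hs
    exact hC _ _ (hb.norm_le t ht) (hb.norm_le s hs)
  have h5 := (h4.add h2).add_const (potential η (ψ t))
  simpa [ContinuousWithinAt] using h5

end Profile

end NLSLine

/-! ### The pseudo-conformal conservation law. -/

namespace NLSLine

theorem norm_truncate_le (R : ℝ) (f : L2) : ‖truncate R f‖ ≤ ‖f‖ := by
  refine Lp.norm_le_norm_of_ae_le ?_
  filter_upwards [truncate_ae R f] with x hx
  rw [hx]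
  split_ifs <;> simp

theorem tendsto_inner_truncate (f k : L2) :
    Tendsto (fun n : ℕ => inner ℂ (truncate n f) (truncate n k)) atTop (𝓝 (inner ℂ f k)) := by
  have e : ∀ n : ℕ, inner ℂ (truncate n f) (truncate n k)
      = ∫ x, starRingEnd ℂ (truncate n f x) * k x := fun n => by
    rw [← inner_truncate_left, truncate_truncate, inner_L2_eq]
  simp only [e]
  rw [inner_L2_eq]
  refine tendsto_integral_of_dominated_convergence (fun x => ‖starRingEnd ℂ (f x) * k x‖)
    (fun n => (integrable_conj_mul_of_L2 _ _).aestronglyMeasurable)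
    (integrable_conj_mul_of_L2 f k).norm (fun n => ?_) ?_
  · filter_upwards [truncate_ae n f] with x hx
    rw [hx]
    split_ifs <;> simp [mul_nonneg]
  · have : ∀ᵐ x : ℝ, ∀ n : ℕ, truncate n f x = if |x| ≤ n then f x else 0 :=
      ae_all_iff.2 fun n => truncate_ae n f
    filter_upwards [this] with x hx
    obtain ⟨m, hm⟩ := exists_nat_ge |x|
    refine tendsto_const_nhds.congr' ?_
    filter_upwards [eventually_ge_atTop m] with n hn
    rw [hx, if_pos (hm.trans (by exact_mod_cast hn))]

theorem IsMulX.smul {f h : L2} (H : IsMulX f h) (c : ℂ) : IsMulX (c • f) (c • h) := by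
  filter_upwards [H, Lp.coeFn_smul c f, Lp.coeFn_smul c h] with x h1 h2 h3
  rw [h3, h2, Pi.smul_apply, Pi.smul_apply, h1, smul_eq_mul, smul_eq_mul]
  ring

/-- `(x + 2it∂) ψ(t)` in terms of `h = xψ` and `ψ' = ∂ψ`. -/
def galilei (h ψ' : ℝ → L2) (t : ℝ) : L2 := h t + (2 * Complex.I * t) • ψ' t

theorem isMulX_freeEvolution_neg {f h g : L2} (X : IsMulX f h) (D : HasL2Deriv f g) (t : ℝ) :
    IsMulX (freeEvolution (-t) f) (freeEvolution (-t) (h + (2 * Complex.I * t) • g)) := by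
  have := X.freeEvolution D (-t)
  rwa [Complex.ofReal_neg, mul_neg, neg_smul, sub_neg_eq_add] at this

variable {η K lam T : ℝ} {ψ v w ψ' h : ℝ → L2}

section Law

variable (P : IsProfile lam η T ψ v w) (hb : IsBoundedH1 T K ψ ψ')
  (hX : ∀ t ∈ Icc 0 T, IsMulX (ψ t) (h t))
include P hb hX

/-- The evolution of `‖(x + 2it∂) ψ‖²`. -/
theorem IsProfile.norm_galilei_sq_sub (hη : 1 ≤ η) {M : ℝ}
    (hM : ∀ t ∈ Icc 0 T, ‖galilei h ψ' t‖ ≤ M) {t : ℝ} (ht : t ∈ Icc 0 T) :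
    ‖galilei h ψ' t‖ ^ 2 - ‖galilei h ψ' 0‖ ^ 2
      = ∫ s in (0 : ℝ)..t, -(8 * lam * η * s) * (potential η (ψ s) / (2 * η + 2)
        + 2 * s * crossTerm η (ψ s) (ψ' s)) := by
  have h0 : (0 : ℝ) ∈ Icc 0 T := ⟨le_rfl, ht.1.trans ht.2⟩
  have hv : ∀ s ∈ Icc 0 T, IsMulX (v s) (freeEvolution (-s) (galilei h ψ' s)) := fun s hs => by
    rw [P.apply_eq hs]
    exact isMulX_freeEvolution_neg (hX s hs) (hb.hasL2Deriv s hs) s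
  set c : ℂ := -(Complex.I * lam) with hc
  -- With `x` truncated, the multiplier is bounded and the squared norm is an honest `C¹` function
  -- of time.
  have hA : ∀ n : ℕ, ‖truncatedX n (v t)‖ ^ 2 - ‖truncatedX n (v 0)‖ ^ 2
      = ∫ s in (0 : ℝ)..t, 2 * (inner ℂ (truncatedX n (v s)) (truncatedX n (c • w s))).re := by
    intro n
    refine (intervalIntegral.integral_eq_sub_of_hasDerivAt
      (f := fun s => ‖truncatedX n (v s)‖ ^ 2) (fun s _ => hasDerivAt_norm_sq ?_) ?_).symm
    · exact ((truncatedX n).restrictScalars ℝ).hasFDerivAt.comp_hasDerivAt s (P.hasDerivAt s)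
    · have c1 : Continuous fun s => truncatedX n (v s) :=
        (truncatedX n).continuous.comp P.continuous_profile
      have c2 : Continuous fun s => truncatedX n (c • w s) :=
        (truncatedX n).continuous.comp (P.continuous.const_smul c)
      exact (continuous_const.mul (Complex.continuous_re.comp
        (c1.inner (𝕜 := ℂ) c2))).intervalIntegrable _ _
  have hlim : ∀ s ∈ Icc 0 T, Tendsto (fun n : ℕ => ‖truncatedX n (v s)‖ ^ 2) atTop
      (𝓝 (‖galilei h ψ' s‖ ^ 2)) := fun s hs => by
    have h1 := (Complex.continuous_re.tendsto _).comp (tendsto_inner_truncate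
      (freeEvolution (-s) (galilei h ψ' s)) (freeEvolution (-s) (galilei h ψ' s)))
    rw [inner_freeEvolution] at h1
    have e1 : (inner ℂ (galilei h ψ' s) (galilei h ψ' s)).re = ‖galilei h ψ' s‖ ^ 2 :=
      (@norm_sq_eq_re_inner ℂ _ _ _ _ _).symm
    rw [e1] at h1
    refine h1.congr fun n => ?_
    rw [(hv s hs).truncatedX_eq]
    exact (@norm_sq_eq_re_inner ℂ _ _ _ _ _).symm
  have hder : ∀ s ∈ Icc 0 T, ∃ k : L2, (∀ n : ℕ, truncatedX n (c • w s)
      = truncate n (freeEvolution (-s) (c • k))) ∧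
      ‖k‖ ≤ (1 + 2 * η) * K ^ (2 * η) * ‖galilei h ψ' s‖ ∧
      (inner ℂ (galilei h ψ' s) k).im
        = -(4 * η * s * (potential η (ψ s) / (2 * η + 2) + 2 * s * crossTerm η (ψ s) (ψ' s))) := by
    intro s hs
    obtain ⟨G, N', hG, hN, -, h3⟩ := exists_galilei_powerNonlinearity (hb.hasL2Deriv s hs)
      (hX s hs) hη (hb.norm_le s hs)
    refine ⟨N' + (2 * Complex.I * s) • G, fun n => ?_, (h3 s).2, (h3 s).1⟩
    rw [P.eq_nonlinearity s hs, (NLSLine.freeEvolution (-s)).map_smul]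
    exact ((isMulX_freeEvolution_neg hN hG s).smul c).truncatedX_eq n
  have hlimR : Tendsto (fun n : ℕ => ∫ s in (0 : ℝ)..t,
      2 * (inner ℂ (truncatedX n (v s)) (truncatedX n (c • w s))).re) atTop
      (𝓝 (∫ s in (0 : ℝ)..t, -(8 * lam * η * s) * (potential η (ψ s) / (2 * η + 2)
        + 2 * s * crossTerm η (ψ s) (ψ' s)))) := by
    have hsub : ∀ s ∈ uIoc 0 t, s ∈ Icc 0 T := fun s hs => by
      rw [uIoc_of_le ht.1] at hs
      exact ⟨hs.1.le, hs.2.trans ht.2⟩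
    -- The bound is uniform in `n`: truncation does not increase norms, the group is isometric, and
    -- `J` of the nonlinearity is controlled by `Jψ`.
    refine intervalIntegral.tendsto_integral_filter_of_dominated_convergence
      (fun _ => 2 * (M * (‖c‖ * ((1 + 2 * η) * |K ^ (2 * η)| * M))))
      (Eventually.of_forall fun n => ?_)
      (Eventually.of_forall fun n => ae_of_all _ fun s hs => ?_) intervalIntegrable_const
      (ae_of_all _ fun s hs => ?_)
    · have c1 : Continuous fun s => truncatedX n (v s) :=
        (truncatedX n).continuous.comp P.continuous_profile
      have c2 : Continuous fun s => truncatedX n (c • w s) :=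
        (truncatedX n).continuous.comp (P.continuous.const_smul c)
      exact (continuous_const.mul (Complex.continuous_re.comp
        (c1.inner (𝕜 := ℂ) c2))).aestronglyMeasurable
    · obtain ⟨k, hk, hk', -⟩ := hder s (hsub s hs)
      have hMs := hM s (hsub s hs)
      have hM0 : 0 ≤ M := (norm_nonneg _).trans hMs
      rw [norm_mul, Real.norm_ofNat]
      gcongr
      refine ((Complex.abs_re_le_norm _).trans (norm_inner_le_norm (𝕜 := ℂ) _ _)).trans ?_
      rw [(hv s (hsub s hs)).truncatedX_eq, hk]
      gcongr
      · refine (norm_truncate_le _ _).trans ?_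
        rwa [norm_freeEvolution]
      · refine (norm_truncate_le _ _).trans ?_
        rw [norm_freeEvolution, norm_smul]
        gcongr
        refine hk'.trans ?_
        gcongr
        exact le_abs_self _
    · obtain ⟨k, hk, -, hk'⟩ := hder s (hsub s hs)
      have h1 := ((Complex.continuous_re.tendsto _).comp (tendsto_inner_truncate
        (freeEvolution (-s) (galilei h ψ' s)) (freeEvolution (-s) (c • k)))).const_mul 2
      have e : 2 * (inner ℂ (freeEvolution (-s) (galilei h ψ' s)) (freeEvolution (-s) (c • k))).re
          = -(8 * lam * η * s) * (potential η (ψ s) / (2 * η + 2)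
            + 2 * s * crossTerm η (ψ s) (ψ' s)) := by
        rw [inner_freeEvolution, inner_smul_right, hc]
        simp only [Complex.mul_re, Complex.neg_re, Complex.I_re, Complex.I_im, Complex.neg_im,
          Complex.mul_im, Complex.ofReal_re, Complex.ofReal_im, hk']
        ring
      rw [e] at h1
      refine h1.congr fun n => ?_
      rw [(hv s (hsub s hs)).truncatedX_eq, hk]
      rfl
  simp only [← hA] at hlimR
  exact tendsto_nhds_unique ((hlim t ht).sub (hlim 0 h0)) hlimR

theorem IsProfile.deriv_potential (hη : 1 ≤ η) {t : ℝ} (ht : t ∈ Ioo 0 T) :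
    HasDerivAt (fun s => potential η (ψ s))
      ((2 * η + 2) * (2 * η * crossTerm η (ψ t) (ψ' t))) t := by
  have ht' := Ioo_subset_Icc_self ht
  obtain ⟨G, N', hG, hN, hGi, -⟩ := exists_galilei_powerNonlinearity (hb.hasL2Deriv t ht')
    (hX t ht') hη (hb.norm_le t ht')
  rw [← hGi]
  exact P.hasDerivAt_potential hb hη ht hG

/-- Nothing is known about measurability of `ψ'` in time. The cross term is nevertheless measurable,
being a constant multiple of the time derivative of the potential. -/
theorem IsProfile.intervalIntegrable_crossTerm (hη : 1 ≤ η) {t : ℝ} (ht : t ∈ Icc 0 T) :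
    IntervalIntegrable (fun s => crossTerm η (ψ s) (ψ' s)) volume 0 t := by
  rw [intervalIntegrable_iff_integrableOn_Ioo_of_le ht.1]
  have hsub : ∀ s ∈ Ioo 0 t, s ∈ Ioo 0 T := fun s hs => ⟨hs.1, hs.2.trans_le ht.2⟩
  have e : ∀ s ∈ Ioo 0 t, ((2 * η + 2) * (2 * η))⁻¹ * deriv (fun s => potential η (ψ s)) s
      = crossTerm η (ψ s) (ψ' s) := by
    intro s hs
    rw [(P.deriv_potential hb hX hη (hsub s hs)).deriv]
    field_simp
  refine Integrable.mono' (integrable_const (|K ^ (2 * η)| * K ^ 2)) ?_ ?_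
  · refine (((measurable_deriv (fun s => potential η (ψ s))).const_mul
      ((2 * η + 2) * (2 * η))⁻¹).aestronglyMeasurable).congr ?_
    filter_upwards [ae_restrict_mem measurableSet_Ioo] with s hs using e s hs
  · filter_upwards [ae_restrict_mem measurableSet_Ioo] with s hs
    have hs' := Ioo_subset_Icc_self (hsub s hs)
    refine (norm_crossTerm_le hη (hb.norm_le s hs') (ψ' s)).trans ?_
    gcongr
    · exact le_abs_self _
    · exact hb.norm_deriv_le s hs'

omit hX in
theorem IsProfile.intervalIntegrable_potential (hη : 1 ≤ η) {t : ℝ} (ht : t ∈ Icc 0 T) :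
    IntervalIntegrable (fun s => s * potential η (ψ s)) volume 0 t := by
  refine ContinuousOn.intervalIntegrable ?_
  rw [uIcc_of_le ht.1]
  exact continuousOn_id.mul ((P.continuousOn_potential hb hη).mono (Icc_subset_Icc_right ht.2))

/-- This provides a second relation involving the time integral of the cross term, which allows its
elimination from the law for `‖Jψ‖²`. -/
theorem IsProfile.sq_mul_potential_eq (hη : 1 ≤ η) {t : ℝ} (ht : t ∈ Icc 0 T) :
    t ^ 2 * potential η (ψ t) = ∫ s in (0 : ℝ)..t, (2 * (s * potential η (ψ s))
      + s ^ 2 * ((2 * η + 2) * (2 * η * crossTerm η (ψ s) (ψ' s)))) := by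
  have hsub : Ioo 0 t ⊆ Ioo 0 T := Ioo_subset_Ioo_right ht.2
  have hi := (((P.intervalIntegrable_potential hb hη ht).const_mul 2).add
    (((((P.intervalIntegrable_crossTerm hb hX hη ht).const_mul (2 * η)).const_mul
      (2 * η + 2))).continuousOn_mul (continuous_pow 2).continuousOn))
  have h1 := intervalIntegral.integral_eq_sub_of_hasDerivAt_of_le ht.1
    (f := fun s => s ^ 2 * potential η (ψ s))
    (f' := fun s => 2 * (s * potential η (ψ s))
      + s ^ 2 * ((2 * η + 2) * (2 * η * crossTerm η (ψ s) (ψ' s))))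
    ((continuous_pow 2).continuousOn.mul
      ((P.continuousOn_potential hb hη).mono (Icc_subset_Icc_right ht.2)))
    (fun s hs => ?_) hi
  · rw [h1]; simp
  · have h2 := (hasDerivAt_pow 2 s).mul (P.deriv_potential hb hX hη (hsub hs))
    refine h2.congr_deriv ?_
    simp only [Nat.cast_ofNat, Nat.add_one_sub_one, pow_one]
    ring

/-- The pseudo-conformal conservation law. -/
theorem IsProfile.pseudoConformal_law (hη : 1 ≤ η) {M : ℝ}
    (hM : ∀ t ∈ Icc 0 T, ‖galilei h ψ' t‖ ≤ M) {t : ℝ} (ht : t ∈ Icc 0 T) :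
    ‖galilei h ψ' t‖ ^ 2 + 4 * t ^ 2 * lam / (η + 1) * potential η (ψ t)
      = ‖h 0‖ ^ 2 + 4 * lam * (2 - η) / (η + 1)
        * ∫ s in (0 : ℝ)..t, s * potential η (ψ s) := by
  have h1 := P.norm_galilei_sq_sub hb hX hη hM ht
  have h2 := P.sq_mul_potential_eq hb hX hη ht
  have h3 : galilei h ψ' 0 = h 0 := by simp [galilei]
  have hp := P.intervalIntegrable_potential hb hη ht
  have hc := (P.intervalIntegrable_crossTerm hb hX hη ht).continuousOn_mul
    (continuous_pow 2).continuousOn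
  set I := ∫ s in (0 : ℝ)..t, s * potential η (ψ s) with hI
  set Q := ∫ s in (0 : ℝ)..t, s ^ 2 * crossTerm η (ψ s) (ψ' s) with hQ
  have e1 : ∫ s in (0 : ℝ)..t, -(8 * lam * η * s) * (potential η (ψ s) / (2 * η + 2)
        + 2 * s * crossTerm η (ψ s) (ψ' s))
      = -(8 * lam * η) / (2 * η + 2) * I + -(16 * lam * η) * Q := by
    rw [hI, hQ, ← intervalIntegral.integral_const_mul, ← intervalIntegral.integral_const_mul,
      ← intervalIntegral.integral_add (hp.const_mul _) (hc.const_mul _)]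
    refine intervalIntegral.integral_congr fun s _ => ?_
    ring
  have e2 : ∫ s in (0 : ℝ)..t, (2 * (s * potential η (ψ s))
      + s ^ 2 * ((2 * η + 2) * (2 * η * crossTerm η (ψ s) (ψ' s))))
      = 2 * I + (2 * η + 2) * (2 * η) * Q := by
    rw [hI, hQ, ← intervalIntegral.integral_const_mul, ← intervalIntegral.integral_const_mul,
      ← intervalIntegral.integral_add (hp.const_mul _) (hc.const_mul _)]
    refine intervalIntegral.integral_congr fun s _ => ?_
    ring
  rw [e1, h3] at h1
  rw [e2] at h2
  -- Adding this to the identity for `‖Jψ‖²` cancels `±16λη Q`; the coefficient of `I` becomes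
  -- `8λ/(η+1) - 4λη/(η+1)`.
  have h4 : 4 * t ^ 2 * lam / (η + 1) * potential η (ψ t)
      = 4 * lam / (η + 1) * (2 * I + (2 * η + 2) * (2 * η) * Q) := by
    rw [← h2]; ring
  have h5 : ‖galilei h ψ' t‖ ^ 2 = ‖h 0‖ ^ 2 + (-(8 * lam * η) / (2 * η + 2) * I
      + -(16 * lam * η) * Q) := by linarith
  have hη1 : η + 1 ≠ 0 := by positivity
  rw [h4, h5, show 2 * η + 2 = 2 * (η + 1) by ring]
  field_simp
  ring

end Law

end NLSLine

/-! ### From the conservation law to the space-time estimate. -/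

namespace NLSLine

variable {η K lam T : ℝ} {q : ℕ} {ψ₀ : L2} {ψ : ℝ → L2}

theorem integral_weakDeriv_auxH (ψ : ℝ → L2) (t : ℝ) :
    ∫ x : ℝ, weakDeriv 2 (auxH ψ t) x = 0 :=
  integral_weakDeriv_two_eq_zero (L1.integrable_coeFn _)

theorem lintegral_enorm_sq_eq (f : L2) :
    ∫⁻ x, ‖f x‖ₑ ^ 2 = ENNReal.ofReal (‖f‖ ^ 2) := by
  rw [norm_sq_L2_eq, ofReal_integral_eq_lintegral_ofReal (integrable_norm_sq f)
    (ae_of_all _ fun _ => by positivity)]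
  refine lintegral_congr fun x => ?_
  rw [ENNReal.ofReal_pow (norm_nonneg _), ofReal_norm]

/-- Finiteness puts `(x + 2it∂)ψ` in `L²`; since `∂ψ` is there already, so is `xψ`. -/
theorem exists_isMulX_of_pseudoConformal_ne_top {t : ℝ} {g : L2} (D : HasL2Deriv (ψ t) g)
    (h : pseudoConformal lam η ψ t ≠ ⊤) :
    ∃ k : L2, IsMulX (ψ t) k ∧ pseudoConformal lam η ψ t
      = ((‖k + (2 * Complex.I * t) • g‖ ^ 2
        + 4 * t ^ 2 * lam / (η + 1) * potential η (ψ t) : ℝ) : EReal) := by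
  have hw := weakDeriv_ae_eq D.isWeakDeriv
  have e1 : ∫⁻ x : ℝ, ‖(x : ℂ) * ψ t x + 2 * Complex.I * t * weakDeriv 1 (ψ t) x‖ₑ ^ 2
      = ∫⁻ x : ℝ, ‖(x : ℂ) * ψ t x + 2 * Complex.I * t * g x‖ₑ ^ 2 := by
    refine lintegral_congr_ae ?_
    filter_upwards [hw] with x hx
    rw [hx]
  have hpc : pseudoConformal lam η ψ t
      = ((∫⁻ x : ℝ, ‖(x : ℂ) * ψ t x + 2 * Complex.I * t * g x‖ₑ ^ 2 : ℝ≥0∞) : EReal)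
        + ((4 * t ^ 2 * lam / (η + 1) * potential η (ψ t) : ℝ) : EReal) := by
    rw [pseudoConformal, e1, integral_weakDeriv_auxH, mul_zero, sub_zero, potential]
  have hfin : ∫⁻ x : ℝ, ‖(x : ℂ) * ψ t x + 2 * Complex.I * t * g x‖ₑ ^ 2 ≠ ⊤ := by
    intro htop
    rw [hpc, htop, EReal.coe_ennreal_top, EReal.top_add_coe] at h
    exact h rfl
  have hm : AEStronglyMeasurable (fun x : ℝ => (x : ℂ) * ψ t x) volume :=
    Complex.measurable_ofReal.aestronglyMeasurable.mul (Lp.aestronglyMeasurable _)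
  have hj : MemLp (fun x : ℝ => (x : ℂ) * ψ t x + 2 * Complex.I * t * g x) 2 volume := by
    refine ⟨hm.add ((Lp.aestronglyMeasurable g).const_mul _), ?_⟩
    refine (eLpNorm_lt_top_iff_lintegral_rpow_enorm_lt_top two_ne_zero ENNReal.ofNat_ne_top).2 ?_
    simpa using hfin.lt_top
  have hk : MemLp (fun x : ℝ => (x : ℂ) * ψ t x) 2 volume := by
    refine (hj.sub ((Lp.memLp g).const_mul (2 * Complex.I * t))).ae_eq (ae_of_all _ fun x => ?_)
    simp
  have hX : IsMulX (ψ t) (hk.toLp _) := hk.coeFn_toLp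
  refine ⟨hk.toLp _, hX, ?_⟩
  rw [hpc, EReal.coe_add]
  congr 1
  rw [show (∫⁻ x : ℝ, ‖(x : ℂ) * ψ t x + 2 * Complex.I * t * g x‖ₑ ^ 2)
    = ∫⁻ x : ℝ, ‖(hk.toLp _ + (2 * Complex.I * t) • g : L2) x‖ₑ ^ 2 by
      refine lintegral_congr_ae ?_
      filter_upwards [hX, coeFn_add_smul (hk.toLp _) g (2 * Complex.I * t)] with x h1 h2
      rw [h2, h1], lintegral_enorm_sq_eq, EReal.coe_ennreal_ofReal, max_eq_left (by positivity)]

theorem morawetzIntegral_eq (hη : 0 ≤ η) (hT : 0 ≤ T)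
    (hK : ∀ t ∈ Icc 0 T, ∀ᵐ x : ℝ, ‖ψ t x‖ ≤ K)
    (hc : ContinuousOn (fun s => potential η (ψ s)) (Icc 0 T)) :
    morawetzIntegral η T ψ = ENNReal.ofReal (∫ s in (0 : ℝ)..T, s * potential η (ψ s)) := by
  have e1 : ∀ t ∈ Icc 0 T, ∫⁻ x : ℝ, ENNReal.ofReal (t * ‖ψ t x‖ ^ (2 * η + 2))
      = ENNReal.ofReal (t * potential η (ψ t)) := by
    intro t ht
    rw [potential, ← integral_const_mul, ofReal_integral_eq_lintegral_ofReal
      ((integrable_potential hη (hK t ht)).const_mul t)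
      (ae_of_all _ fun x => mul_nonneg ht.1 (by positivity))]
  have hi : IntegrableOn (fun s => s * potential η (ψ s)) (Icc 0 T) :=
    (continuousOn_id.mul hc).integrableOn_Icc
  rw [morawetzIntegral, setLIntegral_congr_fun measurableSet_Icc e1,
    intervalIntegral.integral_of_le hT, ← integral_Icc_eq_integral_Ioc,
    ofReal_integral_eq_lintegral_ofReal hi]
  filter_upwards [ae_restrict_mem measurableSet_Icc] with t ht
  exact mul_nonneg ht.1 (potential_nonneg _ _)

/-- Everything the estimates use about a solution of finite pseudo-conformal energy. -/
structure HasPseudoConformalLaw (lam η T S : ℝ) (ψ : ℝ → L2) (a : ℝ → ℝ) (k : L2) : Prop where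
  nonneg : ∀ t ∈ Icc 0 T, 0 ≤ a t
  isMulX : IsMulX (ψ 0) k
  law : ∀ t ∈ Icc 0 T, a t ^ 2 + 4 * t ^ 2 * lam / (η + 1) * potential η (ψ t)
    = ‖k‖ ^ 2 + 4 * lam * (2 - η) / (η + 1) * ∫ s in (0 : ℝ)..t, s * potential η (ψ s)
  le : ∀ t ∈ Icc 0 T, a t ^ 2 + 4 * t ^ 2 * lam / (η + 1) * potential η (ψ t) ≤ S
  decay : ∀ t ∈ Ioc 0 T, potential η (ψ t) ≤ (t⁻¹ * (‖ψ 0‖ * a t)) ^ η * ‖ψ 0‖ ^ 2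
  continuousOn : ContinuousOn (fun s => potential η (ψ s)) (Icc 0 T)
  morawetzIntegral_eq :
    morawetzIntegral η T ψ = ENNReal.ofReal (∫ s in (0 : ℝ)..T, s * potential η (ψ s))

theorem IsMildSolution.exists_law (H : IsMildSolution lam η q T ψ₀ ψ) (hη : 1 ≤ η) (hq : 1 ≤ q)
    (hT : 0 < T) (hS : ⨆ t ∈ Icc 0 T, pseudoConformal lam η ψ t ≠ ⊤) :
    ψ 0 = ψ₀ ∧ ∃ S a k, ⨆ t ∈ Icc 0 T, pseudoConformal lam η ψ t = ((S : ℝ) : EReal) ∧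
      HasPseudoConformalLaw lam η T S ψ a k := by
  obtain ⟨K, ψ', hb⟩ := H.exists_isBoundedH1 hq
  obtain ⟨v, w, P, hv0⟩ := H.exists_isProfile hη hT hb.norm_le
  have h0 : (0 : ℝ) ∈ Icc 0 T := ⟨le_rfl, hT.le⟩
  have hψ0 : ψ 0 = ψ₀ := by rw [P.eq_freeEvolution 0 h0, freeEvolution_zero, hv0]
  have hle : ∀ t ∈ Icc 0 T, pseudoConformal lam η ψ t ≤ ⨆ t ∈ Icc 0 T, pseudoConformal lam η ψ t :=
    fun t ht => le_iSup₂ (f := fun t (_ : t ∈ Icc 0 T) => pseudoConformal lam η ψ t) t ht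
  have hex : ∀ t, ∃ k : L2, t ∈ Icc 0 T → IsMulX (ψ t) k ∧ pseudoConformal lam η ψ t
      = ((‖k + (2 * Complex.I * t) • ψ' t‖ ^ 2
        + 4 * t ^ 2 * lam / (η + 1) * potential η (ψ t) : ℝ) : EReal) := by
    intro t
    by_cases ht : t ∈ Icc 0 T
    · obtain ⟨k, hk⟩ := exists_isMulX_of_pseudoConformal_ne_top (hb.hasL2Deriv t ht)
        (ne_top_of_le_ne_top hS (hle t ht))
      exact ⟨k, fun _ => hk⟩
    · exact ⟨0, fun h => absurd h ht⟩
  choose h hh using hex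
  have hX : ∀ t ∈ Icc 0 T, IsMulX (ψ t) (h t) := fun t ht => (hh t ht).1
  have hbot : ⨆ t ∈ Icc 0 T, pseudoConformal lam η ψ t ≠ ⊥ := by
    refine ne_bot_of_le_ne_bot ?_ (hle 0 h0)
    rw [(hh 0 h0).2]
    exact EReal.coe_ne_bot _
  obtain ⟨S, hSe⟩ : ∃ S : ℝ, ⨆ t ∈ Icc 0 T, pseudoConformal lam η ψ t = (S : EReal) :=
    ⟨_, (EReal.coe_toReal hS hbot).symm⟩
  have hleS : ∀ t ∈ Icc 0 T, ‖galilei h ψ' t‖ ^ 2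
      + 4 * t ^ 2 * lam / (η + 1) * potential η (ψ t) ≤ S := by
    intro t ht
    have := hle t ht
    rw [(hh t ht).2, hSe] at this
    exact EReal.coe_le_coe_iff.1 this
  have hmass : ∀ t ∈ Icc 0 T, ‖ψ t‖ = ‖ψ 0‖ := fun t ht => by
    rw [P.norm_eq hb hη ht, hψ0, hv0]
  -- A crude bound from finiteness of `S` and `y ≤ y² + 1`, needed only as the dominating constant
  -- in the proof of the law.
  have hM : ∀ t ∈ Icc 0 T, ‖galilei h ψ' t‖
      ≤ S + 4 * T ^ 2 * |lam| / (η + 1) * (|K ^ (2 * η)| * ‖ψ 0‖ ^ 2) + 1 := by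
    intro t ht
    have h1 := hleS t ht
    have h2 : potential η (ψ t) ≤ |K ^ (2 * η)| * ‖ψ 0‖ ^ 2 := by
      refine (potential_le (by linarith) (hb.norm_le t ht)).trans ?_
      rw [hmass t ht]
      gcongr
      exact le_abs_self _
    have h3 : |4 * t ^ 2 * lam / (η + 1) * potential η (ψ t)|
        ≤ 4 * T ^ 2 * |lam| / (η + 1) * (|K ^ (2 * η)| * ‖ψ 0‖ ^ 2) := by
      rw [abs_mul, abs_div, abs_mul, abs_of_nonneg (by positivity : 0 ≤ 4 * t ^ 2),
        abs_of_pos (by positivity : 0 < η + 1), abs_of_nonneg (potential_nonneg η (ψ t))]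
      have := ht.1
      have := ht.2
      have := potential_nonneg η (ψ t)
      gcongr
    have h4 := (abs_le.1 h3).1
    nlinarith [sq_nonneg (‖galilei h ψ' t‖ - 1)]
  refine ⟨hψ0, S, fun t => ‖galilei h ψ' t‖, h 0, hSe, fun _ _ => norm_nonneg _, hX 0 h0,
    fun t ht => P.pseudoConformal_law hb hX hη hM ht, hleS, fun t ht => ?_,
    P.continuousOn_potential hb hη,
    NLSLine.morawetzIntegral_eq (by linarith) hT.le hb.norm_le (P.continuousOn_potential hb hη)⟩
  have ht' := Ioc_subset_Icc_self ht
  have h1 := potential_le (η := η) (by linarith) (((hb.hasL2Deriv t ht').norm_sq_le_galilei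
    (hX t ht') ht.1).mono fun x hx => Real.le_sqrt_of_sq_le hx)
  rw [hmass t ht', Real.sqrt_eq_rpow, ← Real.rpow_mul (by have := ht.1; positivity),
    show 1 / 2 * (2 * η) = η by ring] at h1
  exact h1

/-- Either `a ≤ X`, or `X^η ≤ a^η` and the whole inequality can be divided by `a^η`. The assumption
`η < 2` leaves the positive power `2 - η` of `a`. -/
theorem le_mul_of_sq_le {a X N : ℝ} (ha : 0 ≤ a) (hX : 0 ≤ X) (hN : 0 ≤ N) (hη : 0 < η)
    (hη₂ : η < 2) (h : a ^ 2 ≤ X ^ 2 + N * X ^ (2 - η) * a ^ η) :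
    a ≤ (1 + N) ^ (2 - η)⁻¹ * X := by
  have hη2 : 0 < 2 - η := by linarith
  have sq_eq : ∀ {y : ℝ}, 0 ≤ y → y ^ 2 = y ^ (2 - η) * y ^ η := fun {y} hy => by
    rw [← Real.rpow_add_of_nonneg hy hη2.le hη.le, sub_add_cancel, Real.rpow_two]
  rcases le_or_gt a X with hle | hlt
  · refine hle.trans (le_mul_of_one_le_left hX (Real.one_le_rpow (by linarith) ?_))
    positivity
  have ha0 : 0 < a := hX.trans_lt hlt
  have h1 : a ^ (2 - η) * a ^ η ≤ ((1 + N) * X ^ (2 - η)) * a ^ η := by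
    rw [← sq_eq ha]
    refine h.trans ?_
    rw [sq_eq hX]
    have : X ^ (2 - η) * X ^ η ≤ X ^ (2 - η) * a ^ η := by gcongr
    linarith
  have h2 : a ^ (2 - η) ≤ (1 + N) * X ^ (2 - η) := le_of_mul_le_mul_right h1 (by positivity)
  have h3 := Real.rpow_le_rpow (by positivity) h2 (inv_nonneg.2 hη2.le)
  rwa [Real.mul_rpow (by positivity) (by positivity), Real.rpow_rpow_inv ha hη2.ne',
    Real.rpow_rpow_inv hX hη2.ne'] at h3

theorem HasPseudoConformalLaw.morawetz_of_pos {S : ℝ} {a : ℝ → ℝ} {k : L2}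
    (L : HasPseudoConformalLaw lam η T S ψ a k) (hT : 0 ≤ T) (hη : 1 ≤ η) (hη₂ : η < 2)
    (hlam : 0 < lam) :
    ∫ s in (0 : ℝ)..T, s * potential η (ψ s) ≤ (η + 1) / (4 * lam * (2 - η)) * S := by
  have h1 := L.law T ⟨hT, le_rfl⟩
  have h2 := L.le T ⟨hT, le_rfl⟩
  have hη2 : 0 < 2 - η := by linarith
  have h3 : 4 * lam * (2 - η) / (η + 1) * ∫ s in (0 : ℝ)..T, s * potential η (ψ s) ≤ S := by
    nlinarith [sq_nonneg ‖k‖]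
  have h4 : (η + 1) / (4 * lam * (2 - η)) = (4 * lam * (2 - η) / (η + 1))⁻¹ := by
    rw [inv_div]
  rw [h4, ← div_eq_inv_mul, le_div_iff₀ (by positivity), mul_comm]
  exact h3

/-- The constant of the estimate in the focusing case. -/
def focusingConstant (lam η T R : ℝ) : ℝ :=
  (4 * Real.pi * R) ^ (2 - η) * R ^ (3 * η - 2) *
    ((1 + 4 * |lam| / (η + 1) * T ^ (2 - η) * ((4 * Real.pi * R) ^ (2 - η) * R ^ (3 * η - 2)))
      ^ (2 - η)⁻¹) ^ η * (T ^ (2 - η) / (2 - η))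

/-- A bootstrap-free bound on `‖Jψ‖` by `X`: every power of the mass beyond those converted into `X`
is absorbed into `R`, so the final estimate is exactly quadratic in `X`. -/
theorem HasPseudoConformalLaw.morawetz_of_nonpos {S R : ℝ} {a : ℝ → ℝ} {k g : L2}
    (L : HasPseudoConformalLaw lam η T S ψ a k) (hT : 0 < T) (hη : 1 ≤ η) (hη₂ : η < 2)
    (hlam : lam ≤ 0) (hR : ‖ψ 0‖ ≤ R) (hg : HasL2Deriv (ψ 0) g) (hgR : ‖g‖ ≤ 2 * Real.pi * R) :
    ∫ s in (0 : ℝ)..T, s * potential η (ψ s) ≤ focusingConstant lam η T R * S := by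
  have hη2 : 0 < 2 - η := by linarith
  have hR0 : 0 ≤ R := (norm_nonneg _).trans hR
  set X := ‖k‖ with hX
  set m := ‖ψ 0‖ with hm
  set E := (4 * Real.pi * R) ^ (2 - η) * R ^ (3 * η - 2) with hE
  set N := 4 * |lam| / (η + 1) * T ^ (2 - η) * E with hN
  have hX0 : 0 ≤ X := norm_nonneg _
  have hm0 : 0 ≤ m := norm_nonneg _
  have hE0 : 0 ≤ E := by positivity
  have hN0 : 0 ≤ N := by positivity
  have hmX : m ^ 2 ≤ 4 * Real.pi * R * X := by
    refine (hg.norm_sq_le_uncertainty L.isMulX).trans ?_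
    calc 2 * (X * ‖g‖) ≤ 2 * (X * (2 * Real.pi * R)) := by gcongr
      _ = 4 * Real.pi * R * X := by ring
  -- The exponent splits as `2 + η = 2(2-η) + (3η-2)`: the first part becomes `X^{2-η}` by the
  -- uncertainty principle, the rest is bounded by `R` since `3η - 2 ≥ 0`.
  have hmE : m ^ 2 * m ^ η ≤ E * X ^ (2 - η) := by
    have e : m ^ 2 * m ^ η = (m ^ 2) ^ (2 - η) * m ^ (3 * η - 2) := by
      rw [← Real.rpow_two, ← Real.rpow_mul hm0, ← Real.rpow_add_of_nonneg hm0 (by norm_num)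
        (by linarith), ← Real.rpow_add_of_nonneg hm0 (by linarith) (by linarith)]
      congr 1; ring
    rw [e, hE, mul_right_comm, ← Real.mul_rpow (by positivity) hX0]
    have : 0 ≤ 3 * η - 2 := by linarith
    gcongr
  have hB : ∀ t ∈ Ioc 0 T, potential η (ψ t) ≤ t ^ (-η) * (E * X ^ (2 - η) * a t ^ η) := by
    intro t ht
    have ha := L.nonneg t (Ioc_subset_Icc_self ht)
    refine (L.decay t ht).trans ?_
    rw [Real.mul_rpow (by have := ht.1; positivity) (by positivity), Real.mul_rpow hm0 ha,
      Real.inv_rpow ht.1.le, ← Real.rpow_neg ht.1.le]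
    calc t ^ (-η) * (m ^ η * a t ^ η) * m ^ 2 = t ^ (-η) * (m ^ 2 * m ^ η * a t ^ η) := by ring
      _ ≤ _ := by
        have := ht.1
        gcongr
  have hI0 : ∀ t ∈ Icc 0 T, 0 ≤ ∫ s in (0 : ℝ)..t, s * potential η (ψ s) := fun t ht =>
    intervalIntegral.integral_nonneg ht.1 fun s hs => mul_nonneg hs.1 (potential_nonneg _ _)
  have ha : ∀ t ∈ Ioc 0 T, a t ≤ (1 + N) ^ (2 - η)⁻¹ * X := by
    intro t ht
    have ht' := Ioc_subset_Icc_self ht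
    have ha0 := L.nonneg t ht'
    refine le_mul_of_sq_le ha0 hX0 hN0 (by linarith) hη₂ ?_
    have h1 := L.law t ht'
    have h2 : 4 * lam * (2 - η) / (η + 1) * ∫ s in (0 : ℝ)..t, s * potential η (ψ s) ≤ 0 :=
      mul_nonpos_of_nonpos_of_nonneg (div_nonpos_of_nonpos_of_nonneg
        (mul_nonpos_of_nonpos_of_nonneg (by linarith) hη2.le) (by linarith)) (hI0 t ht')
    have h3 : -(4 * t ^ 2 * lam / (η + 1) * potential η (ψ t)) ≤ N * X ^ (2 - η) * a t ^ η := by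
      have e : -(4 * t ^ 2 * lam / (η + 1) * potential η (ψ t))
          = 4 * |lam| / (η + 1) * (t ^ 2 * potential η (ψ t)) := by
        rw [abs_of_nonpos hlam]; ring
      have e2 : t ^ 2 * t ^ (-η) = t ^ (2 - η) := by
        rw [← Real.rpow_two, ← Real.rpow_add ht.1, sub_eq_add_neg]
      rw [e]
      calc 4 * |lam| / (η + 1) * (t ^ 2 * potential η (ψ t))
          ≤ 4 * |lam| / (η + 1) * (t ^ 2 * (t ^ (-η) * (E * X ^ (2 - η) * a t ^ η))) := by
            gcongr
            exact hB t ht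
        _ = 4 * |lam| / (η + 1) * t ^ (2 - η) * (E * X ^ (2 - η) * a t ^ η) := by
            rw [← e2]; ring
        _ ≤ 4 * |lam| / (η + 1) * T ^ (2 - η) * (E * X ^ (2 - η) * a t ^ η) := by
            have := ht.1.le
            have := ht.2
            gcongr
        _ = N * X ^ (2 - η) * a t ^ η := by rw [hN]; ring
    linarith
  -- At `t = 0` the functional reduces to `X²`.
  have hS : X ^ 2 ≤ S := by
    have h1 := L.law 0 ⟨le_rfl, hT.le⟩
    have h2 := L.le 0 ⟨le_rfl, hT.le⟩
    rw [intervalIntegral.integral_same, mul_zero, add_zero] at h1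
    linarith
  set c := E * ((1 + N) ^ (2 - η)⁻¹) ^ η * X ^ 2 with hc
  have hpt : ∀ t ∈ Ioo 0 T, t * potential η (ψ t) ≤ c * t ^ (1 - η) := by
    intro t ht
    have ht' : t ∈ Ioc 0 T := Ioo_subset_Ioc_self ht
    have ha0 := L.nonneg t (Ioc_subset_Icc_self ht')
    have e1 : X ^ (2 - η) * X ^ η = X ^ 2 := by
      rw [← Real.rpow_add_of_nonneg hX0 hη2.le (by linarith), sub_add_cancel, Real.rpow_two]
    have e2 : t * t ^ (-η) = t ^ (1 - η) := by
      rw [sub_eq_add_neg, Real.rpow_add ht.1, Real.rpow_one]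
    have ht0 := ht.1.le
    calc t * potential η (ψ t) ≤ t * (t ^ (-η) * (E * X ^ (2 - η) * a t ^ η)) := by
          gcongr
          exact hB t ht'
      _ = t ^ (1 - η) * (E * X ^ (2 - η) * a t ^ η) := by rw [← e2]; ring
      _ ≤ t ^ (1 - η) * (E * X ^ (2 - η) * ((1 + N) ^ (2 - η)⁻¹ * X) ^ η) := by
          gcongr
          exact ha t ht'
      _ = c * t ^ (1 - η) := by
          rw [Real.mul_rpow (by positivity) hX0, hc, ← e1]; ring
  have hint : IntervalIntegrable (fun s => s * potential η (ψ s)) volume 0 T := by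
    refine ContinuousOn.intervalIntegrable ?_
    rw [uIcc_of_le hT.le]
    exact continuousOn_id.mul L.continuousOn
  -- The comparison is on the open interval, since decay is available only for `t > 0`; `t^{1-η}` is
  -- integrable at `0` because `η < 2`.
  have h1 := intervalIntegral.integral_mono_on_of_le_Ioo hT.le hint
    ((intervalIntegral.intervalIntegrable_rpow' (by linarith : -1 < 1 - η)).const_mul c) hpt
  rw [intervalIntegral.integral_const_mul, integral_rpow (Or.inl (by linarith)),
    show 1 - η + 1 = 2 - η by ring, Real.zero_rpow hη2.ne', sub_zero] at h1
  refine h1.trans ?_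
  rw [focusingConstant, ← hE, ← hN, hc]
  calc E * ((1 + N) ^ (2 - η)⁻¹) ^ η * X ^ 2 * (T ^ (2 - η) / (2 - η))
      = E * ((1 + N) ^ (2 - η)⁻¹) ^ η * (T ^ (2 - η) / (2 - η)) * X ^ 2 := by ring
    _ ≤ _ := by gcongr

theorem morawetzEstimate_of_le {C S I : ℝ} (hC : 0 ≤ C) (hS : 0 ≤ S)
    (hI : morawetzIntegral η T ψ = ENNReal.ofReal I)
    (hsup : ⨆ t ∈ Icc 0 T, pseudoConformal lam η ψ t = (S : EReal)) (h : I ≤ C * S) :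
    MorawetzEstimate lam η T C ψ := by
  rw [MorawetzEstimate, hI, hsup, EReal.coe_ennreal_ofReal, ← EReal.coe_mul,
    EReal.coe_le_coe_iff]
  exact max_le h (by positivity)

/-- Strict positivity matters because `0 * ⊤ = 0` in `EReal`. `focusingConstant` vanishes at `R =
0`, hence the `+ 1` added to it. -/
theorem morawetzEstimate_of_eq_top {C : ℝ} (hC : 0 < C)
    (hsup : ⨆ t ∈ Icc 0 T, pseudoConformal lam η ψ t = ⊤) : MorawetzEstimate lam η T C ψ := by
  rw [MorawetzEstimate, hsup, EReal.coe_mul_top_of_pos hC]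
  exact le_top

theorem HasPseudoConformalLaw.nonneg_bound {S : ℝ} {a : ℝ → ℝ} {k : L2}
    (L : HasPseudoConformalLaw lam η T S ψ a k) (hT : 0 ≤ T) : 0 ≤ S := by
  have h := L.le 0 ⟨le_rfl, hT⟩
  have e : 4 * (0 : ℝ) ^ 2 * lam / (η + 1) * potential η (ψ 0) = 0 := by simp
  rw [e, add_zero] at h
  exact (sq_nonneg _).trans h

theorem IsMildSolution.morawetzEstimate_of_pos (H : IsMildSolution lam η q T ψ₀ ψ)
    (hη₁ : 1 ≤ η) (hη₂ : η < 2) (hq : 1 ≤ q) (hT : 0 < T) (hlam : 0 < lam) :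
    MorawetzEstimate lam η T ((η + 1) / (4 * lam * (2 - η))) ψ := by
  have hη2 : 0 < 2 - η := by linarith
  by_cases hS : ⨆ t ∈ Icc 0 T, pseudoConformal lam η ψ t = ⊤
  · exact morawetzEstimate_of_eq_top (by positivity) hS
  obtain ⟨-, S, a, k, hSe, L⟩ := H.exists_law hη₁ hq hT hS
  exact morawetzEstimate_of_le (by positivity) (L.nonneg_bound hT.le) L.morawetzIntegral_eq hSe
    (L.morawetz_of_pos hT.le hη₁ hη₂ hlam)

theorem IsMildSolution.morawetzEstimate_of_nonpos (H : IsMildSolution lam η q T ψ₀ ψ)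
    (hη₁ : 1 ≤ η) (hη₂ : η < 2) (hq : 1 ≤ q) (hT : 0 < T) (hlam : lam ≤ 0) {R : ℝ≥0}
    (hR : sobolevNorm q ψ₀ ≤ R) :
    MorawetzEstimate lam η T (focusingConstant lam η T R + 1) ψ := by
  have hη2 : 0 < 2 - η := by linarith
  have hC : 0 ≤ focusingConstant lam η T R := by
    rw [focusingConstant]; positivity
  by_cases hS : ⨆ t ∈ Icc 0 T, pseudoConformal lam η ψ t = ⊤
  · exact morawetzEstimate_of_eq_top (by positivity) hS
  obtain ⟨hψ0, S, a, k, hSe, L⟩ := H.exists_law hη₁ hq hT hS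
  have hS0 := L.nonneg_bound hT.le
  have hR' : (sobolevNorm q ψ₀).toReal ≤ R := ENNReal.toReal_le_coe_of_le_coe hR
  obtain ⟨g, hg, hgR⟩ := H.datum_mem.exists_hasL2Deriv hq
  refine morawetzEstimate_of_le (by positivity) hS0 L.morawetzIntegral_eq hSe ?_
  have := L.morawetz_of_nonpos hT hη₁ hη₂ hlam (R := R) (g := g)
    (by rw [hψ0]; exact (norm_le_sobolevNorm H.datum_mem).trans hR') (by rwa [hψ0])
    (hgR.trans (by gcongr))
  linarith

end NLSLine

end

theorem theorem1p6 (lam η : ℝ) (hη₁ : 1 ≤ η) (hη₂ : η < 2) :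
    (0 < lam →
      ∃ C : ℝ, 0 < C ∧
        ∀ (q : ℕ), (1 / 2 : ℝ) < q → η ≤ q →
          ∀ (T : ℝ), 0 < T → ∀ (ψ₀ : NLSLine.L2) (ψ : ℝ → NLSLine.L2),
            NLSLine.IsMildSolution lam η q T ψ₀ ψ →
              NLSLine.MorawetzEstimate lam η T C ψ) ∧
    (∀ (T : ℝ), 0 < T → ∀ (R : ℝ≥0),
      ∃ C : ℝ, 0 < C ∧
        ∀ (q : ℕ), (1 / 2 : ℝ) < q → η ≤ q →
          ∀ (ψ₀ : NLSLine.L2) (ψ : ℝ → NLSLine.L2),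
            NLSLine.sobolevNorm q ψ₀ ≤ R →
            NLSLine.IsMildSolution lam η q T ψ₀ ψ →
              NLSLine.MorawetzEstimate lam η T C ψ) := by
  -- An integer above `1/2` is at least `1`, and `H¹` regularity is all the argument uses.
  have hq1 : ∀ q : ℕ, (1 / 2 : ℝ) < q → 1 ≤ q := fun q hq => by
    rcases Nat.eq_zero_or_pos q with rfl | h
    · norm_num at hq
    · exact h
  have hη2 : 0 < 2 - η := by linarith
  refine ⟨fun hlam => ⟨(η + 1) / (4 * lam * (2 - η)), by positivity,
    fun q hq _ T hT ψ₀ ψ H => H.morawetzEstimate_of_pos hη₁ hη₂ (hq1 q hq) hT hlam⟩,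
    fun T hT R => ?_⟩
  rcases lt_or_ge 0 lam with hlam | hlam
  · exact ⟨(η + 1) / (4 * lam * (2 - η)), by positivity,
      fun q hq _ ψ₀ ψ _ H => H.morawetzEstimate_of_pos hη₁ hη₂ (hq1 q hq) hT hlam⟩
  · have hC : 0 ≤ NLSLine.focusingConstant lam η T R := by
      rw [NLSLine.focusingConstant]; positivity
    exact ⟨NLSLine.focusingConstant lam η T R + 1, by positivity,
      fun q hq _ ψ₀ ψ hR H => H.morawetzEstimate_of_nonpos hη₁ hη₂ (hq1 q hq) hT hlam hR⟩
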